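/- **Notation.** Let $\lambda>1$, $\mathbb{T}_\lambda=\mathbb{R}/2\pi\lambda\mathbb{Z}$, and for frequencies $\zeta=(\xi,q)\in\mathbb{R}\times\mathbb{Z}/\lambda$ write $|\zeta|=(3\xi^2+q^2)^{1/2}$, $\sigma(\zeta)=\xi^3+\xi q^2$, $\langle x\rangle=1+|x|$. With $\widehat v(\xi,q,\tau)=\int_{\mathbb{R}^2}\int_0^{2\pi\lambda}e^{-i(t\tau+x\xi+yq)}v\,dy\,dx\,dt$, let $$\|v\|_{X^{1,b}_\lambda}=\Big(\frac1\lambda\sum_{q\in\mathbb{Z}/\lambda}\int_{\mathbb{R}^2}\langle\tau-\sigma(\zeta)\rangle^{2b}\langle|\zeta|\rangle^{2}|\widehat v(\xi,q,\tau)|^2\,d\xi\,d\tau\Big)^{1/2},$$ and let $\|w\|_{X^{1,b}_{\delta,\lambda}}$ be the infimum of $\|v\|_{X^{1,b}_\lambda}$ over all complex-valued $v$ on $\mathbb{R}\times\mathbb{T}_\lambda\times\mathbb{R}$ that agree with $w$ on $\mathbb{R}\times\mathbb{T}_\lambda\times[0,\delta]$. For $s\in\mathbb{R}$, $A\in\mathbb{R}$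 and a dyadic number $N=2^n$, $n\in\mathbb{N}=\{0,1,2,\dots\}$, let $I$ be the Fourier multiplier operator in $(x,y)$ with multiplier $m(|\zeta|)$, where $m$ is smooth and non-increasing, $m(r)=1$ for $r\le N$, $m(r)=(r/N)^{s-1}$ for $r\ge 2N$, and $|m'|\le A/N$. (The last condition makes the choice of $m$ uniform in $N$; it holds for $m(r)=m_1(r/N)$ with a fixed profile $m_1$ and $A=\sup|m_1'|$. Since $m$ is non-increasing, $s\le1$.) For a space-time function $u$ put $$J_\delta(u)=\int_0^\delta\!\int_{\mathbb{R}\times\mathbb{T}_\lambda}I\Delta u\;\partial_x\big((Iu)^2-I(u^2)\big)\,dx\,dy\,dt,$$ with $\Delta=\partial_x^2+\partial_y^2$. **Lemma.** Let $s>9/10$, $b>1/2$, $\varepsilon>0$ and $A\in\mathbb{R}$. There is a constant $C$, depending only on $s,b,\varepsilon,A$, such that for all $\lambda>1$, all dyadic $N=2^n$, all $m$ as above, all $\delta>0$ and all complex-valued $u\in L^2(\mathbb{R}\times\mathbb{T}_\lambda\times[0,\delta])$ with $\|Iu\|_{X^{1,b}_{\delta,\lambda}}<\infty$, the following holds. Let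 $P_{\le M}$ denote the sharp Fourier truncation to $|\zeta|\le M$. Then the limit $J=\lim_{M\to\infty}J_\delta(P_{\le M}u)$ exists; it equals $J_\delta(u)$, as an ordinary integral, whenever $u\in L^\infty([0,\delta];H^2(\mathbb{R}\times\mathbb{T}_\lambda))$; and $$|J|\le C\,N^{-\frac1{10}+\varepsilon}\,\|Iu\|_{X^{1,b}_{\delta,\lambda}}^3 .$$ -/

import Mathlib

open Real MeasureTheory Filter Topology
open scoped ENNReal FourierTransform ContDiff

namespace ZK

/-- The circle of length `2πl` has positive length when `l > 1`. -/
instance period_pos (l : ℝ) [h : Fact (1 < l)] : Fact (0 < 2 * π * l) :=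
  ⟨mul_pos two_pi_pos (one_pos.trans h.out)⟩

/-- The cylinder `ℝ × 𝕋_l`, where `𝕋_l = ℝ / 2πlℤ`; its `volume` is Lebesgue measure, of total mass
`2πl` in the periodic variable. -/
abbrev Cyl (l : ℝ) : Type := ℝ × AddCircle (2 * π * l)

/-- The modified length `|(ξ, q)| = (3ξ² + q²)^{1/2}` of a frequency. -/
noncomputable def freqNorm (ξ q : ℝ) : ℝ := √(3 * ξ ^ 2 + q ^ 2)

/-- The dispersion relation `σ(ξ, q) = ξ³ + ξq²`. -/
def dispersion (ξ q : ℝ) : ℝ := ξ ^ 3 + ξ * q ^ 2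

/-- The bracket `⟨x⟩ = 1 + |x|`. -/
def bracket (x : ℝ) : ℝ := 1 + |x|

/-- The Plancherel transform of `g ∈ L²(E)`, normalised as `∫ e^{-i⟨x, w⟩} g(x) dx`. (The transform
`𝓕` has the phase `e^{-2πi⟨x, w⟩}`.) The value is `0` when `g ∉ L²`. -/
noncomputable def plancherel {E : Type*} [NormedAddCommGroup E] [InnerProductSpace ℝ E]
    [FiniteDimensional ℝ E] [MeasurableSpace E] [BorelSpace E] (g : E → ℂ) : E → ℂ :=
  open Classical in
  if h : MemLp g 2 (volume : Measure E) then
    fun w => (𝓕 (h.toLp g) : Lp ℂ 2 (volume : Measure E)) ((2 * π)⁻¹ • w)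
  else 0

section Space

variable (l : ℝ) [Fact (1 < l)]

/-- The Fourier transform `∫_ℝ ∫_0^{2πl} e^{-i(xξ + yq)} f(x, y) dy dx`, `q = k / l`, of a function
`f ∈ L²(ℝ × 𝕋_l)`. Here `fourier (-k) y = e^{-iky/l}`. -/
noncomputable def spaceFT (f : Cyl l → ℂ) (k : ℤ) : ℝ → ℂ :=
  plancherel fun x : ℝ => ∫ y : AddCircle (2 * π * l), fourier (-k) y * f (x, y)

/-- The Fourier transform `∫∫_{ℝ²} ∫_0^{2πl} e^{-i(tτ + xξ + yq)} v(t, x, y) dy dx dt`, `q = k / l`,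
of a function `v ∈ L²(ℝ × ℝ × 𝕋_l)`, evaluated at `p = (τ, ξ)`. -/
noncomputable def spaceTimeFT (v : ℝ → Cyl l → ℂ) (k : ℤ) : EuclideanSpace ℝ (Fin 2) → ℂ :=
  plancherel fun p : EuclideanSpace ℝ (Fin 2) =>
    ∫ y : AddCircle (2 * π * l), fourier (-k) y * v (p 0) (p 1, y)

/-- The norm of `H^s(ℝ × 𝕋_l)` on `L²` functions (with value `∞` off `L²`), `s ≥ 0`. -/
noncomputable def sobolevNorm (s : ℝ) (f : Cyl l → ℂ) : ℝ≥0∞ :=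
  open Classical in
  if MemLp f 2 volume then
    (ENNReal.ofReal (2 * π * l)⁻¹ * ∑' k : ℤ, ∫⁻ ξ : ℝ,
      ENNReal.ofReal (bracket (freqNorm ξ (k / l)) ^ (2 * s)) *
        ‖spaceFT l f k ξ‖ₑ ^ 2) ^ (1 / 2 : ℝ)
  else ⊤

/-- The norm of the Bourgain space `X^{s,b}_l` on `L²` functions (with value `∞` off `L²`). For
`s, b ≥ 0`, the only case in which it is used, `X^{s,b}_l` consists of `L²` functions. -/
noncomputable def bourgainNorm (s b : ℝ) (v : ℝ → Cyl l → ℂ) : ℝ≥0∞ :=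
  open Classical in
  if MemLp (fun p : ℝ × Cyl l => v p.1 p.2) 2 volume then
    (ENNReal.ofReal l⁻¹ * ∑' k : ℤ, ∫⁻ p : EuclideanSpace ℝ (Fin 2),
      ENNReal.ofReal (bracket (p 0 - dispersion (p 1) (k / l)) ^ (2 * b) *
        bracket (freqNorm (p 1) (k / l)) ^ (2 * s)) *
        ‖spaceTimeFT l v k p‖ₑ ^ 2) ^ (1 / 2 : ℝ)
  else ⊤

/-- The norm of the restricted space `X^{s,b}_{l,δ}`: the infimum of the norms of all extensions
to `ℝ × ℝ × 𝕋_l` of the restriction of `w` to times in `[0, δ]` (`∞` if there is none in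
`X^{s,b}_l`). -/
noncomputable def bourgainNormOn (s b δ : ℝ) (w : ℝ → Cyl l → ℂ) : ℝ≥0∞ :=
  ⨅ (v : ℝ → Cyl l → ℂ)
    (_ : ∀ᵐ t ∂(volume.restrict (Set.Icc 0 δ)), v t =ᵐ[volume] w t), bourgainNorm l s b v

/-- The Fourier multiplier operator with symbol `a(ξ, q)` on functions on the cylinder: the `L²`
function `g`, unique up to null sets, with `ĝ = a f̂`, and `0` if there is none. -/
noncomputable def fourierMul (a : ℝ → ℝ → ℂ) (f : Cyl l → ℂ) : Cyl l → ℂ :=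
  open Classical in
  if h : ∃ g : Cyl l → ℂ, MemLp g 2 volume ∧
      ∀ k : ℤ, spaceFT l g k =ᵐ[volume] fun ξ => a ξ (k / l) * spaceFT l f k ξ then
    h.choose
  else 0

/-- The derivative `∂_x`. -/
noncomputable def partialX (f : Cyl l → ℂ) : Cyl l → ℂ :=
  fourierMul l (fun ξ _ => Complex.I * (ξ : ℂ)) f

/-- The Laplacian `Δ = ∂_x² + ∂_y²`. -/
noncomputable def laplacian (f : Cyl l → ℂ) : Cyl l → ℂ :=
  fourierMul l (fun ξ q => -((ξ ^ 2 + q ^ 2 : ℝ) : ℂ)) f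

/-- The operator `I` with radial multiplier `m(|(ξ, q)|)`. -/
noncomputable def opI (m : ℝ → ℝ) (f : Cyl l → ℂ) : Cyl l → ℂ :=
  fourierMul l (fun ξ q => (m (freqNorm ξ q) : ℂ)) f

/-- The sharp frequency truncation to `|(ξ, q)| ≤ M`. -/
noncomputable def truncate (M : ℝ) (f : Cyl l → ℂ) : Cyl l → ℂ :=
  fourierMul l (fun ξ q => if freqNorm ξ q ≤ M then 1 else 0) f

/-- The cubic term `∫_0^δ ∫_{ℝ × 𝕋_l} IΔu ∂_x((Iu)² - I(u²)) dx dy dt`. -/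
noncomputable def cubicIncrement (m : ℝ → ℝ) (δ : ℝ) (u : ℝ → Cyl l → ℂ) : ℂ :=
  ∫ t in (0 : ℝ)..δ, ∫ z : Cyl l,
    opI l m (laplacian l (u t)) z *
      partialX l (fun z' => opI l m (u t) z' ^ 2 - opI l m (fun z'' => u t z'' ^ 2) z') z

end Space

/-- `m`, as a function of `r = |(ξ, q)|`, is an admissible multiplier for `I` at the frequency `N`:
smooth, non-increasing, equal to `1` for `r ≤ N` and to `(r / N)^{s-1}` for `r ≥ 2N`, and with
derivative at most `A / N`. (For `m(r) = m₁(r / N)` with a fixed profile `m₁`, the last condition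
holds with `A = sup |m₁'|`.) -/
structure IsMultiplier (s A N : ℝ) (m : ℝ → ℝ) : Prop where
  smooth : ContDiff ℝ ∞ m
  antitone : Antitone m
  low : ∀ r, r ≤ N → m r = 1
  high : ∀ r, 2 * N ≤ r → m r = (r / N) ^ (s - 1)
  deriv_le : ∀ r, |deriv m r| ≤ A / N

end ZK

set_option linter.unusedSectionVars false

/-! On the Fourier side the increment is a trilinear form over frequencies with ζ₁ + ζ₂ + ζ₃ = 0.
Expressed through an extension v of Iu, its symbol is i ξ₁(ξ₁² + q₁²)(1 - m₁/(m₂m₃)), where mⱼ =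
m(|ζⱼ|), and it is integrated against `timeKer`, the integral over [0, δ] of the product of the
three spatial transforms of v(t). Everything rests on the absolute convergence of this form, with a
quantitative bound, for v in the Bourgain space.

The analytic tool is a Cauchy–Schwarz criterion, `sq_trilinear_le`. If the integral of K(ζ, ζ₀ -
ζ)⟨τ - σ(ζ) - σ(ζ₀ - ζ)⟩^{-2b} over ζ is bounded uniformly in τ and ζ₀, then √K⟨ζ₁⟩⟨ζ₂⟩⟨ζ₃⟩ is an
admissible symbol. Only two of the three factors need the modulation weight. The third is needed
merely in L², so the sharp cutoff to [0, δ] is put on it and costs nothing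
(`lintegral_windowFT_sq_le`); hence the uniformity in δ.

Two kernels pass the test. Since ∂_ξ σ = |ζ|², the difference of squared moduli is the Jacobian of
the phase along a line of fixed q; with a weight ⟨q⟩^{-11/10} to sum over q this gives
`lintegral_gapKer_le`. If all three moduli nearly agree the triangle of frequencies is nearly
equilateral, which confines q to two short intervals of length about R^{3/10}. On each line the
phase is quadratic with leading coefficient 3ξ₀, and |ξ₀| ≳ R gives measure R^{-1/2}. A weight
R^{1/5} is then affordable, because 1/5 + 3/10 = 1/2 (`lintegral_nearKer_le`).

It remains to dominate the square of the symbol pointwise by N^{-1/5}(⟨ζ₁⟩⟨ζ₂⟩⟨ζ₃⟩)² times a sum of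
such kernels (`sq_redSymbol_le`). If the two larger frequencies are at most of size N/2 the symbol
vanishes. If one of ζ₂, ζ₃ is much smaller than the other, regularity of m gains and the gap kernel
is large. If all are comparable, either two moduli differ and the gap kernel is large, or all nearly
agree and one vector has a large ξ-component, so the other kernel applies. The condition s > 9/10
enters as 1/m(r) ≲ max(r/N, 1)^{1/10}. A square root yields N^{-1/10}.

The bounding density does not depend on the truncation, so the limit in M is dominated convergence
(`exists_increment_limit`). For data bounded in H² the same formula holds without truncation.
Finally the limit J does not know the extension, so the infimum over extensions may be taken. -/

namespace ZK

/-! ### The Fourier transform on L² of a Euclidean space: bilinear identities -/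

section PlancherelLp

variable {E : Type*} [NormedAddCommGroup E] [InnerProductSpace ℝ E]
    [FiniteDimensional ℝ E] [MeasurableSpace E] [BorelSpace E]

theorem lpPairing_mul_apply (f g : Lp ℂ 2 (volume : Measure E)) :
    ContinuousLinearMap.lpPairing volume 2 2 (ContinuousLinearMap.mul ℂ ℂ) f g =
      ∫ x, f x * g x :=
  ContinuousLinearMap.lpPairing_eq_integral _ _ _

/-- Both sides are continuous in the pair (f, g), so the classical identity for Schwartz functions
extends by density. -/
theorem lp_integral_fourier_mul (f g : Lp ℂ 2 (volume : Measure E)) :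
    ∫ x, (𝓕 f : Lp ℂ 2 (volume : Measure E)) x * g x =
      ∫ x, f x * (𝓕 g : Lp ℂ 2 (volume : Measure E)) x := by
  have hd := SchwartzMap.denseRange_toLpCLM (E := E) (F := ℂ) (p := 2) (μ := volume)
    ENNReal.ofNat_ne_top
  simp only [← lpPairing_mul_apply]
  generalize hB : ContinuousLinearMap.lpPairing (volume : Measure E) 2 2
    (ContinuousLinearMap.mul ℂ ℂ) = B
  generalize hF : (𝓕 : Lp ℂ 2 (volume : Measure E) → Lp ℂ 2 (volume : Measure E)) = Φ
  have hΦ : Continuous Φ := hF ▸ (Lp.fourierTransformₗᵢ E ℂ).continuous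
  refine DenseRange.induction_on₂ (p := fun f g => B (Φ f) g = B f (Φ g)) hd
    (isClosed_eq (by fun_prop) (by fun_prop)) ?_ f g
  · intro a b
    subst hB hF
    simp only [lpPairing_mul_apply]
    have ha : ∀ a : SchwartzMap E ℂ, SchwartzMap.toLpCLM ℝ ℂ 2 (volume : Measure E) a =
      a.toLp 2 (volume : Measure E) := fun _ => rfl
    rw [ha a, ha b, SchwartzMap.toLp_fourier_eq, SchwartzMap.toLp_fourier_eq]
    have := SchwartzMap.integral_fourier_mul_eq a b
    convert this using 1
    · apply integral_congr_ae
      filter_upwards [SchwartzMap.coeFn_toLp (𝓕 a) 2 volume, SchwartzMap.coeFn_toLp b 2 volume]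
        with x h1 h2
      rw [h1, h2]
    · apply integral_congr_ae
      filter_upwards [SchwartzMap.coeFn_toLp (𝓕 b) 2 volume, SchwartzMap.coeFn_toLp a 2 volume]
        with x h1 h2
      rw [h1, h2]

theorem lp_fourierInv_eq_comp_neg (f : Lp ℂ 2 (volume : Measure E)) :
    (𝓕⁻ f : Lp ℂ 2 (volume : Measure E)) =
      Lp.compMeasurePreserving (fun x : E => -x) (Measure.measurePreserving_neg _) (𝓕 f) := by
  have hd := SchwartzMap.denseRange_toLpCLM (E := E) (F := ℂ) (p := 2) (μ := volume)
    ENNReal.ofNat_ne_top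
  refine hd.induction_on (p := fun f : Lp ℂ 2 (volume : Measure E) =>
    (𝓕⁻ f : Lp ℂ 2 (volume : Measure E)) =
      Lp.compMeasurePreserving (fun x : E => -x) (Measure.measurePreserving_neg _) (𝓕 f)) f ?_ ?_
  · apply isClosed_eq
    · exact (Lp.fourierTransformₗᵢ E ℂ).symm.continuous
    · exact (Lp.isometry_compMeasurePreserving (Measure.measurePreserving_neg _)).continuous.comp
        (Lp.fourierTransformₗᵢ E ℂ).continuous
  · intro a
    change (𝓕⁻ (a.toLp 2) : Lp ℂ 2 (volume : Measure E)) =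
      Lp.compMeasurePreserving (fun x : E => -x) (Measure.measurePreserving_neg _) (𝓕 (a.toLp 2))
    rw [SchwartzMap.toLp_fourier_eq, SchwartzMap.toLp_fourierInv_eq]
    apply Lp.ext
    have h1 := SchwartzMap.coeFn_toLp (𝓕 a) 2 volume
    have h2 := (Measure.measurePreserving_neg (volume : Measure E)).quasiMeasurePreserving.ae_eq h1
    filter_upwards [SchwartzMap.coeFn_toLp (𝓕⁻ a) 2 volume, h2,
      Lp.coeFn_compMeasurePreserving ((𝓕 a).toLp 2 volume)
        (Measure.measurePreserving_neg (volume : Measure E))] with x h3 h4 h5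
    rw [h3, h5, h4, SchwartzMap.fourierInv_coe, Function.comp, SchwartzMap.fourier_coe,
      Real.fourierInv_eq_fourier_neg]

/-- The multiplication formula applied to f and 𝓕⁻ g. The bilinear form of Parseval is the useful
one, since the increment contains no complex conjugates. -/
theorem lp_integral_mul_eq (f g : Lp ℂ 2 (volume : Measure E)) :
    ∫ x, f x * g x = ∫ x, (𝓕 f : Lp ℂ 2 (volume : Measure E)) x *
      (𝓕 g : Lp ℂ 2 (volume : Measure E)) (-x) := by
  have h := lp_integral_fourier_mul f (𝓕⁻ g)
  have h1 : (𝓕 (𝓕⁻ g) : Lp ℂ 2 (volume : Measure E)) = g :=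
    (Lp.fourierTransformₗᵢ E ℂ).apply_symm_apply g
  rw [h1] at h
  rw [← h]
  apply integral_congr_ae
  filter_upwards [Lp.coeFn_compMeasurePreserving (𝓕 g)
        (Measure.measurePreserving_neg (volume : Measure E))] with x hx
  rw [lp_fourierInv_eq_comp_neg, hx, Function.comp]

/-- On `L¹ ∩ L²` the Plancherel transform is the Fourier integral. -/
theorem lp_fourier_ae_eq {f : E → ℂ} (h1 : Integrable f) (h2 : MemLp f 2 volume) :
    (𝓕 (h2.toLp f) : Lp ℂ 2 (volume : Measure E)) =ᵐ[volume] 𝓕 f := by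
  have hc : Continuous (𝓕 f) :=
    VectorFourier.fourierIntegral_continuous Real.continuous_fourierChar
      (by exact continuous_inner) h1
  -- Tested against smooth compactly supported functions, both transforms obey the multiplication
  -- formula, one by the L² version and one by the L¹ version.
  refine ae_eq_of_integral_contDiff_smul_eq
    ((Lp.memLp _).locallyIntegrable (by norm_num)) hc.locallyIntegrable ?_
  intro g hg hgc
  have hgc' : HasCompactSupport (fun x => (g x : ℂ)) := hgc.comp_left (g := fun r : ℝ => (r : ℂ)) rfl
  let φ := hgc'.toSchwartzMap (Complex.ofRealCLM.contDiff.comp hg)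
  have hφ : ∀ x, φ x = (g x : ℂ) := fun x => rfl
  have e1 := lp_integral_fourier_mul (φ.toLp 2 (volume : Measure E)) (h2.toLp f)
  have e2 : ∫ x, 𝓕 (φ : E → ℂ) x * f x = ∫ x, φ x * 𝓕 f x := by
    have := VectorFourier.integral_fourierIntegral_smul_eq_flip (μ := (volume : Measure E))
      (ν := (volume : Measure E)) (L := innerₗ E) (f := φ) (g := f) Real.continuous_fourierChar
      (by exact continuous_inner) φ.integrable h1
    rw [flip_innerₗ] at this
    exact this
  rw [SchwartzMap.toLp_fourier_eq] at e1
  calc ∫ x, g x • (𝓕 (h2.toLp f) : Lp ℂ 2 (volume : Measure E)) x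
      = ∫ x, (φ.toLp 2 (volume : Measure E)) x *
          (𝓕 (h2.toLp f) : Lp ℂ 2 (volume : Measure E)) x := by
        apply integral_congr_ae
        filter_upwards [SchwartzMap.coeFn_toLp φ 2 volume] with x hx
        rw [hx, hφ, Complex.real_smul]
    _ = ∫ x, 𝓕 (φ : E → ℂ) x * f x := by
        rw [← e1]
        apply integral_congr_ae
        filter_upwards [SchwartzMap.coeFn_toLp (𝓕 φ) 2 volume, h2.coeFn_toLp] with x hx hx'
        rw [hx, hx', SchwartzMap.fourier_coe]
    _ = ∫ x, g x • 𝓕 f x := by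
        rw [e2]
        simp only [hφ, Complex.real_smul]

end PlancherelLp


theorem lintegral_enorm_sq_eq {α F : Type*} [MeasurableSpace α] [NormedAddCommGroup F]
    (μ : Measure α) (f : α → F) : ∫⁻ x, ‖f x‖ₑ ^ 2 ∂μ = eLpNorm f 2 μ ^ 2 := by
  rw [eLpNorm_eq_lintegral_rpow_enorm_toReal (by norm_num) (by norm_num)]
  simp only [ENNReal.toReal_ofNat]
  rw [← ENNReal.rpow_natCast, ← ENNReal.rpow_mul]
  norm_num

theorem memLp_two_iff {α F : Type*} [MeasurableSpace α] [NormedAddCommGroup F]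
    {μ : Measure α} {f : α → F} :
    MemLp f 2 μ ↔ AEStronglyMeasurable f μ ∧ ∫⁻ x, ‖f x‖ₑ ^ 2 ∂μ ≠ ⊤ := by
  rw [lintegral_enorm_sq_eq]
  constructor
  · intro h
    exact ⟨h.1, ENNReal.pow_ne_top h.2.ne⟩
  · intro h
    refine ⟨h.1, lt_top_iff_ne_top.mpr fun h' => h.2 ?_⟩
    rw [h']; simp

/-! ### The transform with phase e^{-i⟨x, w⟩} -/

section Plancherel

variable {E : Type*} [NormedAddCommGroup E] [InnerProductSpace ℝ E]
    [FiniteDimensional ℝ E] [MeasurableSpace E] [BorelSpace E]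

theorem plancherel_of_memLp {g : E → ℂ} (h : MemLp g 2 (volume : Measure E)) :
    plancherel g =
      fun w => (𝓕 (h.toLp g) : Lp ℂ 2 (volume : Measure E)) ((2 * π)⁻¹ • w) := by
  unfold plancherel
  rw [dif_pos h]

theorem plancherel_stronglyMeasurable (g : E → ℂ) : StronglyMeasurable (plancherel g) := by
  unfold plancherel
  split_ifs with h
  · exact (Lp.stronglyMeasurable _).comp_measurable (measurable_const_smul _)
  · exact stronglyMeasurable_zero

theorem plancherel_congr {g h : E → ℂ} (hgh : g =ᵐ[volume] h) : plancherel g = plancherel h := by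
  by_cases hg : MemLp g 2 (volume : Measure E)
  · have hh := (memLp_congr_ae hgh).mp hg
    rw [plancherel_of_memLp hg, plancherel_of_memLp hh, MemLp.toLp_congr hg hh hgh]
  · have hh : ¬ MemLp h 2 (volume : Measure E) := fun h' => hg ((memLp_congr_ae hgh).mpr h')
    unfold plancherel
    rw [dif_neg hg, dif_neg hh]

theorem quasiMeasurePreserving_const_smul {r : ℝ} (hr : r ≠ 0) :
    Measure.QuasiMeasurePreserving (fun x : E => r • x) volume volume :=
  ⟨measurable_const_smul r, by
    rw [Measure.map_addHaar_smul _ hr]; exact Measure.smul_absolutelyContinuous⟩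

theorem lintegral_comp_const_smul {r : ℝ} (hr : 0 < r) {f : E → ℝ≥0∞} (hf : Measurable f) :
    ∫⁻ x, f (r⁻¹ • x) = ENNReal.ofReal (r ^ Module.finrank ℝ E) * ∫⁻ x, f x := by
  rw [← lintegral_map (μ := volume) (f := f) (g := fun x : E => r⁻¹ • x) hf
    (measurable_const_smul _),
    Measure.map_addHaar_smul _ (inv_ne_zero hr.ne'), lintegral_smul_measure, smul_eq_mul,
    inv_pow, inv_inv, abs_of_pos (by positivity)]

/-- Mathlib's transform is isometric; the power of 2π is the Jacobian of the rescaling w ↦ w/2π. -/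
theorem lintegral_plancherel {g : E → ℂ} (h : MemLp g 2 (volume : Measure E)) :
    ∫⁻ w, ‖plancherel g w‖ₑ ^ 2 =
      ENNReal.ofReal ((2 * π) ^ Module.finrank ℝ E) * ∫⁻ x, ‖g x‖ₑ ^ 2 := by
  rw [plancherel_of_memLp h]
  have hm : Measurable fun x => ‖(𝓕 (h.toLp g) : Lp ℂ 2 (volume : Measure E)) x‖ₑ ^ 2 :=
    (Lp.stronglyMeasurable _).measurable.enorm.pow_const 2
  rw [lintegral_comp_const_smul two_pi_pos hm]
  congr 1
  have e : ∀ F : Lp ℂ 2 (volume : Measure E), ∫⁻ x, ‖F x‖ₑ ^ 2 = ENNReal.ofReal (‖F‖ ^ 2) := by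
    intro F
    rw [lintegral_enorm_sq_eq, Lp.norm_def, ENNReal.ofReal_pow ENNReal.toReal_nonneg,
      ENNReal.ofReal_toReal (Lp.eLpNorm_ne_top F)]
  rw [e, Lp.norm_fourier_eq, ← e]
  apply lintegral_congr_ae
  filter_upwards [h.coeFn_toLp] with x hx
  rw [hx]

theorem memLp_plancherel (g : E → ℂ) : MemLp (plancherel g) 2 (volume : Measure E) := by
  by_cases h : MemLp g 2 (volume : Measure E)
  · rw [memLp_two_iff]
    refine ⟨(plancherel_stronglyMeasurable g).aestronglyMeasurable, ?_⟩
    rw [lintegral_plancherel h]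
    exact ENNReal.mul_ne_top ENNReal.ofReal_ne_top (memLp_two_iff.mp h).2
  · unfold plancherel
    rw [dif_neg h]
    exact MemLp.zero

theorem plancherel_sub {g h : E → ℂ} (hg : MemLp g 2 (volume : Measure E))
    (hh : MemLp h 2 (volume : Measure E)) :
    plancherel (fun x => g x - h x) =ᵐ[volume] fun w => plancherel g w - plancherel h w := by
  have hs : MemLp (fun x => g x - h x) 2 (volume : Measure E) := hg.sub hh
  rw [plancherel_of_memLp hs, plancherel_of_memLp hg, plancherel_of_memLp hh]
  have e : hs.toLp = hg.toLp - hh.toLp := rfl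
  have e2 : (𝓕 (hs.toLp) : Lp ℂ 2 (volume : Measure E)) = 𝓕 hg.toLp - 𝓕 hh.toLp := by
    rw [e]
    exact (Lp.fourierTransformₗᵢ E ℂ).map_sub _ _
  rw [e2]
  have := (quasiMeasurePreserving_const_smul (E := E)
    (inv_ne_zero two_pi_pos.ne')).ae_eq (Lp.coeFn_sub (𝓕 hg.toLp) (𝓕 hh.toLp))
  exact this

theorem integral_mul_eq_plancherel {g h : E → ℂ} (hg : MemLp g 2 (volume : Measure E))
    (hh : MemLp h 2 (volume : Measure E)) :
    ∫ x, g x * h x = (((2 * π) ^ Module.finrank ℝ E)⁻¹ : ℝ) *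
      ∫ w, plancherel g w * plancherel h (-w) := by
  rw [plancherel_of_memLp hg, plancherel_of_memLp hh]
  have h1 := lp_integral_mul_eq hg.toLp hh.toLp
  have h2 : ∫ x, hg.toLp g x * hh.toLp h x = ∫ x, g x * h x := by
    apply integral_congr_ae
    filter_upwards [hg.coeFn_toLp, hh.coeFn_toLp] with x hx hx'
    rw [hx, hx']
  rw [← h2, h1]
  have h3 := Measure.integral_comp_smul (volume : Measure E) (fun x =>
    (𝓕 hg.toLp : Lp ℂ 2 (volume : Measure E)) x * (𝓕 hh.toLp : Lp ℂ 2 (volume : Measure E)) (-x))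
    (2 * π)⁻¹
  simp only [smul_neg]
  rw [h3]
  rw [inv_pow, inv_inv, abs_of_pos (by positivity), Complex.real_smul, ← mul_assoc,
    ← Complex.ofReal_mul, inv_mul_cancel₀ (by positivity), Complex.ofReal_one, one_mul]

theorem fourier_smul_eq (g : E → ℂ) (w : E) :
    𝓕 g ((2 * π)⁻¹ • w) = ∫ x, Complex.exp (-(Complex.I * (inner ℝ x w : ℝ))) * g x := by
  rw [Real.fourier_eq']
  congr 1
  funext x
  rw [smul_eq_mul, inner_smul_right]
  congr 2
  have : (π : ℂ) ≠ 0 := by exact_mod_cast pi_pos.ne'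
  push_cast
  field_simp

theorem plancherel_ae_eq_integral {g : E → ℂ} (h1 : Integrable g)
    (h2 : MemLp g 2 (volume : Measure E)) :
    plancherel g =ᵐ[volume]
      fun w => ∫ x, Complex.exp (-(Complex.I * (inner ℝ x w : ℝ))) * g x := by
  rw [plancherel_of_memLp h2]
  filter_upwards [(quasiMeasurePreserving_const_smul (E := E)
    (inv_ne_zero two_pi_pos.ne')).ae_eq (lp_fourier_ae_eq h1 h2)] with w hw
  rw [← fourier_smul_eq]
  exact hw

/-- The inverse Fourier integral of `G`. -/
noncomputable def invFourierIntegral (G : E → ℂ) (x : E) : ℂ :=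
  (((2 * π) ^ Module.finrank ℝ E)⁻¹ : ℝ) *
    ∫ w, Complex.exp (Complex.I * (inner ℝ w x : ℝ)) * G w

theorem invFourierIntegral_eq (G : E → ℂ) (x : E) :
    invFourierIntegral G x = 𝓕 (fun w => G ((2 * π) • w)) (-x) := by
  have h3 := Measure.integral_comp_smul (volume : Measure E) (fun w =>
    Complex.exp (Complex.I * (inner ℝ w x : ℝ)) * G w) (2 * π)
  rw [invFourierIntegral, Real.fourier_eq', ← Complex.real_smul]
  rw [abs_of_pos (by positivity)] at h3
  rw [← h3]
  congr 1
  funext w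
  rw [smul_eq_mul, inner_smul_left, inner_neg_right]
  congr 2
  simp only [conj_trivial]
  push_cast
  ring

theorem integrable_and_memLp_comp_smul {G : E → ℂ} (h1 : Integrable G)
    (h2 : MemLp G 2 (volume : Measure E)) {r : ℝ} (hr : 0 < r) :
    Integrable (fun w => G (r • w)) ∧ MemLp (fun w => G (r • w)) 2 (volume : Measure E) := by
  refine ⟨h1.comp_smul hr.ne', ?_⟩
  exact MemLp.comp_of_map (f := fun w : E => r • w) (μ := volume)
    (by rw [Measure.map_addHaar_smul _ hr.ne']; exact h2.smul_measure ENNReal.ofReal_ne_top)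
    (measurable_const_smul r).aemeasurable

/-- After rescaling, the absolutely convergent integral coincides with the L² inverse transform, and
the latter is a genuine inverse on L². -/
theorem invFourierIntegral_memLp {G : E → ℂ} (h1 : Integrable G)
    (h2 : MemLp G 2 (volume : Measure E)) :
    MemLp (invFourierIntegral G) 2 (volume : Measure E) ∧
      plancherel (invFourierIntegral G) =ᵐ[volume] G := by
  obtain ⟨k1, k2⟩ := integrable_and_memLp_comp_smul h1 h2 two_pi_pos
  have e : (𝓕⁻ k2.toLp : Lp ℂ 2 (volume : Measure E)) =ᵐ[volume] invFourierIntegral G := by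
    rw [lp_fourierInv_eq_comp_neg]
    filter_upwards [Lp.coeFn_compMeasurePreserving (𝓕 k2.toLp)
        (Measure.measurePreserving_neg (volume : Measure E)),
      (Measure.measurePreserving_neg (volume : Measure E)).quasiMeasurePreserving.ae_eq
        (lp_fourier_ae_eq k1 k2)] with x hx hx'
    rw [hx, hx', invFourierIntegral_eq]
    rfl
  have hm : MemLp (invFourierIntegral G) 2 (volume : Measure E) :=
    (memLp_congr_ae e).mp (Lp.memLp _)
  refine ⟨hm, ?_⟩
  rw [plancherel_of_memLp hm]
  have e3 : hm.toLp = (𝓕⁻ k2.toLp : Lp ℂ 2 (volume : Measure E)) := by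
    apply Lp.ext
    filter_upwards [hm.coeFn_toLp, e] with x hx hx'
    rw [hx, hx']
  have e4 : (𝓕 (𝓕⁻ k2.toLp) : Lp ℂ 2 (volume : Measure E)) = k2.toLp :=
    (Lp.fourierTransformₗᵢ E ℂ).apply_symm_apply _
  rw [e3, e4]
  filter_upwards [(quasiMeasurePreserving_const_smul (E := E)
    (inv_ne_zero two_pi_pos.ne')).ae_eq k2.coeFn_toLp] with w hw
  have := hw
  simp only [Function.comp, smul_smul] at this
  rw [mul_inv_cancel₀ two_pi_pos.ne', one_smul] at this
  exact this

end Plancherel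


/-! ### The frequency space of the cylinder -/

/-- The measure `l⁻¹ · counting × Lebesgue` on the frequency space `ℤ × ℝ`, where `(k, ξ)`
stands for the frequency `(ξ, k / l)`. -/
noncomputable def freqMeasure (l : ℝ) : Measure (ℤ × ℝ) :=
  (Real.toNNReal l⁻¹ • (Measure.count : Measure ℤ)).prod volume

instance (l : ℝ) : SigmaFinite (freqMeasure l) := by unfold freqMeasure; infer_instance

instance (l : ℝ) : (freqMeasure l).IsAddLeftInvariant := by unfold freqMeasure; infer_instance

instance count_neg_invariant : (Measure.count : Measure ℤ).IsNegInvariant := by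
  constructor
  ext s hs
  rw [Measure.neg_apply, Measure.count_apply hs.neg, Measure.count_apply hs]
  rw [← Set.image_neg_eq_neg]
  rw [neg_injective.encard_image]

instance freqMeasure_neg_invariant (l : ℝ) : (freqMeasure l).IsNegInvariant := by
  constructor
  unfold freqMeasure
  have h1 : MeasurePreserving (fun k : ℤ => -k) (Real.toNNReal l⁻¹ • (Measure.count : Measure ℤ))
      (Real.toNNReal l⁻¹ • (Measure.count : Measure ℤ)) :=
    (Measure.measurePreserving_neg (Measure.count : Measure ℤ)).smul_measure _
  exact (h1.prod (Measure.measurePreserving_neg (volume : Measure ℝ))).map_eq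

theorem lintegral_freqMeasure (l : ℝ) {f : ℤ × ℝ → ℝ≥0∞} (hf : Measurable f) :
    ∫⁻ p, f p ∂freqMeasure l = ENNReal.ofReal l⁻¹ * ∑' k : ℤ, ∫⁻ ξ : ℝ, f (k, ξ) := by
  unfold freqMeasure
  rw [lintegral_prod _ hf.aemeasurable]
  rw [lintegral_smul_measure, lintegral_count]
  rfl

theorem ae_freqMeasure {l : ℝ} (hl : 0 < l) {P : ℤ × ℝ → Prop} :
    (∀ᵐ p ∂freqMeasure l, P p) ↔ ∀ k : ℤ, ∀ᵐ ξ : ℝ, P (k, ξ) := by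
  unfold freqMeasure
  have hc : Real.toNNReal l⁻¹ ≠ 0 := by simpa using hl
  constructor
  · intro h
    have h1 := Measure.ae_ae_of_ae_prod h
    have h2 := (Measure.ae_smul_measure_iff (μ := (Measure.count : Measure ℤ)) hc).mp h1
    exact Measure.ae_count_iff.mp h2
  · intro h
    rw [ae_iff]
    refine measure_mono_null (t := ⋃ k : ℤ, {k} ×ˢ {ξ : ℝ | ¬ P (k, ξ)}) ?_ ?_
    · rintro ⟨k, ξ⟩ hk
      simp only [Set.mem_iUnion]
      exact ⟨k, rfl, hk⟩
    · rw [measure_iUnion_null_iff]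
      intro k
      rw [Measure.prod_prod, ae_iff.mp (h k), mul_zero]

theorem integral_freqMeasure {l : ℝ} (hl : 0 < l) {f : ℤ × ℝ → ℂ}
    (hf : Integrable f (freqMeasure l)) :
    ∫ p, f p ∂freqMeasure l = (l⁻¹ : ℝ) * ∑' k : ℤ, ∫ ξ : ℝ, f (k, ξ) := by
  unfold freqMeasure at *
  rw [integral_prod _ hf, integral_countable hf.integral_prod_left, ← tsum_mul_left]
  congr 1
  funext k
  have : (Real.toNNReal l⁻¹ • (Measure.count : Measure ℤ)).real {k} = l⁻¹ := by
    rw [measureReal_def, Measure.smul_apply, Measure.count_singleton]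
    have : 0 ≤ l⁻¹ := by positivity
    simp [ENNReal.smul_def, this]
  rw [this, Complex.real_smul]

/-! ### Fourier series on the circle -/

section Circle

variable {T : ℝ} [hT : Fact (0 < T)]

theorem fourierCoeff_eq_integral (g : AddCircle T → ℂ) (k : ℤ) :
    fourierCoeff g k = (T⁻¹ : ℝ) * ∫ y, fourier (-k) y * g y := by
  unfold fourierCoeff
  rw [AddCircle.integral_haarAddCircle, Complex.real_smul]
  simp only [smul_eq_mul]

theorem tsum_enorm_sq_integral_fourier {g : AddCircle T → ℂ} (hg : MemLp g 2 volume) :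
    ∑' k : ℤ, ‖∫ y, fourier (-k) y * g y‖ₑ ^ 2 = ENNReal.ofReal T * ∫⁻ y, ‖g y‖ₑ ^ 2 := by
  have hg' : MemLp g 2 (AddCircle.haarAddCircle (T := T)) := memLp_haarAddCircle_iff.mpr hg
  have hT0 : 0 < T := hT.out
  have h := hasSum_sq_fourierCoeff hg'.toLp
  have hc : ∀ k : ℤ, fourierCoeff (hg'.toLp g) k = (T⁻¹ : ℝ) * ∫ y, fourier (-k) y * g y := by
    intro k
    rw [← fourierCoeff_eq_integral]
    exact congrFun (fourierCoeff_congr_ae hg'.coeFn_toLp) k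
  have hi : ∫ t, ‖hg'.toLp g t‖ ^ 2 ∂AddCircle.haarAddCircle = T⁻¹ * ∫ t, ‖g t‖ ^ 2 := by
    rw [integral_congr_ae (g := fun t => ‖g t‖ ^ 2), AddCircle.integral_haarAddCircle, smul_eq_mul]
    filter_upwards [hg'.coeFn_toLp] with x hx
    rw [hx]
  simp only [hc, hi] at h
  have h2 : HasSum (fun k : ℤ => ‖∫ y, fourier (-k) y * g y‖ ^ 2) (T * ∫ t, ‖g t‖ ^ 2) := by
    have e1 : (fun k : ℤ => ‖∫ y, fourier (-k) y * g y‖ ^ 2) =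
        fun k : ℤ => T ^ 2 * ‖(T⁻¹ : ℝ) * ∫ y, fourier (-k) y * g y‖ ^ 2 := by
      funext k
      rw [norm_mul, Complex.norm_real, mul_pow, norm_of_nonneg (by positivity)]
      field_simp
    have e2 : T * ∫ t, ‖g t‖ ^ 2 = T ^ 2 * (T⁻¹ * ∫ t, ‖g t‖ ^ 2) := by field_simp
    rw [e1, e2]
    exact h.mul_left (T ^ 2)
  have h3 : ∫⁻ y, ‖g y‖ₑ ^ 2 = ENNReal.ofReal (∫ t, ‖g t‖ ^ 2) := by
    rw [ofReal_integral_eq_lintegral_ofReal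
      (by simpa using hg.integrable_norm_pow (by norm_num)) (ae_of_all _ fun _ => by positivity)]
    congr 1
    funext y
    rw [ENNReal.ofReal_pow (norm_nonneg _), ofReal_norm]
  rw [h3, ← ENNReal.ofReal_mul hT0.le, ← h2.tsum_eq,
    ENNReal.ofReal_tsum_of_nonneg (fun _ => by positivity) h2.summable]
  congr 1
  funext y
  rw [ENNReal.ofReal_pow (norm_nonneg _), ofReal_norm]

/-- The Hilbert basis expansion of the inner product of conj h with g: conjugation turns the
coefficient at k into that of h at -k. The factor T converts normalised Haar measure into Lebesgue
measure. -/
theorem hasSum_integral_fourier_mul {g h : AddCircle T → ℂ} (hg : MemLp g 2 volume)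
    (hh : MemLp h 2 volume) :
    HasSum (fun k : ℤ => (∫ y, fourier (-k) y * g y) * ∫ y, fourier (-(-k)) y * h y)
      (T * ∫ y, g y * h y) := by
  have hg' : MemLp g 2 (AddCircle.haarAddCircle (T := T)) := memLp_haarAddCircle_iff.mpr hg
  have hh' : MemLp h 2 (AddCircle.haarAddCircle (T := T)) := memLp_haarAddCircle_iff.mpr hh
  have hs' : MemLp (fun y => (starRingEnd ℂ) (h y)) 2 (AddCircle.haarAddCircle (T := T)) := hh'.star
  have hT0 : (T : ℂ) ≠ 0 := by exact_mod_cast hT.out.ne'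
  have h0 := fourierBasis.hasSum_inner_mul_inner hs'.toLp hg'.toLp
  have e1 : ∀ k : ℤ, inner ℂ (fourierBasis k) (hg'.toLp g) =
      (T⁻¹ : ℝ) * ∫ y, fourier (-k) y * g y := by
    intro k
    rw [← fourierCoeff_eq_integral, ← HilbertBasis.repr_apply_apply, fourierBasis_repr]
    exact congrFun (fourierCoeff_congr_ae hg'.coeFn_toLp) k
  have e2 : ∀ k : ℤ, inner ℂ hs'.toLp (fourierBasis k) =
      (T⁻¹ : ℝ) * ∫ y, fourier (-(-k)) y * h y := by
    intro k
    rw [L2.inner_def, ← fourierCoeff_eq_integral]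
    unfold fourierCoeff
    apply integral_congr_ae
    rw [coe_fourierBasis]
    filter_upwards [hs'.coeFn_toLp, coeFn_fourierLp (T := T) 2 k] with y hy hy'
    rw [hy, hy']
    simp [RCLike.inner_apply]
  have e3 : inner ℂ hs'.toLp hg'.toLp = (T⁻¹ : ℝ) * ∫ y, g y * h y := by
    rw [L2.inner_def, ← Complex.real_smul, ← AddCircle.integral_haarAddCircle]
    apply integral_congr_ae
    filter_upwards [hs'.coeFn_toLp, hg'.coeFn_toLp] with y hy hy'
    rw [hy, hy']
    simp [RCLike.inner_apply]
  simp only [e1, e2, e3] at h0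
  have f1 : (fun k : ℤ => (∫ y, fourier (-k) y * g y) * ∫ y, fourier (-(-k)) y * h y) =
      fun k : ℤ => (T : ℂ) ^ 2 * (((T⁻¹ : ℝ) * ∫ y, fourier (-(-k)) y * h y) *
        ((T⁻¹ : ℝ) * ∫ y, fourier (-k) y * g y)) := by
    funext k
    push_cast
    field_simp
  have f2 : T * ∫ y, g y * h y = (T : ℂ) ^ 2 * ((T⁻¹ : ℝ) * ∫ y, g y * h y) := by
    push_cast
    field_simp
  rw [f1, f2]
  exact h0.mul_left ((T : ℂ) ^ 2)

end Circle


/-! ### Plancherel's theorem on the cylinder -/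

section Cylinder

variable {l : ℝ} [hl : Fact (1 < l)]

/-- The `k`-th Fourier coefficient in the periodic variable, up to the factor `2πl`. -/
noncomputable def sliceCoeff (f : Cyl l → ℂ) (k : ℤ) (x : ℝ) : ℂ :=
  ∫ y : AddCircle (2 * π * l), fourier (-k) y * f (x, y)

/-- The Fourier transform on the cylinder as a function on `ℤ × ℝ`. -/
noncomputable def cylFT (f : Cyl l → ℂ) (p : ℤ × ℝ) : ℂ := spaceFT l f p.1 p.2

theorem l_pos : 0 < l := one_pos.trans hl.out

theorem sliceCoeff_aestronglyMeasurable {f : Cyl l → ℂ} (hf : AEStronglyMeasurable f volume)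
    (k : ℤ) : AEStronglyMeasurable (sliceCoeff f k) volume := by
  have h : AEStronglyMeasurable (fun z : Cyl l => fourier (-k) z.2 * f z)
      ((volume : Measure ℝ).prod volume) :=
    ((fourier (-k)).continuous.comp continuous_snd).aestronglyMeasurable.mul hf
  exact h.integral_prod_right'

theorem sliceCoeff_congr {f g : Cyl l → ℂ} (h : f =ᵐ[volume] g) (k : ℤ) :
    sliceCoeff f k =ᵐ[volume] sliceCoeff g k := by
  have h' : ∀ᵐ z ∂((volume : Measure ℝ).prod (volume : Measure (AddCircle (2 * π * l)))),
      f z = g z := h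
  filter_upwards [Measure.ae_ae_of_ae_prod h'] with x hx
  apply integral_congr_ae
  filter_upwards [hx] with y hy
  rw [hy]

theorem spaceFT_congr {f g : Cyl l → ℂ} (h : f =ᵐ[volume] g) (k : ℤ) :
    spaceFT l f k = spaceFT l g k := plancherel_congr (sliceCoeff_congr h k)

theorem cylFT_congr {f g : Cyl l → ℂ} (h : f =ᵐ[volume] g) : cylFT f = cylFT g := by
  funext p
  exact congrFun (spaceFT_congr h p.1) p.2

theorem cylFT_measurable (f : Cyl l → ℂ) : Measurable (cylFT f) :=
  measurable_from_prod_countable_right fun k =>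
    (plancherel_stronglyMeasurable (sliceCoeff f k)).measurable

theorem ae_memLp_slice {f : Cyl l → ℂ} (hf : MemLp f 2 volume) :
    ∀ᵐ x : ℝ, MemLp (fun y => f (x, y)) 2 volume := by
  have h := memLp_two_iff.mp hf
  have h1 : AEStronglyMeasurable f
    ((volume : Measure ℝ).prod (volume : Measure (AddCircle (2 * π * l)))) := h.1
  have h2 : ∫⁻ z, ‖f z‖ₑ ^ 2 ∂((volume : Measure ℝ).prod
    (volume : Measure (AddCircle (2 * π * l)))) ≠ ⊤ := h.2
  have hm : AEMeasurable (fun z => ‖f z‖ₑ ^ 2) ((volume : Measure ℝ).prod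
    (volume : Measure (AddCircle (2 * π * l)))) := h1.enorm.pow_const 2
  rw [lintegral_prod _ hm] at h2
  filter_upwards [h1.prodMk_left, ae_lt_top' hm.lintegral_prod_right' h2] with x hx hx'
  exact memLp_two_iff.mpr ⟨hx, hx'.ne⟩

/-- Parseval on almost every circle, integrated in x. Square integrability is asked of the slices
only, so that the identity can also serve to prove that f is in L². -/
theorem tsum_lintegral_sliceCoeff {f : Cyl l → ℂ} (hf : AEStronglyMeasurable f volume)
    (hs : ∀ᵐ x : ℝ, MemLp (fun y => f (x, y)) 2 volume) :
    ∑' k : ℤ, ∫⁻ x, ‖sliceCoeff f k x‖ₑ ^ 2 =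
      ENNReal.ofReal (2 * π * l) * ∫⁻ z, ‖f z‖ₑ ^ 2 := by
  have hm : AEMeasurable (fun z => ‖f z‖ₑ ^ 2) ((volume : Measure ℝ).prod
    (volume : Measure (AddCircle (2 * π * l)))) := hf.enorm.pow_const 2
  rw [Measure.volume_eq_prod, lintegral_prod _ hm,
    ← lintegral_tsum fun k => (sliceCoeff_aestronglyMeasurable hf k).enorm.pow_const 2,
    ← lintegral_const_mul' _ _ ENNReal.ofReal_ne_top]
  apply lintegral_congr_ae
  filter_upwards [hs] with x hx
  exact tsum_enorm_sq_integral_fourier hx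

theorem sliceCoeff_memLp {f : Cyl l → ℂ} (hf : MemLp f 2 volume) (k : ℤ) :
    MemLp (sliceCoeff f k) 2 volume := by
  rw [memLp_two_iff]
  refine ⟨sliceCoeff_aestronglyMeasurable hf.1 k, ?_⟩
  have h := tsum_lintegral_sliceCoeff hf.1 (ae_memLp_slice hf)
  refine ne_top_of_le_ne_top ?_ (ENNReal.le_tsum (f := fun k => ∫⁻ x, ‖sliceCoeff f k x‖ₑ ^ 2) k)
  rw [h]
  exact ENNReal.mul_ne_top ENNReal.ofReal_ne_top (memLp_two_iff.mp hf).2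

/-- Plancherel's theorem on the cylinder. -/
theorem lintegral_cylFT {f : Cyl l → ℂ} (hf : MemLp f 2 volume) :
    ∫⁻ p, ‖cylFT f p‖ₑ ^ 2 ∂freqMeasure l =
      ENNReal.ofReal ((2 * π) ^ 2) * ∫⁻ z, ‖f z‖ₑ ^ 2 := by
  have hl0 : 0 < l := l_pos
  rw [lintegral_freqMeasure l ((cylFT_measurable f).enorm.pow_const 2)]
  have h : ∀ k : ℤ, ∫⁻ ξ, ‖cylFT f (k, ξ)‖ₑ ^ 2 =
      ENNReal.ofReal (2 * π) * ∫⁻ x, ‖sliceCoeff f k x‖ₑ ^ 2 := by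
    intro k
    have := lintegral_plancherel (sliceCoeff_memLp hf k)
    rw [Module.finrank_self, pow_one] at this
    exact this
  simp only [h]
  rw [ENNReal.tsum_mul_left, tsum_lintegral_sliceCoeff hf.1 (ae_memLp_slice hf), ← mul_assoc,
    ← mul_assoc, ← ENNReal.ofReal_mul (by positivity), ← ENNReal.ofReal_mul (by positivity)]
  congr 2
  field_simp

theorem memLp_cylFT {f : Cyl l → ℂ} (hf : MemLp f 2 volume) :
    MemLp (cylFT f) 2 (freqMeasure l) := by
  rw [memLp_two_iff]
  refine ⟨(cylFT_measurable f).aestronglyMeasurable, ?_⟩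
  rw [lintegral_cylFT hf]
  exact ENNReal.mul_ne_top ENNReal.ofReal_ne_top (memLp_two_iff.mp hf).2

theorem cylFT_sub {f g : Cyl l → ℂ} (hf : MemLp f 2 volume) (hg : MemLp g 2 volume) :
    cylFT (fun z => f z - g z) =ᵐ[freqMeasure l] fun p => cylFT f p - cylFT g p := by
  refine (ae_freqMeasure l_pos).mpr fun k => ?_
  have h1 : sliceCoeff (fun z => f z - g z) k =ᵐ[volume]
      fun x => sliceCoeff f k x - sliceCoeff g k x := by
    filter_upwards [ae_memLp_slice hf, ae_memLp_slice hg] with x hx hx'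
    unfold sliceCoeff
    have hb : ∀ F : AddCircle (2 * π * l) → ℂ, MemLp F 2 volume →
        Integrable (fun y => fourier (-k) y * F y) volume := by
      intro F hF
      refine (hF.integrable (by norm_num)).bdd_mul (c := 1)
        (fourier (-k)).continuous.aestronglyMeasurable (ae_of_all _ fun y => ?_)
      rw [fourier_apply]
      exact (Circle.norm_coe _).le
    rw [← integral_sub (hb _ hx) (hb _ hx')]
    congr 1
    funext y
    ring
  have h2 := plancherel_sub (sliceCoeff_memLp hf k) (sliceCoeff_memLp hg k)
  rw [← plancherel_congr h1] at h2
  exact h2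

theorem ae_eq_of_cylFT {f g : Cyl l → ℂ} (hf : MemLp f 2 volume) (hg : MemLp g 2 volume)
    (h : cylFT f =ᵐ[freqMeasure l] cylFT g) : f =ᵐ[volume] g := by
  have hs : MemLp (fun z => f z - g z) 2 volume := hf.sub hg
  have h1 := lintegral_cylFT hs
  have h2 : ∫⁻ p, ‖cylFT (fun z => f z - g z) p‖ₑ ^ 2 ∂freqMeasure l = 0 := by
    rw [lintegral_eq_zero_iff' ((cylFT_measurable _).enorm.pow_const 2).aemeasurable]
    filter_upwards [cylFT_sub hf hg, h] with p hp hp'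
    rw [hp, hp']
    simp
  rw [h2] at h1
  have h3 := (mul_eq_zero.mp h1.symm).resolve_left (by
    rw [ENNReal.ofReal_eq_zero, not_le]; positivity)
  rw [lintegral_eq_zero_iff' (hs.1.enorm.pow_const 2)] at h3
  filter_upwards [h3] with z hz
  have : ‖f z - g z‖ₑ = 0 := by simpa using hz
  rw [enorm_eq_zero, sub_eq_zero] at this
  exact this

/-- Parseval's identity on the cylinder, in bilinear form. -/
theorem integral_mul_eq_cylFT {f g : Cyl l → ℂ} (hf : MemLp f 2 volume) (hg : MemLp g 2 volume) :
    ∫ z, f z * g z = (((2 * π) ^ 2)⁻¹ : ℝ) * ∫ p, cylFT f p * cylFT g (-p) ∂freqMeasure l := by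
  have hl0 : 0 < l := l_pos
  have hi : Integrable (fun z => f z * g z) ((volume : Measure ℝ).prod
    (volume : Measure (AddCircle (2 * π * l)))) := hf.integrable_mul hg
  have hG : MemLp (fun p => cylFT g (-p)) 2 (freqMeasure l) :=
    (memLp_cylFT hg).comp_measurePreserving (Measure.measurePreserving_neg _)
  have hi2 : Integrable (fun p => cylFT f p * cylFT g (-p)) (freqMeasure l) :=
    (memLp_cylFT hf).integrable_mul hG
  rw [integral_freqMeasure hl0 hi2,
    Measure.volume_eq_prod, integral_prod _ hi]
  have h1 : ∫ x, ∫ y, f (x, y) * g (x, y) = ((2 * π * l)⁻¹ : ℝ) *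
      ∫ x, ∑' k : ℤ, sliceCoeff f k x * sliceCoeff g (-k) x := by
    rw [← integral_const_mul]
    apply integral_congr_ae
    filter_upwards [ae_memLp_slice hf, ae_memLp_slice hg] with x hx hx'
    have := (hasSum_integral_fourier_mul hx hx').tsum_eq
    unfold sliceCoeff
    rw [this, ← mul_assoc, ← Complex.ofReal_mul, inv_mul_cancel₀ (by positivity),
      Complex.ofReal_one, one_mul]
  -- Absolute convergence, from |ab| ≤ |a|² + |b|², permits exchanging the sum over k with the
  -- integral over x.
  have hfin : ∑' k : ℤ, ∫⁻ x, ‖sliceCoeff f k x * sliceCoeff g (-k) x‖ₑ ≠ ⊤ := by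
    have hle : ∀ k : ℤ, ∫⁻ x, ‖sliceCoeff f k x * sliceCoeff g (-k) x‖ₑ ≤
        (∫⁻ x, ‖sliceCoeff f k x‖ₑ ^ 2) + ∫⁻ x, ‖sliceCoeff g (-k) x‖ₑ ^ 2 := by
      intro k
      rw [← lintegral_add_left' ((sliceCoeff_aestronglyMeasurable hf.1 k).enorm.pow_const 2)]
      refine lintegral_mono fun x => ?_
      simp only [enorm_mul]
      rcases le_total ‖sliceCoeff f k x‖ₑ ‖sliceCoeff g (-k) x‖ₑ with hh | hh
      · rw [sq, sq]
        exact (mul_le_mul_left hh _).trans le_add_self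
      · rw [sq, sq]
        exact (mul_le_mul_right hh _).trans le_self_add
    refine ne_top_of_le_ne_top ?_ (ENNReal.tsum_le_tsum hle)
    have hneg : ∑' k : ℤ, ∫⁻ x, ‖sliceCoeff g (-k) x‖ₑ ^ 2 =
        ∑' k : ℤ, ∫⁻ x, ‖sliceCoeff g k x‖ₑ ^ 2 :=
      (Equiv.neg ℤ).tsum_eq (fun k : ℤ => ∫⁻ x, ‖sliceCoeff g k x‖ₑ ^ 2)
    rw [ENNReal.tsum_add, hneg,
      tsum_lintegral_sliceCoeff hf.1 (ae_memLp_slice hf),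
      tsum_lintegral_sliceCoeff hg.1 (ae_memLp_slice hg)]
    exact ENNReal.add_ne_top.mpr
      ⟨ENNReal.mul_ne_top ENNReal.ofReal_ne_top (memLp_two_iff.mp hf).2,
      ENNReal.mul_ne_top ENNReal.ofReal_ne_top (memLp_two_iff.mp hg).2⟩
  have h0 : ∫ x, ∑' k : ℤ, sliceCoeff f k x * sliceCoeff g (-k) x =
      ∑' k : ℤ, ∫ x, sliceCoeff f k x * sliceCoeff g (-k) x :=
    integral_tsum (fun k => (sliceCoeff_aestronglyMeasurable hf.1 k).mul
      (sliceCoeff_aestronglyMeasurable hg.1 (-k))) hfin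
  rw [h1, h0]
  have h2 : ∀ k : ℤ, ∫ x, sliceCoeff f k x * sliceCoeff g (-k) x =
      ((2 * π)⁻¹ : ℝ) * ∫ ξ, cylFT f (k, ξ) * cylFT g (-(k, ξ)) := by
    intro k
    have := integral_mul_eq_plancherel (sliceCoeff_memLp hf k) (sliceCoeff_memLp hg (-k))
    rw [Module.finrank_self, pow_one] at this
    exact this
  simp only [h2]
  rw [tsum_mul_left, ← mul_assoc, ← mul_assoc, ← Complex.ofReal_mul, ← Complex.ofReal_mul]
  congr 2
  field_simp

end Cylinder


/-! ### Cauchy–Schwarz inequalities for lower integrals -/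

section CauchySchwarz

variable {α : Type*} [MeasurableSpace α]

theorem sq_lintegral_mul_le (μ : Measure α) {f g : α → ℝ≥0∞} (hf : AEMeasurable f μ)
    (hg : AEMeasurable g μ) :
    (∫⁻ x, f x * g x ∂μ) ^ 2 ≤ (∫⁻ x, f x ^ 2 ∂μ) * ∫⁻ x, g x ^ 2 ∂μ := by
  have h := ENNReal.lintegral_mul_le_Lp_mul_Lq μ Real.HolderConjugate.two_two hf hg
  have e : ∀ a : ℝ≥0∞, (a ^ (1 / 2 : ℝ)) ^ 2 = a := by
    intro a
    rw [← ENNReal.rpow_natCast, ← ENNReal.rpow_mul]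
    norm_num
  calc (∫⁻ x, f x * g x ∂μ) ^ 2 ≤ _ := pow_le_pow_left' h 2
    _ = _ := by
      rw [mul_pow, e, e]
      simp only [ENNReal.rpow_two]

/-- Cauchy–Schwarz after splitting f as √f · √f; this is the form behind Young's inequality L¹ * L²
⊂ L². -/
theorem sq_lintegral_mul_le_weight (μ : Measure α) {f g : α → ℝ≥0∞} (hf : AEMeasurable f μ)
    (hg : AEMeasurable g μ) :
    (∫⁻ x, f x * g x ∂μ) ^ 2 ≤ (∫⁻ x, f x ∂μ) * ∫⁻ x, f x * g x ^ 2 ∂μ := by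
  have e : ∀ a : ℝ≥0∞, (a ^ (1 / 2 : ℝ)) ^ 2 = a := by
    intro a
    rw [← ENNReal.rpow_natCast, ← ENNReal.rpow_mul]
    norm_num
  have h := sq_lintegral_mul_le μ (hf.pow_const (1 / 2 : ℝ)) ((hf.pow_const (1 / 2 : ℝ)).mul hg)
  have e2 : ∀ x, f x ^ (1 / 2 : ℝ) * (f x ^ (1 / 2 : ℝ) * g x) = f x * g x := by
    intro x
    rw [← mul_assoc, ← sq, e]
  simp only [Pi.mul_apply, e2, mul_pow, e] at h
  exact h

end CauchySchwarz

/-! ### Fourier inversion on the cylinder -/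

section Cylinder

variable {l : ℝ} [hl : Fact (1 < l)]

/-- The character `e^{i(xξ + yq)}`. -/
noncomputable def cylChar (p : ℤ × ℝ) (z : Cyl l) : ℂ :=
  Complex.exp (Complex.I * ((p.2 * z.1 : ℝ) : ℂ)) * fourier p.1 z.2

theorem cylChar_norm (p : ℤ × ℝ) (z : Cyl l) : ‖cylChar p z‖ = 1 := by
  unfold cylChar
  rw [norm_mul, mul_comm Complex.I, Complex.norm_exp_ofReal_mul_I, one_mul, fourier_apply]
  exact Circle.norm_coe _

theorem cylChar_add (p p' : ℤ × ℝ) (z : Cyl l) :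
    cylChar (p + p') z = cylChar p z * cylChar p' z := by
  unfold cylChar
  rw [Prod.fst_add, Prod.snd_add, fourier_add]
  rw [show Complex.I * (((p.2 + p'.2) * z.1 : ℝ) : ℂ) =
    Complex.I * ((p.2 * z.1 : ℝ) : ℂ) + Complex.I * ((p'.2 * z.1 : ℝ) : ℂ) by push_cast; ring,
    Complex.exp_add]
  ring

theorem cylChar_measurable : Measurable fun q : (ℤ × ℝ) × Cyl l => cylChar q.1 q.2 := by
  unfold cylChar
  have h1 : Measurable fun r : ℤ × AddCircle (2 * π * l) => (fourier r.1 r.2 : ℂ) :=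
    measurable_from_prod_countable_right fun k => (fourier k).continuous.measurable
  have h2 : Measurable fun q : (ℤ × ℝ) × Cyl l => (fourier q.1.1 q.2.2 : ℂ) :=
    h1.comp (f := fun q : (ℤ × ℝ) × Cyl l => (q.1.1, q.2.2)) (by fun_prop)
  refine Measurable.mul ?_ h2
  fun_prop

/-- The inverse Fourier integral on the cylinder. -/
noncomputable def cylInv (G : ℤ × ℝ → ℂ) (z : Cyl l) : ℂ :=
  (((2 * π) ^ 2)⁻¹ : ℝ) * ∫ p, cylChar p z * G p ∂freqMeasure l

theorem cylInv_stronglyMeasurable {G : ℤ × ℝ → ℂ} (hG : Measurable G) :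
    StronglyMeasurable (cylInv (l := l) G) := by
  unfold cylInv
  refine StronglyMeasurable.const_mul ?_ _
  have h : Measurable fun q : Cyl l × (ℤ × ℝ) => cylChar q.2 q.1 * G q.2 :=
    (cylChar_measurable.comp measurable_swap).mul (hG.comp measurable_snd)
  exact h.stronglyMeasurable.integral_prod_right

theorem integrable_cylChar_mul {G : ℤ × ℝ → ℂ} (hG : Integrable G (freqMeasure l)) (z : Cyl l) :
    Integrable (fun p => cylChar p z * G p) (freqMeasure l) := by
  refine hG.bdd_mul (c := 1) ?_ (ae_of_all _ fun p => (cylChar_norm p z).le)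
  exact (cylChar_measurable.comp (measurable_id.prodMk measurable_const)).aestronglyMeasurable

theorem norm_cylInv_le {G : ℤ × ℝ → ℂ} (z : Cyl l) :
    ‖cylInv G z‖ ≤ ((2 * π) ^ 2)⁻¹ * ∫ p, ‖G p‖ ∂freqMeasure l := by
  unfold cylInv
  rw [norm_mul, Complex.norm_real, norm_of_nonneg (by positivity)]
  gcongr
  refine (norm_integral_le_integral_norm _).trans_eq ?_
  congr 1
  funext p
  rw [norm_mul, cylChar_norm, one_mul]

theorem slice_lintegral_ne_top {f : ℤ × ℝ → ℝ≥0∞} (hf : Measurable f)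
    (h : ∫⁻ p, f p ∂freqMeasure l ≠ ⊤) (k : ℤ) : ∫⁻ ξ : ℝ, f (k, ξ) ≠ ⊤ := by
  have hl0 : 0 < l := l_pos
  rw [lintegral_freqMeasure l hf] at h
  intro hk
  apply h
  rw [ENNReal.mul_eq_top]
  left
  refine ⟨by rw [Ne, ENNReal.ofReal_eq_zero, not_le]; positivity, ?_⟩
  exact top_unique (hk ▸ ENNReal.le_tsum (f := fun k => ∫⁻ ξ : ℝ, f (k, ξ)) k)

theorem slice_integrable {G : ℤ × ℝ → ℂ} (hG : Measurable G)
    (h : Integrable G (freqMeasure l)) (k : ℤ) : Integrable (fun ξ => G (k, ξ)) := by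
  refine ⟨(hG.comp measurable_prodMk_left).aestronglyMeasurable, ?_⟩
  exact lt_top_iff_ne_top.mpr (slice_lintegral_ne_top hG.enorm h.2.ne k)

theorem slice_memLp {G : ℤ × ℝ → ℂ} (hG : Measurable G)
    (h : MemLp G 2 (freqMeasure l)) (k : ℤ) : MemLp (fun ξ => G (k, ξ)) 2 volume := by
  refine memLp_two_iff.mpr ⟨(hG.comp measurable_prodMk_left).aestronglyMeasurable, ?_⟩
  exact slice_lintegral_ne_top (hG.enorm.pow_const 2) (memLp_two_iff.mp h).2 k

theorem integral_fourier_mul_fourier (k j : ℤ) :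
    ∫ y : AddCircle (2 * π * l), fourier (-k) y * fourier j y =
      if j = k then ((2 * π * l : ℝ) : ℂ) else 0 := by
  have h1 := fourierCoeff_eq_integral (T := 2 * π * l) (fourier j) k
  have h2 := congrFun (fourierCoeff_fourier (T := 2 * π * l) j) k
  rw [h1] at h2
  have hl0 : (0 : ℝ) < 2 * π * l := (period_pos l).out
  have hl1 : ((2 * π * l : ℝ) : ℂ) ≠ 0 := by exact_mod_cast hl0.ne'
  have h3 : ∫ y : AddCircle (2 * π * l), fourier (-k) y * fourier j y =
      ((2 * π * l : ℝ) : ℂ) * (((2 * π * l)⁻¹ : ℝ) *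
        ∫ y : AddCircle (2 * π * l), fourier (-k) y * fourier j y) := by
    rw [← mul_assoc, ← Complex.ofReal_mul, mul_inv_cancel₀ hl0.ne', Complex.ofReal_one, one_mul]
  rw [h3, h2, Pi.single_apply]
  by_cases h : j = k
  · simp [h]
  · simp [h, Ne.symm h]

/-- Fubini and orthogonality of the characters of the circle leave only the line of frequencies
above k, so inversion reduces to the one-dimensional case. -/
theorem sliceCoeff_cylInv {G : ℤ × ℝ → ℂ}
    (h : Integrable G (freqMeasure l)) (k : ℤ) :
    sliceCoeff (cylInv (l := l) G) k = invFourierIntegral fun ξ => G (k, ξ) := by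
  have hl0 : 0 < l := l_pos
  funext x
  have hint : Integrable (Function.uncurry fun (y : AddCircle (2 * π * l)) (p : ℤ × ℝ) =>
      fourier (-k) y * (cylChar p (x, y) * G p)) (volume.prod (freqMeasure l)) := by
    have h0 := h.comp_snd (volume : Measure (AddCircle (2 * π * l)))
    refine (h0.bdd_mul (c := 1) (f := fun q : AddCircle (2 * π * l) × (ℤ × ℝ) =>
      fourier (-k) q.1 * cylChar q.2 (x, q.1)) ?_ (ae_of_all _ fun q => ?_)).congr
      (ae_of_all _ fun q => by simp only [Function.uncurry, mul_assoc])
    · refine Measurable.aestronglyMeasurable (Measurable.mul ?_ ?_)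
      · exact (fourier (-k)).continuous.measurable.comp measurable_fst
      · exact cylChar_measurable.comp
          (g := fun q : (ℤ × ℝ) × Cyl l => cylChar q.1 q.2)
          (f := fun q : AddCircle (2 * π * l) × (ℤ × ℝ) => (q.2, (x, q.1))) (by fun_prop)
    · rw [norm_mul, cylChar_norm, fourier_apply, Circle.norm_coe, one_mul]
  calc sliceCoeff (cylInv (l := l) G) k x
      = (((2 * π) ^ 2)⁻¹ : ℝ) * ∫ y : AddCircle (2 * π * l), ∫ p,
          fourier (-k) y * (cylChar p (x, y) * G p) ∂freqMeasure l := by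
        unfold sliceCoeff cylInv
        rw [← integral_const_mul]
        congr 1
        funext y
        rw [integral_const_mul]
        ring
    _ = (((2 * π) ^ 2)⁻¹ : ℝ) * ∫ p, (Complex.exp (Complex.I * ((p.2 * x : ℝ) : ℂ)) *
          (if p.1 = k then ((2 * π * l : ℝ) : ℂ) else 0)) * G p ∂freqMeasure l := by
        rw [integral_integral_swap hint]
        congr 2
        funext p
        rw [← integral_fourier_mul_fourier, ← integral_const_mul, ← integral_mul_const]
        congr 1
        funext y
        simp only [cylChar]
        ring
    _ = (((2 * π) ^ 2)⁻¹ : ℝ) * ((l⁻¹ : ℝ) * ∫ ξ : ℝ,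
          (Complex.exp (Complex.I * ((ξ * x : ℝ) : ℂ)) * ((2 * π * l : ℝ) : ℂ)) * G (k, ξ)) := by
        congr 1
        rw [integral_freqMeasure hl0]
        · congr 1
          rw [tsum_eq_single k]
          · simp
          · intro j hj
            simp [hj]
        · refine h.bdd_mul (c := 2 * π * l) ?_ (ae_of_all _ fun p => ?_)
          · refine Measurable.aestronglyMeasurable (Measurable.mul (by fun_prop) ?_)
            exact Measurable.ite (measurable_fst (measurableSet_singleton k)) measurable_const
              measurable_const
          · rw [norm_mul, mul_comm Complex.I, Complex.norm_exp_ofReal_mul_I, one_mul]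
            split_ifs
            · rw [Complex.norm_real, norm_of_nonneg (by positivity)]
            · rw [norm_zero]
              positivity
    _ = invFourierIntegral (fun ξ => G (k, ξ)) x := by
        unfold invFourierIntegral
        rw [Module.finrank_self, pow_one, ← mul_assoc, ← integral_const_mul, ← integral_const_mul]
        congr 1
        funext ξ
        have hl1 : (l : ℂ) ≠ 0 := by exact_mod_cast hl0.ne'
        have hp : (π : ℂ) ≠ 0 := by exact_mod_cast pi_pos.ne'
        rw [show inner ℝ ξ x = ξ * x from inner_apply ξ x]
        push_cast
        field_simp

/-- Inversion of the Fourier transform on the cylinder for `L¹ ∩ L²` data. -/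
theorem cylInv_spec {G : ℤ × ℝ → ℂ} (hG : Measurable G)
    (h1 : Integrable G (freqMeasure l)) (h2 : MemLp G 2 (freqMeasure l)) :
    MemLp (cylInv (l := l) G) 2 volume ∧ cylFT (cylInv (l := l) G) =ᵐ[freqMeasure l] G := by
  have hk : ∀ k, MemLp (sliceCoeff (cylInv (l := l) G) k) 2 volume ∧
      plancherel (sliceCoeff (cylInv (l := l) G) k) =ᵐ[volume] fun ξ => G (k, ξ) := by
    intro k
    rw [sliceCoeff_cylInv h1 k]
    exact invFourierIntegral_memLp (slice_integrable hG h1 k) (slice_memLp hG h2 k)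
  have hm := (cylInv_stronglyMeasurable (l := l) hG)
  constructor
  · rw [memLp_two_iff]
    refine ⟨hm.aestronglyMeasurable, ?_⟩
    -- An inverse integral of an L¹ function is bounded, so its slices over the circle are in L²;
    -- Parseval then yields global square integrability.
    have h3 := tsum_lintegral_sliceCoeff (l := l) hm.aestronglyMeasurable
      (ae_of_all _ fun x => MemLp.of_bound
        (hm.measurable.comp measurable_prodMk_left).aestronglyMeasurable _
        (ae_of_all _ fun y => norm_cylInv_le (x, y)))
    have h4 : ∑' k : ℤ, ∫⁻ x, ‖sliceCoeff (cylInv (l := l) G) k x‖ₑ ^ 2 ≠ ⊤ := by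
      have h5 : ∀ k, ∫⁻ x, ‖sliceCoeff (cylInv (l := l) G) k x‖ₑ ^ 2 ≤
          ∫⁻ ξ, ‖G (k, ξ)‖ₑ ^ 2 := by
        intro k
        have h6 := lintegral_plancherel (hk k).1
        have h7 : ∫⁻ ξ, ‖plancherel (sliceCoeff (cylInv (l := l) G) k) ξ‖ₑ ^ 2 =
            ∫⁻ ξ, ‖G (k, ξ)‖ₑ ^ 2 := by
          apply lintegral_congr_ae
          filter_upwards [(hk k).2] with ξ hξ
          rw [hξ]
        rw [← h7, h6, Module.finrank_self, pow_one]
        refine le_mul_of_one_le_left' ?_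
        rw [ENNReal.one_le_ofReal]
        linarith [pi_gt_three]
      refine ne_top_of_le_ne_top ?_ (ENNReal.tsum_le_tsum h5)
      have h8 := (memLp_two_iff.mp h2).2
      rw [lintegral_freqMeasure l (hG.enorm.pow_const 2)] at h8
      intro h9
      apply h8
      rw [h9, ENNReal.mul_top]
      have hl0 : 0 < l := l_pos
      rw [Ne, ENNReal.ofReal_eq_zero, not_le]
      positivity
    rw [h3] at h4
    intro h9
    apply h4
    rw [h9, ENNReal.mul_top]
    rw [Ne, ENNReal.ofReal_eq_zero, not_le]
    exact (period_pos l).out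
  · exact (ae_freqMeasure l_pos).mpr fun k => (hk k).2

end Cylinder


/-! ### Surjectivity of the transform, multipliers and products -/

section Cylinder

variable {l : ℝ} [hl : Fact (1 < l)]

theorem eLpNorm_cylFT {f : Cyl l → ℂ} (hf : MemLp f 2 volume) :
    eLpNorm (cylFT f) 2 (freqMeasure l) = ENNReal.ofReal (2 * π) * eLpNorm f 2 volume := by
  have h := lintegral_cylFT hf
  rw [lintegral_enorm_sq_eq, lintegral_enorm_sq_eq, ENNReal.ofReal_pow two_pi_pos.le,
    ← mul_pow] at h
  exact (ENNReal.pow_right_strictMono two_ne_zero).injective h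

/-- Boxes exhausting the frequency space. -/
def freqBox (n : ℕ) : Set (ℤ × ℝ) := Set.Icc (-(n : ℤ)) n ×ˢ Set.Icc (-(n : ℝ)) n

theorem freqBox_measurable (n : ℕ) : MeasurableSet (freqBox n) :=
  measurableSet_Icc.prod measurableSet_Icc

theorem freqBox_mono {n m : ℕ} (h : n ≤ m) : freqBox n ⊆ freqBox m := by
  have h1 : (n : ℤ) ≤ m := by exact_mod_cast h
  have h2 : (n : ℝ) ≤ m := by exact_mod_cast h
  exact Set.prod_mono (Set.Icc_subset_Icc (by linarith) h1) (Set.Icc_subset_Icc (by linarith) h2)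

theorem freqBox_eventually (p : ℤ × ℝ) : ∀ᶠ n : ℕ in atTop, p ∈ freqBox n := by
  obtain ⟨a, ha⟩ := exists_nat_ge |p.2|
  filter_upwards [eventually_ge_atTop (max a p.1.natAbs)] with n hn
  refine freqBox_mono hn ?_
  have h1 : |p.1| ≤ ((max a p.1.natAbs : ℕ) : ℤ) := by
    rw [Int.abs_eq_natAbs]
    exact_mod_cast le_max_right _ _
  have h2 : |p.2| ≤ ((max a p.1.natAbs : ℕ) : ℝ) := ha.trans (by exact_mod_cast le_max_left _ _)
  exact ⟨abs_le.mp h1, abs_le.mp h2⟩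

theorem freqBox_measure (n : ℕ) : freqMeasure l (freqBox n) < ⊤ := by
  unfold freqMeasure freqBox
  rw [Measure.prod_prod]
  refine ENNReal.mul_lt_top ?_ ?_
  · rw [Measure.smul_apply, ENNReal.smul_def, smul_eq_mul]
    exact ENNReal.mul_lt_top ENNReal.coe_lt_top
      (Measure.count_apply_lt_top.mpr (Set.finite_Icc _ _))
  · rw [Real.volume_Icc]
    exact ENNReal.ofReal_lt_top

theorem indicator_freqBox_spec {G : ℤ × ℝ → ℂ} (hG : Measurable G)
    (h2 : MemLp G 2 (freqMeasure l)) (n : ℕ) :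
    Measurable ((freqBox n).indicator G) ∧ Integrable ((freqBox n).indicator G) (freqMeasure l) ∧
      MemLp ((freqBox n).indicator G) 2 (freqMeasure l) := by
  refine ⟨hG.indicator (freqBox_measurable n), ?_, h2.indicator (freqBox_measurable n)⟩
  rw [integrable_indicator_iff (freqBox_measurable n)]
  have : IsFiniteMeasure ((freqMeasure l).restrict (freqBox n)) :=
    ⟨by rw [Measure.restrict_apply_univ]; exact freqBox_measure n⟩
  exact (h2.restrict (freqBox n)).integrable (by norm_num)

theorem tendsto_eLpNorm_freqBox {G : ℤ × ℝ → ℂ} (hG : Measurable G)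
    (h2 : MemLp G 2 (freqMeasure l)) :
    Tendsto (fun n : ℕ => eLpNorm (fun p => G p - (freqBox n).indicator G p) 2 (freqMeasure l))
      atTop (𝓝 0) := by
  have h3 : Tendsto (fun n : ℕ => ∫⁻ p, ‖G p - (freqBox n).indicator G p‖ₑ ^ 2 ∂freqMeasure l)
      atTop (𝓝 (∫⁻ _, 0 ∂freqMeasure l)) := by
    refine tendsto_lintegral_of_dominated_convergence (fun p => ‖G p‖ₑ ^ 2)
      (fun n => ((hG.sub (hG.indicator (freqBox_measurable n))).enorm.pow_const 2))
      (fun n => ae_of_all _ fun p => ?_) (memLp_two_iff.mp h2).2 (ae_of_all _ fun p => ?_)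
    · by_cases h : p ∈ freqBox n
      · simp [h]
      · simp [h]
    · refine tendsto_const_nhds.congr' ?_
      filter_upwards [freqBox_eventually p] with n hn
      simp [hn]
  rw [lintegral_zero] at h3
  have h4 := h3.ennrpow_const (1 / 2)
  simp only [lintegral_enorm_sq_eq] at h4
  rw [ENNReal.zero_rpow_of_pos (by norm_num)] at h4
  refine h4.congr fun n => ?_
  rw [← ENNReal.rpow_natCast, ← ENNReal.rpow_mul]
  norm_num

/-- Every square integrable function on the frequency space is a Fourier transform. -/
theorem exists_cylFT_eq {G : ℤ × ℝ → ℂ} (hG : Measurable G) (h2 : MemLp G 2 (freqMeasure l)) :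
    ∃ f : Cyl l → ℂ, MemLp f 2 volume ∧ cylFT f =ᵐ[freqMeasure l] G := by
  have hs := indicator_freqBox_spec hG h2
  have hf := fun n => cylInv_spec (hs n).1 (hs n).2.1 (hs n).2.2
  set f : ℕ → Cyl l → ℂ := fun n => cylInv ((freqBox n).indicator G) with hfdef
  have hb := tendsto_eLpNorm_freqBox hG h2
  -- For n, m ≥ N the transforms of the approximants agree on box N, and outside it their difference
  -- is bounded by G; Plancherel transfers this tail to the functions.
  have hcauchy : CauchySeq fun n => (hf n).1.toLp (f n) := by
    refine cauchySeq_of_le_tendsto_0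
      (fun n => (eLpNorm (fun p => G p - (freqBox n).indicator G p) 2 (freqMeasure l)).toReal)
      (fun n m N hn hm => ?_) ?_
    · rw [Lp.dist_def]
      have hNfin : eLpNorm (fun p => G p - (freqBox N).indicator G p) 2 (freqMeasure l) ≠ ⊤ :=
        (h2.sub (hs N).2.2).2.ne
      refine ENNReal.toReal_mono hNfin ?_
      have h5 : eLpNorm (⇑((hf n).1.toLp (f n)) - ⇑((hf m).1.toLp (f m))) 2 volume =
          eLpNorm (fun z => f n z - f m z) 2 volume :=
        eLpNorm_congr_ae ((hf n).1.coeFn_toLp.sub (hf m).1.coeFn_toLp)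
      have hsub : MemLp (fun z => f n z - f m z) 2 volume := (hf n).1.sub (hf m).1
      have h6 : eLpNorm (fun z => f n z - f m z) 2 volume ≤
          eLpNorm (cylFT fun z => f n z - f m z) 2 (freqMeasure l) := by
        rw [eLpNorm_cylFT hsub]
        refine le_mul_of_one_le_left' ?_
        rw [ENNReal.one_le_ofReal]
        linarith [pi_gt_three]
      rw [h5]
      refine h6.trans ?_
      refine eLpNorm_mono_ae ?_
      filter_upwards [cylFT_sub (hf n).1 (hf m).1, (hf n).2, (hf m).2] with p h7 h8 h9
      rw [h7, h8, h9]
      by_cases hN : p ∈ freqBox N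
      · simp [hN, freqBox_mono hn hN, freqBox_mono hm hN]
      · by_cases hpn : p ∈ freqBox n <;> by_cases hpm : p ∈ freqBox m <;> simp [hN, hpn, hpm]
    · have := (ENNReal.tendsto_toReal ENNReal.zero_ne_top).comp hb
      exact this
  obtain ⟨F, hF⟩ := cauchySeq_tendsto_of_complete hcauchy
  refine ⟨F, Lp.memLp F, ?_⟩
  have hF' : Tendsto (fun n => eLpNorm (fun z => F z - f n z) 2 volume) atTop (𝓝 0) := by
    have h1 := tendsto_iff_edist_tendsto_0.mp hF
    refine h1.congr fun n => ?_
    rw [edist_comm, Lp.edist_def]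
    exact eLpNorm_congr_ae ((ae_eq_refl _).sub (hf n).1.coeFn_toLp)
  have hz : eLpNorm (fun p => cylFT F p - G p) 2 (freqMeasure l) = 0 := by
    have hle : ∀ n, eLpNorm (fun p => cylFT F p - G p) 2 (freqMeasure l) ≤
        ENNReal.ofReal (2 * π) * eLpNorm (fun z => F z - f n z) 2 volume +
        eLpNorm (fun p => G p - (freqBox n).indicator G p) 2 (freqMeasure l) := by
      intro n
      have hsub : MemLp (fun z => F z - f n z) 2 volume := (Lp.memLp F).sub (hf n).1
      have e1 : eLpNorm (fun p => G p - (freqBox n).indicator G p) 2 (freqMeasure l) =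
          eLpNorm (fun p => (freqBox n).indicator G p - G p) 2 (freqMeasure l) := by
        rw [← eLpNorm_neg]
        congr 1
        funext p
        simp
      rw [← eLpNorm_cylFT hsub, e1]
      refine (le_of_eq (eLpNorm_congr_ae ?_)).trans (eLpNorm_add_le
        (cylFT_measurable _).aestronglyMeasurable
        ((hs n).1.sub hG).aestronglyMeasurable (by norm_num))
      filter_upwards [cylFT_sub (Lp.memLp F) (hf n).1, (hf n).2] with p h7 h8
      have h9 : cylFT (fun z => F z - f n z) p = cylFT F p - (freqBox n).indicator G p := by
        rw [← h8, ← h7]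
      rw [Pi.add_apply, h9]
      ring
    have hlim : Tendsto (fun n => ENNReal.ofReal (2 * π) *
        eLpNorm (fun z => F z - f n z) 2 volume +
        eLpNorm (fun p => G p - (freqBox n).indicator G p) 2 (freqMeasure l)) atTop (𝓝 0) := by
      have := (ENNReal.Tendsto.const_mul hF' (Or.inr ENNReal.ofReal_ne_top)
        (a := ENNReal.ofReal (2 * π))).add hb
      simpa using this
    exact le_antisymm (ge_of_tendsto' hlim hle) zero_le
  replace hz := (eLpNorm_eq_zero_iff (f := fun p => cylFT F p - G p)
    ((cylFT_measurable _).sub hG).aestronglyMeasurable (by norm_num)).mp hz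
  filter_upwards [hz] with p hp
  exact sub_eq_zero.mp hp

/-- Surjectivity of the transform shows that the choice in `fourierMul` is not the default 0. All
operators of the increment are unfolded through this lemma, so only the product of symbol and
transform has to be square integrable. -/
theorem fourierMul_spec (a : ℝ → ℝ → ℂ) (f : Cyl l → ℂ) {G : ℤ × ℝ → ℂ} (hG : Measurable G)
    (h2 : MemLp G 2 (freqMeasure l))
    (h : (fun p => a p.2 (p.1 / l) * cylFT f p) =ᵐ[freqMeasure l] G) :
    MemLp (fourierMul l a f) 2 volume ∧ cylFT (fourierMul l a f) =ᵐ[freqMeasure l] G := by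
  have hex : ∃ g : Cyl l → ℂ, MemLp g 2 volume ∧
      ∀ k : ℤ, spaceFT l g k =ᵐ[volume] fun ξ => a ξ (k / l) * spaceFT l f k ξ := by
    obtain ⟨g, hg, hgG⟩ := exists_cylFT_eq hG h2
    refine ⟨g, hg, fun k => ?_⟩
    exact (ae_freqMeasure l_pos).mp (hgG.trans h.symm) k
  unfold fourierMul
  rw [dif_pos hex]
  refine ⟨hex.choose_spec.1, ?_⟩
  refine EventuallyEq.trans ?_ h
  exact (ae_freqMeasure l_pos).mpr hex.choose_spec.2

/-- The convolution `(2π)⁻² F * G` on the frequency space. -/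
noncomputable def freqConv (l : ℝ) (F G : ℤ × ℝ → ℂ) (p : ℤ × ℝ) : ℂ :=
  (((2 * π) ^ 2)⁻¹ : ℝ) * ∫ p', F p' * G (p - p') ∂freqMeasure l

theorem freqConv_measurable {F G : ℤ × ℝ → ℂ} (hF : Measurable F) (hG : Measurable G) :
    Measurable (freqConv l F G) := by
  unfold freqConv
  refine Measurable.const_mul ?_ _
  have h : Measurable fun q : (ℤ × ℝ) × (ℤ × ℝ) => F q.2 * G (q.1 - q.2) := by fun_prop
  exact h.stronglyMeasurable.integral_prod_right.measurable

theorem integrable_freqConv_integrand {F G : ℤ × ℝ → ℂ} (hF : Integrable F (freqMeasure l))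
    (hG : Integrable G (freqMeasure l)) :
    Integrable (fun q : (ℤ × ℝ) × (ℤ × ℝ) => F q.2 * G (q.1 - q.2))
      ((freqMeasure l).prod (freqMeasure l)) :=
  hF.convolution_integrand (ContinuousLinearMap.mul ℂ ℂ) hG

theorem integrable_freqConv {F G : ℤ × ℝ → ℂ} (hF : Integrable F (freqMeasure l))
    (hG : Integrable G (freqMeasure l)) : Integrable (freqConv l F G) (freqMeasure l) :=
  (integrable_freqConv_integrand hF hG).integral_prod_left.const_mul _

/-- Young's inequality: Cauchy–Schwarz with a as weight, then Tonelli and translation invariance. -/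
theorem lintegral_conv_sq_le {a b : ℤ × ℝ → ℝ≥0∞} (ha : Measurable a) (hb : Measurable b) :
    ∫⁻ p, (∫⁻ p', a p' * b (p - p') ∂freqMeasure l) ^ 2 ∂freqMeasure l ≤
      (∫⁻ p, a p ∂freqMeasure l) ^ 2 * ∫⁻ p, b p ^ 2 ∂freqMeasure l := by
  have h1 : ∀ p, (∫⁻ p', a p' * b (p - p') ∂freqMeasure l) ^ 2 ≤
      (∫⁻ p, a p ∂freqMeasure l) * ∫⁻ p', a p' * b (p - p') ^ 2 ∂freqMeasure l := fun p =>
    sq_lintegral_mul_le_weight _ ha.aemeasurable (by fun_prop)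
  refine (lintegral_mono h1).trans ?_
  rw [lintegral_const_mul _ (Measurable.lintegral_prod_right (by fun_prop)), sq, mul_assoc]
  refine mul_le_mul_right ?_ _
  rw [lintegral_lintegral_swap (by fun_prop)]
  have h2 : ∀ p', ∫⁻ p, a p' * b (p - p') ^ 2 ∂freqMeasure l =
      a p' * ∫⁻ p, b p ^ 2 ∂freqMeasure l := by
    intro p'
    rw [lintegral_const_mul _ (by fun_prop), lintegral_sub_right_eq_self (fun p => b p ^ 2)]
  simp only [h2]
  rw [lintegral_mul_const _ ha]

theorem enorm_freqConv_le (F G : ℤ × ℝ → ℂ) (p : ℤ × ℝ) :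
    ‖freqConv l F G p‖ₑ ≤ ∫⁻ p', ‖F p'‖ₑ * ‖G (p - p')‖ₑ ∂freqMeasure l := by
  unfold freqConv
  rw [enorm_mul]
  refine (mul_le_of_le_one_left' ?_).trans ((enorm_integral_le_lintegral_enorm _).trans_eq ?_)
  · rw [← ofReal_norm, Complex.norm_real, norm_of_nonneg (by positivity), ENNReal.ofReal_le_one]
    apply inv_le_one_of_one_le₀
    nlinarith [pi_gt_three]
  · simp only [enorm_mul]

theorem memLp_freqConv {F G : ℤ × ℝ → ℂ} (hF : Measurable F) (hG : Measurable G)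
    (hF1 : Integrable F (freqMeasure l)) (hG2 : MemLp G 2 (freqMeasure l)) :
    MemLp (freqConv l F G) 2 (freqMeasure l) := by
  refine memLp_two_iff.mpr ⟨(freqConv_measurable hF hG).aestronglyMeasurable, ?_⟩
  refine ne_top_of_le_ne_top ?_ ((lintegral_mono fun p =>
    pow_le_pow_left' (enorm_freqConv_le F G p) 2).trans
    (lintegral_conv_sq_le hF.enorm hG.enorm))
  exact ENNReal.mul_ne_top (ENNReal.pow_ne_top hF1.2.ne) (memLp_two_iff.mp hG2).2

/-- The characters are multiplicative in the frequency, so Fubini and a translation separate the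
double integral. -/
theorem cylInv_mul {F G : ℤ × ℝ → ℂ} (hF1 : Integrable F (freqMeasure l))
    (hG1 : Integrable G (freqMeasure l)) (z : Cyl l) :
    cylInv F z * cylInv G z = cylInv (freqConv l F G) z := by
  have hi : Integrable (Function.uncurry fun p p' : ℤ × ℝ =>
      (cylChar p' z * F p') * (cylChar (p - p') z * G (p - p')))
      ((freqMeasure l).prod (freqMeasure l)) :=
    integrable_freqConv_integrand (integrable_cylChar_mul hF1 z) (integrable_cylChar_mul hG1 z)
  have h1 : ∫ p, cylChar p z * ∫ p', F p' * G (p - p') ∂freqMeasure l ∂freqMeasure l =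
      (∫ p, cylChar p z * F p ∂freqMeasure l) * ∫ p, cylChar p z * G p ∂freqMeasure l := by
    calc _ = ∫ p, ∫ p', (cylChar p' z * F p') * (cylChar (p - p') z * G (p - p'))
          ∂freqMeasure l ∂freqMeasure l := by
          congr 1
          funext p
          rw [← integral_const_mul]
          congr 1
          funext p'
          have : cylChar p z = cylChar p' z * cylChar (p - p') z := by
            rw [← cylChar_add, add_sub_cancel]
          rw [this]
          ring
      _ = _ := by
          rw [integral_integral_swap hi, ← integral_mul_const]
          congr 1
          funext p'
          rw [integral_const_mul,
            integral_sub_right_eq_self (fun p => cylChar p z * G p)]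
  unfold cylInv freqConv
  have h2 : ∀ p, cylChar p z * ((((2 * π) ^ 2)⁻¹ : ℝ) * ∫ p', F p' * G (p - p') ∂freqMeasure l) =
      (((2 * π) ^ 2)⁻¹ : ℝ) * (cylChar p z * ∫ p', F p' * G (p - p') ∂freqMeasure l) := by
    intro p; ring
  simp only [h2]
  rw [integral_const_mul, h1]
  ring

/-- The Fourier transform of a product is the convolution of the Fourier transforms. -/
theorem cylFT_mul {f g : Cyl l → ℂ} (hf : MemLp f 2 volume) (hg : MemLp g 2 volume)
    {F G : ℤ × ℝ → ℂ} (hF : Measurable F) (hG : Measurable G)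
    (hfF : cylFT f =ᵐ[freqMeasure l] F) (hgG : cylFT g =ᵐ[freqMeasure l] G)
    (hF1 : Integrable F (freqMeasure l)) (hG1 : Integrable G (freqMeasure l)) :
    MemLp (fun z => f z * g z) 2 volume ∧
      cylFT (fun z => f z * g z) =ᵐ[freqMeasure l] freqConv l F G := by
  have hF2 := (memLp_congr_ae hfF).mp (memLp_cylFT hf)
  have hG2 := (memLp_congr_ae hgG).mp (memLp_cylFT hg)
  obtain ⟨f1, f2⟩ := cylInv_spec hF hF1 hF2
  obtain ⟨g1, g2⟩ := cylInv_spec hG hG1 hG2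
  obtain ⟨c1, c2⟩ := cylInv_spec (l := l) (freqConv_measurable hF hG) (integrable_freqConv hF1 hG1)
    (memLp_freqConv hF hG hF1 hG2)
  have e : (fun z => f z * g z) =ᵐ[volume] cylInv (freqConv l F G) := by
    filter_upwards [ae_eq_of_cylFT hf f1 (hfF.trans f2.symm),
      ae_eq_of_cylFT hg g1 (hgG.trans g2.symm)] with z h1 h2
    rw [h1, h2, cylInv_mul hF1 hG1]
  refine ⟨(memLp_congr_ae e).mpr c1, ?_⟩
  rw [cylFT_congr e]
  exact c2

end Cylinder


/-! ### Weights on the frequency space -/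

/-- The modified length of a frequency. -/
noncomputable def rad (l : ℝ) (p : ℤ × ℝ) : ℝ := freqNorm p.2 (p.1 / l)

theorem rad_nonneg (l : ℝ) (p : ℤ × ℝ) : 0 ≤ rad l p := Real.sqrt_nonneg _

theorem rad_sq (l : ℝ) (p : ℤ × ℝ) : rad l p ^ 2 = 3 * p.2 ^ 2 + (p.1 / l) ^ 2 :=
  Real.sq_sqrt (by positivity)

theorem rad_neg (l : ℝ) (p : ℤ × ℝ) : rad l (-p) = rad l p := by
  simp [rad, freqNorm, neg_div]

theorem abs_snd_le_rad (l : ℝ) (p : ℤ × ℝ) : |p.2| ≤ rad l p := by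
  refine abs_le_of_sq_le_sq ?_ (rad_nonneg l p)
  nlinarith [rad_sq l p, sq_nonneg p.2, sq_nonneg ((p.1 : ℝ) / l)]

theorem abs_fst_le_rad (l : ℝ) (p : ℤ × ℝ) : |(p.1 : ℝ) / l| ≤ rad l p := by
  refine abs_le_of_sq_le_sq ?_ (rad_nonneg l p)
  nlinarith [rad_sq l p, sq_nonneg p.2, sq_nonneg ((p.1 : ℝ) / l)]

theorem rad_measurable (l : ℝ) : Measurable (rad l) := by
  unfold rad freqNorm
  have h : Measurable fun p : ℤ × ℝ => (p.1 : ℝ) := (measurable_of_countable _).comp measurable_fst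
  fun_prop

theorem fst_measurable (l : ℝ) : Measurable fun p : ℤ × ℝ => (p.1 : ℝ) / l :=
  ((measurable_of_countable (fun k : ℤ => (k : ℝ))).comp measurable_fst).div_const l

/-- The bracket `⟨|ζ|⟩`. -/
noncomputable def radBr (l : ℝ) (p : ℤ × ℝ) : ℝ := 1 + rad l p

theorem radBr_eq (l : ℝ) (p : ℤ × ℝ) : bracket (freqNorm p.2 (p.1 / l)) = radBr l p := by
  unfold bracket radBr
  rw [← rad, abs_of_nonneg (rad_nonneg l p)]

theorem one_le_radBr (l : ℝ) (p : ℤ × ℝ) : 1 ≤ radBr l p := by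
  unfold radBr; linarith [rad_nonneg l p]

theorem radBr_measurable (l : ℝ) : Measurable (radBr l) := (rad_measurable l).const_add 1

theorem bracket_continuous : Continuous bracket := by unfold bracket; fun_prop

theorem one_le_bracket (x : ℝ) : 1 ≤ bracket x := by unfold bracket; linarith [abs_nonneg x]

theorem lintegral_bracket_rpow_ne_top {r : ℝ} (hr : 1 < r) :
    ∫⁻ x : ℝ, ENNReal.ofReal (bracket x ^ (-r)) ≠ ⊤ := by
  have h := integrable_one_add_norm (E := ℝ) (μ := volume) (r := r) (by simpa using hr)
  exact h.lintegral_lt_top.ne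

theorem lintegral_eq_tsum_grid {l : ℝ} (hl : 0 < l) (f : ℝ → ℝ≥0∞) :
    ∫⁻ x, f x = ∑' k : ℤ, ∫⁻ x in Set.Ioc (k / l) ((k + 1) / l), f x := by
  have h1 : (⋃ k : ℤ, Set.Ioc ((k : ℝ) / l) ((k + 1) / l)) = Set.univ := by
    rw [← iUnion_Ioc_zsmul (inv_pos.mpr hl)]
    congr 1
    funext k
    simp only [zsmul_eq_mul, Int.cast_add, Int.cast_one, div_eq_mul_inv]
  rw [← setLIntegral_univ, ← h1, lintegral_iUnion (fun k => measurableSet_Ioc)]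
  intro i j hij
  rw [Function.onFun, Set.disjoint_left]
  intro x hx hx'
  rcases lt_or_gt_of_ne hij with h | h
  · have : (i : ℝ) + 1 ≤ j := by exact_mod_cast h
    have h3 : ((i : ℝ) + 1) / l ≤ j / l := by gcongr
    linarith [hx.2, hx'.1]
  · have : (j : ℝ) + 1 ≤ i := by exact_mod_cast h
    have h3 : ((j : ℝ) + 1) / l ≤ i / l := by gcongr
    linarith [hx'.2, hx.1]

/-- Riemann sums of `⟨q⟩^{-r}` with mesh at most `1` are bounded by the integral. -/
theorem tsum_bracket_rpow_le {l : ℝ} (hl : 1 < l) {r : ℝ} (hr : 0 < r) :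
    ENNReal.ofReal l⁻¹ * ∑' k : ℤ, ENNReal.ofReal (bracket (k / l) ^ (-r)) ≤
      ENNReal.ofReal (2 ^ r) * ∫⁻ x : ℝ, ENNReal.ofReal (bracket x ^ (-r)) := by
  have hl0 : 0 < l := one_pos.trans hl
  rw [lintegral_eq_tsum_grid hl0, ← ENNReal.tsum_mul_left, ← ENNReal.tsum_mul_left]
  refine ENNReal.tsum_le_tsum fun k => ?_
  have h1 : ∀ x ∈ Set.Ioc ((k : ℝ) / l) ((k + 1) / l),
      ENNReal.ofReal (2 ^ r)⁻¹ * ENNReal.ofReal (bracket (k / l) ^ (-r)) ≤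
        ENNReal.ofReal (bracket x ^ (-r)) := by
    intro x hx
    have hinv : l⁻¹ ≤ 1 := inv_le_one_of_one_le₀ hl.le
    have h2 : bracket x ≤ 2 * bracket (k / l) := by
      have h3 : |x| ≤ |(k : ℝ) / l| + 1 := by
        have h4 : |x - k / l| ≤ 1 := by
          have h5 : ((k : ℝ) + 1) / l = k / l + l⁻¹ := by rw [add_div, one_div]
          rw [abs_le]
          constructor <;> linarith [hx.1, hx.2]
        calc |x| = |k / l + (x - k / l)| := by rw [add_sub_cancel]
          _ ≤ _ := (abs_add_le _ _).trans (by linarith)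
      unfold bracket
      linarith [abs_nonneg ((k : ℝ) / l)]
    rw [← ENNReal.ofReal_mul (by positivity)]
    apply ENNReal.ofReal_le_ofReal
    have hb : 0 < bracket x := one_pos.trans_le (one_le_bracket x)
    have hb' : 0 < bracket ((k : ℝ) / l) := one_pos.trans_le (one_le_bracket _)
    rw [← Real.rpow_neg two_pos.le, ← Real.mul_rpow two_pos.le hb'.le]
    exact Real.rpow_le_rpow_of_nonpos hb h2 (by linarith)
  have h6 : ENNReal.ofReal l⁻¹ * (ENNReal.ofReal (2 ^ r)⁻¹ *
      ENNReal.ofReal (bracket (k / l) ^ (-r))) ≤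
      ∫⁻ x in Set.Ioc ((k : ℝ) / l) ((k + 1) / l), ENNReal.ofReal (bracket x ^ (-r)) := by
    refine le_trans (le_of_eq ?_) (setLIntegral_mono' measurableSet_Ioc h1)
    rw [setLIntegral_const, Real.volume_Ioc, mul_comm]
    congr 2
    rw [← sub_div, add_sub_cancel_left, one_div]
  calc ENNReal.ofReal l⁻¹ * ENNReal.ofReal (bracket (k / l) ^ (-r))
      = ENNReal.ofReal (2 ^ r) * (ENNReal.ofReal l⁻¹ * (ENNReal.ofReal (2 ^ r)⁻¹ *
        ENNReal.ofReal (bracket (k / l) ^ (-r)))) := by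
        have : ENNReal.ofReal (2 ^ r) * ENNReal.ofReal (2 ^ r)⁻¹ = 1 := by
          rw [← ENNReal.ofReal_mul (by positivity), mul_inv_cancel₀ (by positivity),
            ENNReal.ofReal_one]
        rw [mul_left_comm, ← mul_assoc (ENNReal.ofReal (2 ^ r)), this, one_mul]
    _ ≤ _ := mul_le_mul_right h6 _

/-- The weight is at most ⟨q⟩⁻²⟨ξ⟩⁻², and each factor is summable, respectively integrable. Only
finiteness is used later, for qualitative H² statements. -/
theorem lintegral_radBr_ne_top {l : ℝ} [hl : Fact (1 < l)] :
    ∫⁻ p, ENNReal.ofReal ((radBr l p ^ 4)⁻¹) ∂freqMeasure l ≠ ⊤ := by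
  have hl0 : 0 < l := l_pos
  have h1 : ∀ p : ℤ × ℝ, ENNReal.ofReal ((radBr l p ^ 4)⁻¹) ≤
      ENNReal.ofReal (bracket (p.1 / l) ^ (-2 : ℝ)) * ENNReal.ofReal (bracket p.2 ^ (-2 : ℝ)) := by
    intro p
    have hx := one_le_bracket ((p.1 : ℝ) / l)
    have hy := one_le_bracket p.2
    have hx' : bracket ((p.1 : ℝ) / l) ≤ radBr l p := by
      unfold bracket radBr; linarith [abs_fst_le_rad l p]
    have hy' : bracket p.2 ≤ radBr l p := by
      unfold bracket radBr; linarith [abs_snd_le_rad l p]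
    rw [← ENNReal.ofReal_mul (by positivity)]
    apply ENNReal.ofReal_le_ofReal
    rw [Real.rpow_neg (by linarith), Real.rpow_neg (by linarith), ← mul_inv, Real.rpow_two,
      Real.rpow_two]
    gcongr
    calc _ ≤ radBr l p ^ 2 * radBr l p ^ 2 := by gcongr
      _ = _ := by ring
  have hm : Measurable fun p : ℤ × ℝ => ENNReal.ofReal (bracket (p.1 / l) ^ (-2 : ℝ)) *
      ENNReal.ofReal (bracket p.2 ^ (-2 : ℝ)) := by
    have h2 := bracket_continuous.measurable.comp (fst_measurable l)
    have h3 : Measurable fun p : ℤ × ℝ => bracket p.2 :=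
      bracket_continuous.measurable.comp measurable_snd
    exact ((h2.pow_const (-2 : ℝ)).ennreal_ofReal).mul ((h3.pow_const (-2 : ℝ)).ennreal_ofReal)
  refine ne_top_of_le_ne_top ?_ (lintegral_mono h1)
  rw [lintegral_freqMeasure l hm]
  have h4 : ∀ k : ℤ, ∫⁻ ξ : ℝ, ENNReal.ofReal (bracket (k / l) ^ (-2 : ℝ)) *
      ENNReal.ofReal (bracket ξ ^ (-2 : ℝ)) = ENNReal.ofReal (bracket (k / l) ^ (-2 : ℝ)) *
      ∫⁻ ξ : ℝ, ENNReal.ofReal (bracket ξ ^ (-2 : ℝ)) := fun k =>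
    lintegral_const_mul' _ _ ENNReal.ofReal_ne_top
  simp only [h4]
  rw [ENNReal.tsum_mul_right, ← mul_assoc]
  have h5 := lintegral_bracket_rpow_ne_top (r := 2) one_lt_two
  refine ENNReal.mul_ne_top (ne_top_of_le_ne_top ?_ (tsum_bracket_rpow_le hl.out two_pos)) h5
  exact ENNReal.mul_ne_top ENNReal.ofReal_ne_top h5


/-! ### Absolute convergence of the cubic form on H² -/

section Trilinear

variable {l : ℝ} [hl : Fact (1 < l)]

theorem lintegral_neg_sub_eq (f : ℤ × ℝ → ℝ≥0∞) (p : ℤ × ℝ) :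
    ∫⁻ p', f (-p - p') ∂freqMeasure l = ∫⁻ p', f p' ∂freqMeasure l := by
  rw [← lintegral_neg_eq_self]
  simp only [sub_neg_eq_add]
  rw [lintegral_add_left_eq_self]

theorem lintegral_neg_sub_swap (b c : ℤ × ℝ → ℝ≥0∞) (p : ℤ × ℝ) :
    ∫⁻ p', b p' * c (-p - p') ∂freqMeasure l = ∫⁻ p', c p' * b (-p - p') ∂freqMeasure l := by
  rw [← lintegral_neg_sub_eq (fun p' => b p' * c (-p - p')) p]
  simp only [sub_sub_cancel]
  simp only [mul_comm]

/-- The trilinear form `∫∫ a(ζ₁) b(ζ₂) c(-ζ₁ - ζ₂)`. -/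
noncomputable def triForm (l : ℝ) (a b c : ℤ × ℝ → ℝ≥0∞) : ℝ≥0∞ :=
  ∫⁻ p, a p * ∫⁻ p', b p' * c (-p - p') ∂freqMeasure l ∂freqMeasure l

theorem triForm_swap (a b c : ℤ × ℝ → ℝ≥0∞) : triForm l a b c = triForm l a c b := by
  unfold triForm
  simp only [lintegral_neg_sub_swap b c]

/-- Cauchy–Schwarz in the first frequency, then Young's inequality with b in L¹ and c in L². -/
theorem triForm_sq_le {a b c : ℤ × ℝ → ℝ≥0∞} (ha : Measurable a) (hb : Measurable b)
    (hc : Measurable c) :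
    triForm l a b c ^ 2 ≤ (∫⁻ p, a p ^ 2 ∂freqMeasure l) *
      ((∫⁻ p, b p ∂freqMeasure l) ^ 2 * ∫⁻ p, c p ^ 2 ∂freqMeasure l) := by
  have hm : Measurable fun q : (ℤ × ℝ) × (ℤ × ℝ) => b q.2 * c (-q.1 - q.2) := by fun_prop
  refine (sq_lintegral_mul_le _ ha.aemeasurable hm.lintegral_prod_right.aemeasurable).trans ?_
  gcongr
  rw [← lintegral_neg_eq_self]
  simp only [neg_neg]
  exact lintegral_conv_sq_le hb hc

/-- The squared weighted norm corresponding to `H²`. -/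
noncomputable def sobSq (l : ℝ) (G : ℤ × ℝ → ℂ) : ℝ≥0∞ :=
  ∫⁻ p, (ENNReal.ofReal (radBr l p ^ 2) * ‖G p‖ₑ) ^ 2 ∂freqMeasure l

theorem weight_measurable {G : ℤ × ℝ → ℂ} (hG : Measurable G) :
    Measurable fun p => ENNReal.ofReal (radBr l p ^ 2) * ‖G p‖ₑ :=
  ((radBr_measurable l).pow_const 2).ennreal_ofReal.mul hG.enorm

/-- `∫ ⟨ζ⟩⁻⁴`. -/
noncomputable def weightConst (l : ℝ) : ℝ≥0∞ :=
  ∫⁻ p, ENNReal.ofReal ((radBr l p ^ 4)⁻¹) ∂freqMeasure l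

/-- In two dimensions H² functions have integrable transforms: Cauchy–Schwarz against ⟨ζ⟩⁻². -/
theorem sq_lintegral_enorm_le {G : ℤ × ℝ → ℂ} (hG : Measurable G) :
    (∫⁻ p, ‖G p‖ₑ ∂freqMeasure l) ^ 2 ≤ weightConst l * sobSq l G := by
  have h1 : ∀ p, ‖G p‖ₑ = ENNReal.ofReal ((radBr l p ^ 2)⁻¹) *
      (ENNReal.ofReal (radBr l p ^ 2) * ‖G p‖ₑ) := by
    intro p
    have := one_le_radBr l p
    rw [← mul_assoc, ← ENNReal.ofReal_mul (by positivity), inv_mul_cancel₀ (by positivity),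
      ENNReal.ofReal_one, one_mul]
  have h2 := sq_lintegral_mul_le (freqMeasure l)
    (f := fun p => ENNReal.ofReal ((radBr l p ^ 2)⁻¹))
    ((radBr_measurable l).pow_const 2).inv.ennreal_ofReal.aemeasurable
    (weight_measurable (l := l) hG).aemeasurable
  simp only [← h1] at h2
  refine h2.trans_eq ?_
  unfold weightConst sobSq
  congr 2
  funext p
  have := one_le_radBr l p
  rw [← ENNReal.ofReal_pow (by positivity), inv_pow, ← pow_mul]

theorem integrable_of_sobSq {G : ℤ × ℝ → ℂ} (hG : Measurable G) (h : sobSq l G ≠ ⊤) :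
    Integrable G (freqMeasure l) := by
  refine ⟨hG.aestronglyMeasurable, lt_top_iff_ne_top.mpr fun h' => ?_⟩
  have h1 := sq_lintegral_enorm_le (l := l) hG
  rw [h'] at h1
  have h2 : weightConst l * sobSq l G ≠ ⊤ := ENNReal.mul_ne_top lintegral_radBr_ne_top h
  exact h2 (top_unique (by simpa using h1))

theorem memLp_of_sobSq {G H : ℤ × ℝ → ℂ} (h : sobSq l G ≠ ⊤) (hH : Measurable H)
    (hle : ∀ p, ‖H p‖ ≤ radBr l p ^ 2 * ‖G p‖) : MemLp H 2 (freqMeasure l) := by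
  refine memLp_two_iff.mpr ⟨hH.aestronglyMeasurable, ne_top_of_le_ne_top h ?_⟩
  refine lintegral_mono fun p => pow_le_pow_left' ?_ 2
  rw [← ofReal_norm, ← ofReal_norm, ← ENNReal.ofReal_mul (by positivity)]
  exact ENNReal.ofReal_le_ofReal (hle p)

/-- The symbol of the cubic increment, acting on `û(ζ₁) û(ζ₂) û(ζ₃)`, `ζ₃ = -ζ₁ - ζ₂`. -/
noncomputable def incSymbol (l : ℝ) (m : ℝ → ℝ) (p p' : ℤ × ℝ) : ℂ :=
  Complex.I * ((p.2 * (p.2 ^ 2 + (p.1 / l) ^ 2) * m (rad l p) *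
    (m (rad l p') * m (rad l (-p - p')) - m (rad l p)) : ℝ) : ℂ)

theorem incSymbol_measurable {m : ℝ → ℝ} (hm : Measurable m) :
    Measurable fun q : (ℤ × ℝ) × (ℤ × ℝ) => incSymbol l m q.1 q.2 := by
  unfold incSymbol
  have h1 : Measurable fun p => m (rad l p) := hm.comp (rad_measurable l)
  have h2 := fst_measurable l
  have h3 : Measurable fun q : (ℤ × ℝ) × (ℤ × ℝ) => m (rad l (-q.1 - q.2)) :=
    h1.comp (by fun_prop)
  have h4 : Measurable fun q : (ℤ × ℝ) × (ℤ × ℝ) => m (rad l q.1) := h1.comp measurable_fst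
  have h5 : Measurable fun q : (ℤ × ℝ) × (ℤ × ℝ) => m (rad l q.2) := h1.comp measurable_snd
  have h6 : Measurable fun q : (ℤ × ℝ) × (ℤ × ℝ) => (q.1.1 : ℝ) / l := h2.comp measurable_fst
  refine Measurable.const_mul (Complex.measurable_ofReal.comp ?_) _
  exact (((measurable_snd.comp measurable_fst).mul
    (((measurable_snd.comp measurable_fst).pow_const 2).add (h6.pow_const 2))).mul h4).mul
    ((h5.mul h3).sub h4)

theorem sq_add_sq_le_radBr_sq (l : ℝ) (p : ℤ × ℝ) :
    p.2 ^ 2 + (p.1 / l) ^ 2 ≤ radBr l p ^ 2 := by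
  have h1 := rad_sq l p
  have h2 := rad_nonneg l p
  unfold radBr
  nlinarith [sq_nonneg p.2]

theorem abs_le_radBr_sq (l : ℝ) (p : ℤ × ℝ) : |p.2| ≤ radBr l p ^ 2 := by
  have h1 := abs_snd_le_rad l p
  have h2 := rad_nonneg l p
  unfold radBr
  nlinarith

/-- The Laplacian uses up the two derivatives available on the first factor. As ξ₁ = -(ξ₂ + ξ₃), the
derivative ∂_x may be charged to one of the other two, and the multipliers are bounded by 1. -/
theorem norm_incSymbol_le {m : ℝ → ℝ} (hm0 : ∀ r, 0 ≤ m r) (hm1 : ∀ r, m r ≤ 1)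
    (p p' : ℤ × ℝ) :
    ‖incSymbol l m p p'‖ ≤ radBr l p ^ 2 * (radBr l p' ^ 2 + radBr l (-p - p') ^ 2) := by
  unfold incSymbol
  rw [norm_mul, Complex.norm_I, one_mul, Complex.norm_real, norm_mul, norm_mul, norm_mul,
    Real.norm_eq_abs, Real.norm_eq_abs, Real.norm_eq_abs, Real.norm_eq_abs]
  have h1 : |p.2| ≤ radBr l p' ^ 2 + radBr l (-p - p') ^ 2 := by
    have h2 := abs_le_radBr_sq l p'
    have h3 := abs_le_radBr_sq l (-p - p')
    have h4 : p.2 = -(p'.2 + (-p - p').2) := by simp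
    rw [h4, abs_neg]
    exact (abs_add_le _ _).trans (add_le_add h2 h3)
  have h5 : |p.2 ^ 2 + (p.1 / l) ^ 2| ≤ radBr l p ^ 2 := by
    rw [abs_of_nonneg (by positivity)]
    exact sq_add_sq_le_radBr_sq l p
  have h6 : |m (rad l p)| ≤ 1 := by rw [abs_of_nonneg (hm0 _)]; exact hm1 _
  have h7 : |m (rad l p') * m (rad l (-p - p')) - m (rad l p)| ≤ 1 := by
    have := mul_nonneg (hm0 (rad l p')) (hm0 (rad l (-p - p')))
    have := mul_le_one₀ (hm1 (rad l p')) (hm0 (rad l (-p - p'))) (hm1 (rad l (-p - p')))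
    rw [abs_le]
    constructor <;> linarith [hm0 (rad l p), hm1 (rad l p)]
  calc _ ≤ (radBr l p' ^ 2 + radBr l (-p - p') ^ 2) * radBr l p ^ 2 * 1 * 1 := by gcongr
    _ = _ := by ring

/-- Absolute convergence of the cubic form on `H²`. -/
theorem lintegral_incSymbol_le {m : ℝ → ℝ} (hm0 : ∀ r, 0 ≤ m r)
    (hm1 : ∀ r, m r ≤ 1) {G : ℤ × ℝ → ℂ} (hG : Measurable G) :
    (∫⁻ p, ∫⁻ p', ‖incSymbol l m p p' * (G p * G p' * G (-p - p'))‖ₑ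
      ∂freqMeasure l ∂freqMeasure l) ^ 2 ≤ 4 * (weightConst l * sobSq l G ^ 3) := by
  set A : ℤ × ℝ → ℝ≥0∞ := fun p => ENNReal.ofReal (radBr l p ^ 2) * ‖G p‖ₑ with hA
  have hAm : Measurable A := weight_measurable hG
  set g : ℤ × ℝ → ℝ≥0∞ := fun p => ‖G p‖ₑ with hg
  have hgm : Measurable g := hG.enorm
  have h1 : ∀ p p', ‖incSymbol l m p p' * (G p * G p' * G (-p - p'))‖ₑ ≤
      A p * (A p' * g (-p - p') + g p' * A (-p - p')) := by
    intro p p'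
    have h2 : ‖incSymbol l m p p'‖ₑ ≤ ENNReal.ofReal (radBr l p ^ 2) *
        (ENNReal.ofReal (radBr l p' ^ 2) + ENNReal.ofReal (radBr l (-p - p') ^ 2)) := by
      rw [← ofReal_norm, ← ENNReal.ofReal_add (by positivity) (by positivity),
        ← ENNReal.ofReal_mul (by positivity)]
      exact ENNReal.ofReal_le_ofReal (norm_incSymbol_le hm0 hm1 p p')
    rw [enorm_mul, enorm_mul, enorm_mul]
    calc _ ≤ ENNReal.ofReal (radBr l p ^ 2) *
        (ENNReal.ofReal (radBr l p' ^ 2) + ENNReal.ofReal (radBr l (-p - p') ^ 2)) *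
          (‖G p‖ₑ * ‖G p'‖ₑ * ‖G (-p - p')‖ₑ) := by gcongr
      _ = _ := by simp only [hA, hg]; ring
  have h3 : ∫⁻ p, ∫⁻ p', ‖incSymbol l m p p' * (G p * G p' * G (-p - p'))‖ₑ
      ∂freqMeasure l ∂freqMeasure l ≤ 2 * triForm l A g A := by
    calc _ ≤ ∫⁻ p, ∫⁻ p', A p * (A p' * g (-p - p') + g p' * A (-p - p'))
          ∂freqMeasure l ∂freqMeasure l := lintegral_mono fun p => lintegral_mono fun p' => h1 p p'
      _ = ∫⁻ p, (A p * ∫⁻ p', A p' * g (-p - p') ∂freqMeasure l) +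
            A p * ∫⁻ p', g p' * A (-p - p') ∂freqMeasure l ∂freqMeasure l := by
          congr 1
          funext p
          rw [lintegral_const_mul _ (by fun_prop), lintegral_add_left (by fun_prop), mul_add]
      _ = triForm l A A g + triForm l A g A := by
          have hm' : Measurable fun q : (ℤ × ℝ) × (ℤ × ℝ) => A q.2 * g (-q.1 - q.2) := by fun_prop
          exact lintegral_add_left (hAm.mul hm'.lintegral_prod_right) _
      _ = 2 * triForm l A g A := by rw [triForm_swap A A g, two_mul]
  calc _ ≤ (2 * triForm l A g A) ^ 2 := pow_le_pow_left' h3 2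
    _ = 4 * triForm l A g A ^ 2 := by rw [mul_pow]; norm_num
    _ ≤ 4 * (sobSq l G * (weightConst l * sobSq l G * sobSq l G)) := by
        gcongr
        refine (triForm_sq_le hAm hgm hAm).trans ?_
        exact mul_le_mul_right (mul_le_mul_left (sq_lintegral_enorm_le hG) _) _
    _ = _ := by ring

end Trilinear

/-! ### The spatial integral as a trilinear form -/

section Increment

variable {l : ℝ} [hl : Fact (1 < l)]

/-- The spatial integral in the cubic increment. -/
noncomputable def incDensity (l : ℝ) [Fact (1 < l)] (m : ℝ → ℝ) (g : Cyl l → ℂ) : ℂ :=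
  ∫ z : Cyl l, opI l m (laplacian l g) z *
    partialX l (fun z' => opI l m g z' ^ 2 - opI l m (fun z'' => g z'' ^ 2) z') z

/-- Parseval pairs the frequency p of IΔg with -p in the second factor. The signs of -(ξ² + q²) and
of i(-ξ) cancel, which gives the symbol its sign. One factor (2π)⁻² comes from Parseval and one from
the convolution. -/
theorem incDensity_eq {m : ℝ → ℝ} (hm : Measurable m) (hm0 : ∀ r, 0 ≤ m r)
    (hm1 : ∀ r, m r ≤ 1) {g : Cyl l → ℂ} (hg : MemLp g 2 volume) {G : ℤ × ℝ → ℂ}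
    (hG : Measurable G) (hgG : cylFT g =ᵐ[freqMeasure l] G) (hS : sobSq l G ≠ ⊤) :
    incDensity l m g = (((2 * π) ^ 4)⁻¹ : ℝ) * ∫ p, ∫ p',
      incSymbol l m p p' * (G p * G p' * G (-p - p')) ∂freqMeasure l ∂freqMeasure l := by
  have hl0 : 0 < l := l_pos
  have hmr : Measurable fun p => (m (rad l p) : ℂ) :=
    Complex.measurable_ofReal.comp (hm.comp (rad_measurable l))
  have hmn : ∀ r, ‖(m r : ℂ)‖ ≤ 1 := fun r => by
    rw [Complex.norm_real, norm_of_nonneg (hm0 r)]; exact hm1 r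
  have hG1 := integrable_of_sobSq hG hS
  have hw : ∀ p, ‖G p‖ ≤ radBr l p ^ 2 * ‖G p‖ := fun p =>
    le_mul_of_one_le_left (norm_nonneg _) (one_le_pow₀ (one_le_radBr l p))
  have hG2 : MemLp G 2 (freqMeasure l) := memLp_of_sobSq hS hG hw
  -- the Laplacian
  set G1 : ℤ × ℝ → ℂ := fun p => -((p.2 ^ 2 + (p.1 / l) ^ 2 : ℝ) : ℂ) * G p with hG1d
  have hsqm : Measurable fun p : ℤ × ℝ => ((p.2 ^ 2 + (p.1 / l) ^ 2 : ℝ) : ℂ) :=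
    Complex.measurable_ofReal.comp ((measurable_snd.pow_const 2).add ((fst_measurable l).pow_const 2))
  have hG1m : Measurable G1 := hsqm.neg.mul hG
  have hG1n : ∀ p, ‖G1 p‖ ≤ radBr l p ^ 2 * ‖G p‖ := by
    intro p
    rw [hG1d]
    simp only
    rw [norm_mul, norm_neg, Complex.norm_real, norm_of_nonneg (by positivity)]
    gcongr
    exact sq_add_sq_le_radBr_sq l p
  obtain ⟨a1, a2⟩ := fourierMul_spec (l := l) (fun ξ q => -((ξ ^ 2 + q ^ 2 : ℝ) : ℂ)) g hG1m
    (memLp_of_sobSq hS hG1m hG1n) (by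
      filter_upwards [hgG] with p hp
      simp only [hp, hG1d])
  -- `I` applied to it
  set G2 : ℤ × ℝ → ℂ := fun p => (m (rad l p) : ℂ) * G1 p with hG2d
  have hG2m : Measurable G2 := hmr.mul hG1m
  have hG2n : ∀ p, ‖G2 p‖ ≤ radBr l p ^ 2 * ‖G p‖ := by
    intro p
    rw [hG2d]
    simp only
    rw [norm_mul]
    exact (mul_le_of_le_one_left (norm_nonneg _) (hmn _)).trans (hG1n p)
  obtain ⟨b1, b2⟩ := fourierMul_spec (l := l) (fun ξ q => (m (freqNorm ξ q) : ℂ))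
    (laplacian l g) hG2m (memLp_of_sobSq hS hG2m hG2n) (by
      filter_upwards [a2] with p hp
      simp only [hG2d]
      rw [← hp]
      rfl)
  -- `I g`
  set G3 : ℤ × ℝ → ℂ := fun p => (m (rad l p) : ℂ) * G p with hG3d
  have hG3m : Measurable G3 := hmr.mul hG
  have hG3n : ∀ p, ‖G3 p‖ ≤ ‖G p‖ := by
    intro p
    rw [hG3d]
    simp only
    rw [norm_mul]
    exact mul_le_of_le_one_left (norm_nonneg _) (hmn _)
  have hG3i : Integrable G3 (freqMeasure l) := hG1.mono hG3m.aestronglyMeasurable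
    (ae_of_all _ hG3n)
  obtain ⟨c1, c2⟩ := fourierMul_spec (l := l) (fun ξ q => (m (freqNorm ξ q) : ℂ)) g hG3m
    (memLp_of_sobSq hS hG3m fun p => (hG3n p).trans (hw p)) (by
      filter_upwards [hgG] with p hp
      simp only [hp, hG3d]
      rfl)
  -- the two quadratic terms
  obtain ⟨d1, d2⟩ := cylFT_mul c1 c1 hG3m hG3m c2 c2 hG3i hG3i
  obtain ⟨e1, e2⟩ := cylFT_mul hg hg hG hG hgG hgG hG1 hG1
  have hcm := freqConv_measurable (l := l) hG hG
  have hc2 := memLp_freqConv (l := l) hG hG hG1 hG2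
  set G4 : ℤ × ℝ → ℂ := fun p => (m (rad l p) : ℂ) * freqConv l G G p with hG4d
  have hG4m : Measurable G4 := hmr.mul hcm
  have hG4l : MemLp G4 2 (freqMeasure l) := hc2.mono hG4m.aestronglyMeasurable
    (ae_of_all _ fun p => by
      rw [hG4d]
      simp only
      rw [norm_mul]
      exact mul_le_of_le_one_left (norm_nonneg _) (hmn _))
  obtain ⟨f1, f2⟩ := fourierMul_spec (l := l) (fun ξ q => (m (freqNorm ξ q) : ℂ))
    (fun z => g z * g z) hG4m hG4l (by
      filter_upwards [e2] with p hp
      simp only [hp, hG4d]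
      rfl)
  set Y : ℤ × ℝ → ℂ := fun p => (((2 * π) ^ 2)⁻¹ : ℝ) * ∫ p',
    ((m (rad l p') * m (rad l (p - p')) - m (rad l p) : ℝ) : ℂ) * (G p' * G (p - p'))
      ∂freqMeasure l with hYd
  -- Combining the two convolutions under one integral needs both to converge, which Fubini
  -- guarantees for almost every p only.
  have hYeq : ∀ᵐ p ∂freqMeasure l, freqConv l G3 G3 p - G4 p = Y p := by
    have i1 := (integrable_freqConv_integrand (l := l) hG3i hG3i).prod_right_ae
    have i2 := (integrable_freqConv_integrand (l := l) hG1 hG1).prod_right_ae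
    filter_upwards [i1, i2] with p j1 j2
    simp only [hG4d, hYd, freqConv]
    have : (m (rad l p) : ℂ) * ((((2 * π) ^ 2)⁻¹ : ℝ) *
        ∫ p', G p' * G (p - p') ∂freqMeasure l) = (((2 * π) ^ 2)⁻¹ : ℝ) *
        ∫ p', (m (rad l p) : ℂ) * (G p' * G (p - p')) ∂freqMeasure l := by
      rw [integral_const_mul]; ring
    rw [this, ← mul_sub, ← integral_sub j1 (j2.const_mul _)]
    congr 2
    funext p'
    simp only [hG3d]
    push_cast
    ring
  have hYm : Measurable Y := by
    refine Measurable.const_mul ?_ _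
    have hmr' : Measurable fun p => m (rad l p) := hm.comp (rad_measurable l)
    have h : Measurable fun q : (ℤ × ℝ) × (ℤ × ℝ) =>
        ((m (rad l q.2) * m (rad l (q.1 - q.2)) - m (rad l q.1) : ℝ) : ℂ) *
          (G q.2 * G (q.1 - q.2)) := by
      refine (Complex.measurable_ofReal.comp (((hmr'.comp measurable_snd).mul (hmr'.comp
        (measurable_fst.sub measurable_snd))).sub (hmr'.comp measurable_fst))).mul ?_
      fun_prop
    exact h.stronglyMeasurable.integral_prod_right.measurable
  -- the derivative
  set G5 : ℤ × ℝ → ℂ := fun p => Complex.I * (p.2 : ℂ) * Y p with hG5d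
  have hG5m : Measurable G5 := by
    refine Measurable.mul ?_ hYm
    fun_prop
  -- The factor ξ = ξ' + (ξ - ξ') falls on one of the two functions; that one is in a weighted L²,
  -- the other is in L¹, and Young's inequality applies.
  have hG5l : MemLp G5 2 (freqMeasure l) := by
    set A : ℤ × ℝ → ℝ≥0∞ := fun p => ENNReal.ofReal (radBr l p ^ 2) * ‖G p‖ₑ with hA
    have hAm : Measurable A := weight_measurable hG
    have hle : ∀ p, ‖G5 p‖ₑ ≤ 2 * ∫⁻ p', ‖G p'‖ₑ * A (p - p') ∂freqMeasure l := by
      intro p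
      have k1 : ‖Y p‖ₑ ≤ ∫⁻ p', ‖G p'‖ₑ * ‖G (p - p')‖ₑ ∂freqMeasure l := by
        rw [hYd]
        simp only
        rw [enorm_mul]
        refine (mul_le_of_le_one_left' ?_).trans
          ((enorm_integral_le_lintegral_enorm _).trans (lintegral_mono fun p' => ?_))
        · rw [← ofReal_norm, Complex.norm_real, norm_of_nonneg (by positivity),
            ENNReal.ofReal_le_one]
          apply inv_le_one_of_one_le₀
          nlinarith [pi_gt_three]
        · rw [enorm_mul, enorm_mul]
          refine mul_le_of_le_one_left' ?_
          rw [← ofReal_norm, ENNReal.ofReal_le_one, Complex.norm_real, Real.norm_eq_abs]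
          have := mul_nonneg (hm0 (rad l p')) (hm0 (rad l (p - p')))
          have := mul_le_one₀ (hm1 (rad l p')) (hm0 (rad l (p - p'))) (hm1 (rad l (p - p')))
          rw [abs_le]
          constructor <;> linarith [hm0 (rad l p), hm1 (rad l p)]
      have k2 : ‖G5 p‖ₑ = ENNReal.ofReal |p.2| * ‖Y p‖ₑ := by
        rw [hG5d]
        simp only
        rw [enorm_mul, enorm_mul, ← ofReal_norm, ← ofReal_norm, Complex.norm_I,
          ENNReal.ofReal_one, one_mul, Complex.norm_real, Real.norm_eq_abs]
      rw [k2]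
      calc _ ≤ ENNReal.ofReal |p.2| * ∫⁻ p', ‖G p'‖ₑ * ‖G (p - p')‖ₑ ∂freqMeasure l := by gcongr
        _ = ∫⁻ p', ENNReal.ofReal |p.2| * (‖G p'‖ₑ * ‖G (p - p')‖ₑ) ∂freqMeasure l := by
            rw [lintegral_const_mul _ (by fun_prop)]
        _ ≤ ∫⁻ p', (A p' * ‖G (p - p')‖ₑ + ‖G p'‖ₑ * A (p - p')) ∂freqMeasure l := by
            refine lintegral_mono fun p' => ?_
            have k3 : ENNReal.ofReal |p.2| ≤ ENNReal.ofReal (radBr l p' ^ 2) +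
                ENNReal.ofReal (radBr l (p - p') ^ 2) := by
              rw [← ENNReal.ofReal_add (by positivity) (by positivity)]
              apply ENNReal.ofReal_le_ofReal
              have : p.2 = p'.2 + (p - p').2 := by simp
              rw [this]
              exact (abs_add_le _ _).trans (add_le_add (abs_le_radBr_sq l _) (abs_le_radBr_sq l _))
            calc _ ≤ (ENNReal.ofReal (radBr l p' ^ 2) +
                ENNReal.ofReal (radBr l (p - p') ^ 2)) * (‖G p'‖ₑ * ‖G (p - p')‖ₑ) := by gcongr
              _ = _ := by simp only [hA]; ring
        _ = _ := by
            rw [lintegral_add_left (by fun_prop), two_mul]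
            congr 1
            have := lintegral_neg_sub_swap (l := l) A (fun p => ‖G p‖ₑ) (-p)
            simp only [neg_neg] at this
            exact this
    refine memLp_two_iff.mpr ⟨hG5m.aestronglyMeasurable, ?_⟩
    refine ne_top_of_le_ne_top ?_ (lintegral_mono fun p => pow_le_pow_left' (hle p) 2)
    simp only [mul_pow]
    rw [lintegral_const_mul' _ _ (by norm_num)]
    refine ENNReal.mul_ne_top (by norm_num) (ne_top_of_le_ne_top ?_
      (lintegral_conv_sq_le hG.enorm hAm))
    exact ENNReal.mul_ne_top (ENNReal.pow_ne_top hG1.2.ne) hS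
  have hX : (fun z' => opI l m g z' ^ 2 - opI l m (fun z'' => g z'' ^ 2) z') =
      fun z => (fourierMul l (fun ξ q => (m (freqNorm ξ q) : ℂ)) g z *
        fourierMul l (fun ξ q => (m (freqNorm ξ q) : ℂ)) g z) -
        fourierMul l (fun ξ q => (m (freqNorm ξ q) : ℂ)) (fun z => g z * g z) z := by
    funext z
    simp only [opI, sq]
  obtain ⟨h1, h2⟩ := fourierMul_spec (l := l) (fun ξ _ => Complex.I * (ξ : ℂ))
    (fun z => (fourierMul l (fun ξ q => (m (freqNorm ξ q) : ℂ)) g z *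
        fourierMul l (fun ξ q => (m (freqNorm ξ q) : ℂ)) g z) -
        fourierMul l (fun ξ q => (m (freqNorm ξ q) : ℂ)) (fun z => g z * g z) z) hG5m hG5l (by
      filter_upwards [cylFT_sub d1 f1, d2, f2, hYeq] with p s1 s2 s3 s4
      rw [s1, s2, s3, s4])
  unfold incDensity partialX opI laplacian at *
  rw [hX]
  rw [integral_mul_eq_cylFT b1 h1]
  have hneg := (Measure.measurePreserving_neg (freqMeasure l)).quasiMeasurePreserving.ae_eq h2
  have hfin : ∫ p, cylFT (fourierMul l (fun ξ q => (m (freqNorm ξ q) : ℂ))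
      (fourierMul l (fun ξ q => -((ξ ^ 2 + q ^ 2 : ℝ) : ℂ)) g)) p *
      cylFT (fourierMul l (fun ξ _ => Complex.I * (ξ : ℂ)) (fun z =>
        (fourierMul l (fun ξ q => (m (freqNorm ξ q) : ℂ)) g z *
        fourierMul l (fun ξ q => (m (freqNorm ξ q) : ℂ)) g z) -
        fourierMul l (fun ξ q => (m (freqNorm ξ q) : ℂ)) (fun z => g z * g z) z)) (-p)
        ∂freqMeasure l = ∫ p, (((2 * π) ^ 2)⁻¹ : ℝ) * ∫ p',
      incSymbol l m p p' * (G p * G p' * G (-p - p')) ∂freqMeasure l ∂freqMeasure l := by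
    apply integral_congr_ae
    filter_upwards [b2, hneg] with p s1 s2
    have s2' := s2
    simp only [Function.comp] at s2'
    rw [s1, s2']
    simp only [hG2d, hG1d, hG5d, hYd, rad_neg, Prod.snd_neg]
    rw [← mul_assoc, ← integral_const_mul, ← integral_const_mul, ← integral_const_mul]
    congr 1
    funext p'
    unfold incSymbol
    push_cast
    ring
  rw [hfin, integral_const_mul, ← mul_assoc, ← Complex.ofReal_mul]
  congr 2
  rw [← mul_inv, ← pow_add]

end Increment


/-! ### Partial Plancherel transforms in the plane -/

/-- The plane as a product of lines. -/
noncomputable def planeEquiv : ℝ × ℝ ≃ᵐ EuclideanSpace ℝ (Fin 2) :=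
  MeasurableEquiv.finTwoArrow.symm.trans (MeasurableEquiv.toLp 2 (Fin 2 → ℝ))

theorem planeEquiv_zero (q : ℝ × ℝ) : planeEquiv q 0 = q.1 := rfl

theorem planeEquiv_one (q : ℝ × ℝ) : planeEquiv q 1 = q.2 := rfl

theorem planeEquiv_measurePreserving : MeasurePreserving planeEquiv (volume.prod volume) volume :=
  (PiLp.volume_preserving_toLp (Fin 2)).comp (volume_preserving_finTwoArrow ℝ).symm

theorem inner_planeEquiv (q r : ℝ × ℝ) :
    inner ℝ (planeEquiv q) (planeEquiv r) = inner ℝ q.1 r.1 + inner ℝ q.2 r.2 := by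
  rw [PiLp.inner_apply, Fin.sum_univ_two]
  rfl

theorem ae_planeEquiv {P : EuclideanSpace ℝ (Fin 2) → Prop} (h : ∀ᵐ p, P p) :
    ∀ᵐ q : ℝ × ℝ ∂(volume.prod volume), P (planeEquiv q) :=
  planeEquiv_measurePreserving.quasiMeasurePreserving.ae h

theorem invFourierIntegral_plane (α G : ℝ → ℂ) (r : ℝ × ℝ) :
    invFourierIntegral (fun p : EuclideanSpace ℝ (Fin 2) => α (p 0) * G (p 1)) (planeEquiv r) =
      invFourierIntegral α r.1 * invFourierIntegral G r.2 := by
  unfold invFourierIntegral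
  rw [← planeEquiv_measurePreserving.integral_comp']
  have h : ∀ q : ℝ × ℝ, Complex.exp (Complex.I *
      ((inner ℝ (planeEquiv q) (planeEquiv r) : ℝ) : ℂ)) *
      (α (planeEquiv q 0) * G (planeEquiv q 1)) =
      (Complex.exp (Complex.I * ((inner ℝ q.1 r.1 : ℝ) : ℂ)) * α q.1) *
      (Complex.exp (Complex.I * ((inner ℝ q.2 r.2 : ℝ) : ℂ)) * G q.2) := by
    intro q
    rw [planeEquiv_zero, planeEquiv_one, inner_planeEquiv, Complex.ofReal_add, mul_add,
      Complex.exp_add]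
    ring
  simp only [h]
  rw [integral_prod_mul (fun t => Complex.exp (Complex.I * ((inner ℝ t r.1 : ℝ) : ℂ)) * α t)
    (fun t => Complex.exp (Complex.I * ((inner ℝ t r.2 : ℝ) : ℂ)) * G t)]
  simp only [finrank_euclideanSpace, Fintype.card_fin, Module.finrank_self]
  push_cast
  ring

theorem tensor_integrable {α G : ℝ → ℂ} (hα : Integrable α) (hG : Integrable G) :
    Integrable (fun p : EuclideanSpace ℝ (Fin 2) => α (p 0) * G (p 1)) := by
  have h : Integrable (fun q : ℝ × ℝ => α q.1 * G q.2) (volume.prod volume) := hα.mul_prod hG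
  exact (planeEquiv_measurePreserving.integrable_comp_emb planeEquiv.measurableEmbedding).mp h

theorem tensor_memLp_prod {α G : ℝ → ℂ} (hα : MemLp α 2 volume) (hG : MemLp G 2 volume) :
    MemLp (fun q : ℝ × ℝ => α q.1 * G q.2) 2 (volume.prod volume) := by
  have h1 := memLp_two_iff.mp hα
  have h2 := memLp_two_iff.mp hG
  refine memLp_two_iff.mpr ⟨hα.1.comp_fst.mul hG.1.comp_snd, ?_⟩
  simp only [enorm_mul, mul_pow]
  rw [lintegral_prod_mul (h1.1.enorm.pow_const 2) (h2.1.enorm.pow_const 2)]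
  exact ENNReal.mul_ne_top h1.2 h2.2

theorem memLp_plane_iff {f : EuclideanSpace ℝ (Fin 2) → ℂ} :
    MemLp (fun q : ℝ × ℝ => f (planeEquiv q)) 2 (volume.prod volume) ↔ MemLp f 2 volume := by
  rw [← planeEquiv_measurePreserving.map_eq, planeEquiv.measurableEmbedding.memLp_map_measure_iff]
  rfl

theorem tensor_memLp {α G : ℝ → ℂ} (hα : MemLp α 2 volume) (hG : MemLp G 2 volume) :
    MemLp (fun p : EuclideanSpace ℝ (Fin 2) => α (p 0) * G (p 1)) 2 volume :=
  memLp_plane_iff.mp (tensor_memLp_prod hα hG)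

/-- A square integrable function orthogonal to all Schwartz functions of a countable dense family
vanishes. -/
theorem exists_countable_schwartz : ∃ S : Set (SchwartzMap ℝ ℂ), S.Countable ∧
    ∀ D : ℝ → ℂ, MemLp D 2 volume → (∀ ψ ∈ S, ∫ x, D x * ψ x = 0) → D =ᵐ[volume] 0 := by
  have : Fact ((2 : ℝ≥0∞) ≠ ⊤) := ⟨by norm_num⟩
  have : SecondCountableTopology (Lp ℂ 2 (volume : Measure ℝ)) := Lp.SecondCountableTopology
  have hd : Dense (Set.range (SchwartzMap.toLpCLM ℝ (E := ℝ) ℂ 2 volume)) :=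
    SchwartzMap.denseRange_toLpCLM (E := ℝ) (F := ℂ) (p := 2) (μ := volume) ENNReal.ofNat_ne_top
  obtain ⟨t, ht, htc, htd⟩ := hd.exists_countable_dense_subset
  have ht' : ∀ u ∈ t, ∃ ψ : SchwartzMap ℝ ℂ, ψ.toLp 2 (volume : Measure ℝ) = u := fun u hu => ht hu
  choose! φ hφ using ht'
  refine ⟨φ '' t, htc.image φ, fun D hD h => ?_⟩
  set B := ContinuousLinearMap.lpPairing (volume : Measure ℝ) 2 2 (ContinuousLinearMap.mul ℂ ℂ)
    with hB
  have h1 : ∀ u ∈ t, B hD.toLp u = 0 := by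
    intro u hu
    rw [hB, lpPairing_mul_apply, ← h (φ u) ⟨u, hu, rfl⟩]
    apply integral_congr_ae
    have e : u =ᵐ[volume] φ u := by
      have := SchwartzMap.coeFn_toLp (φ u) 2 (volume : Measure ℝ)
      have h2 : (φ u).toLp 2 (volume : Measure ℝ) = u := hφ u hu
      rw [h2] at this
      exact this
    filter_upwards [hD.coeFn_toLp, e] with x hx hx'
    rw [hx, hx']
  have h2 : ∀ u, B hD.toLp u = 0 := by
    intro u
    have hcl : IsClosed {u | B hD.toLp u = 0} :=
      isClosed_eq (B hD.toLp).continuous continuous_const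
    exact hcl.closure_subset_iff.mpr h1 (htd u)
  have hs : MemLp (fun x => (starRingEnd ℂ) (D x)) 2 volume := hD.star
  have h3 := h2 hs.toLp
  rw [hB, lpPairing_mul_apply] at h3
  have h4 : ∫ x, ((‖D x‖ ^ 2 : ℝ) : ℂ) = 0 := by
    rw [← h3]
    apply integral_congr_ae
    filter_upwards [hD.coeFn_toLp, hs.coeFn_toLp] with x hx hx'
    rw [hx, hx', Complex.mul_conj, Complex.normSq_eq_norm_sq]
  have h4' : ((∫ x, ‖D x‖ ^ 2 : ℝ) : ℂ) = 0 := by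
    rw [← h4]
    exact integral_ofReal.symm
  rw [Complex.ofReal_eq_zero] at h4'
  have hi : Integrable (fun x => ‖D x‖ ^ 2) := hD.integrable_norm_pow (by norm_num)
  rw [integral_eq_zero_iff_of_nonneg (fun x => by positivity) hi] at h4'
  filter_upwards [h4'] with x hx
  simpa using hx

/-- Compactly supported smooth functions are inverse Fourier integrals of `L¹ ∩ L²` functions. -/
theorem exists_invFourierIntegral_eq (φ : SchwartzMap ℝ ℂ) :
    ∃ α : ℝ → ℂ, Integrable α ∧ MemLp α 2 volume ∧ invFourierIntegral α = φ := by
  let ψ : SchwartzMap ℝ ℂ := 𝓕 φ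
  obtain ⟨k1, k2⟩ := integrable_and_memLp_comp_smul ψ.integrable
    (ψ.memLp 2 (volume : Measure ℝ)) (inv_pos.mpr two_pi_pos)
  refine ⟨_, k1, k2, ?_⟩
  funext x
  rw [invFourierIntegral_eq]
  have h1 : (fun w : ℝ => ψ ((2 * π)⁻¹ • (2 * π) • w)) = ψ := by
    funext w
    rw [smul_smul, inv_mul_cancel₀ two_pi_pos.ne', one_smul]
  have h2 := Real.fourierInv_eq_fourier_neg (⇑ψ) x
  calc _ = 𝓕 (⇑ψ) (-x) := by
        show 𝓕 (fun w : ℝ => ψ ((2 * π)⁻¹ • (2 * π) • w)) (-x) = _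
        rw [h1]
    _ = (𝓕⁻ ψ : SchwartzMap ℝ ℂ) x := by rw [← h2, SchwartzMap.fourierInv_coe]
    _ = φ x := by rw [FourierPair.fourierInv_fourier_eq]


theorem enorm_invFourierIntegral_le (G : ℝ → ℂ) (t : ℝ) :
    ‖invFourierIntegral G t‖ₑ ≤ ENNReal.ofReal (2 * π)⁻¹ * ∫⁻ τ, ‖G τ‖ₑ := by
  unfold invFourierIntegral
  rw [enorm_mul]
  have h0 : ‖((((2 * π) ^ Module.finrank ℝ ℝ)⁻¹ : ℝ) : ℂ)‖ₑ = ENNReal.ofReal (2 * π)⁻¹ := by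
    rw [Module.finrank_self, pow_one, ← ofReal_norm, Complex.norm_real,
      Real.norm_of_nonneg (by positivity)]
  rw [h0]
  gcongr
  refine (enorm_integral_le_lintegral_enorm _).trans (lintegral_mono fun τ => ?_)
  have : ‖Complex.exp (Complex.I * ((inner ℝ τ t : ℝ) : ℂ))‖ₑ = 1 := by
    rw [← ofReal_norm, mul_comm, Complex.norm_exp_ofReal_mul_I, ENNReal.ofReal_one]
  rw [enorm_mul, this, one_mul]

theorem invFourierIntegral_stronglyMeasurable {X : Type*} [MeasurableSpace X] {F : ℝ → X → ℂ}
    (hF : StronglyMeasurable (fun q : ℝ × X => F q.1 q.2)) :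
    StronglyMeasurable (fun q : ℝ × X => invFourierIntegral (fun τ => F τ q.2) q.1) := by
  unfold invFourierIntegral
  refine StronglyMeasurable.const_mul ?_ _
  have h : StronglyMeasurable (fun z : (ℝ × X) × ℝ =>
      Complex.exp (Complex.I * ((inner ℝ z.2 z.1.1 : ℝ) : ℂ)) * F z.2 z.1.2) := by
    refine StronglyMeasurable.mul ?_ (hF.comp_measurable
      (measurable_snd.prodMk (measurable_snd.comp measurable_fst)))
    have : Continuous (fun z : ℝ × ℝ => Complex.exp (Complex.I * ((inner ℝ z.2 z.1 : ℝ) : ℂ))) := by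
      fun_prop
    exact this.stronglyMeasurable.comp_measurable
      ((measurable_fst.comp measurable_fst).prodMk measurable_snd)
  exact h.integral_prod_right

/-- The plane transform, inverted in τ alone, is the transform in x of almost every time slice. The
proof is by duality against products a(t)ψ(ξ). The hypothesis `hW` makes the τ-integral converge for
almost every ξ and bounds it in L²(dξ) uniformly in t. -/
theorem plancherel_slice_ae_eq {H : ℝ → ℝ → ℂ} {F : ℝ → ℝ → ℂ}
    (hH : MemLp (fun q : ℝ × ℝ => H q.1 q.2) 2 (volume.prod volume))
    (hF : ∀ τ ξ, F τ ξ = plancherel (fun p : EuclideanSpace ℝ (Fin 2) => H (p 0) (p 1)) !₂[τ, ξ])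
    (hW : ∫⁻ ξ, (∫⁻ τ, ‖F τ ξ‖ₑ) ^ 2 ≠ ⊤) :
    ∀ᵐ t, plancherel (H t) =ᵐ[volume] fun ξ => invFourierIntegral (fun τ => F τ ξ) t := by
  set HE : EuclideanSpace ℝ (Fin 2) → ℂ := fun p => H (p 0) (p 1) with hHE
  have hHE2 : MemLp HE 2 volume := memLp_plane_iff.mp hH
  have hFs : StronglyMeasurable (fun q : ℝ × ℝ => F q.1 q.2) := by
    simp only [hF]
    exact (plancherel_stronglyMeasurable HE).comp_measurable planeEquiv.measurable
  have hF2 : MemLp (fun q : ℝ × ℝ => F q.1 q.2) 2 (volume.prod volume) := by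
    simp only [hF]
    exact memLp_plane_iff.mpr (memLp_plancherel HE)
  set V : ℝ → ℝ → ℂ := fun t ξ => invFourierIntegral (fun τ => F τ ξ) t with hV
  set W : ℝ → ℝ≥0∞ := fun ξ => ENNReal.ofReal (2 * π)⁻¹ * ∫⁻ τ, ‖F τ ξ‖ₑ with hWdef
  have hVs : StronglyMeasurable (fun q : ℝ × ℝ => V q.1 q.2) :=
    invFourierIntegral_stronglyMeasurable hFs
  have hVW : ∀ t ξ, ‖V t ξ‖ₑ ≤ W ξ := fun t ξ => enorm_invFourierIntegral_le _ t
  have hWm : Measurable W := (hFs.enorm.lintegral_prod_left).const_mul _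
  have hW2 : ∫⁻ ξ, W ξ ^ 2 ≠ ⊤ := by
    simp only [hWdef, mul_pow]
    rw [lintegral_const_mul' _ _ (by finiteness)]
    exact ENNReal.mul_ne_top (by finiteness) hW
  have hVt : ∀ t, MemLp (V t) 2 volume := fun t => memLp_two_iff.mpr
    ⟨(hVs.comp_measurable measurable_prodMk_left).aestronglyMeasurable,
      ne_top_of_le_ne_top hW2 (lintegral_mono fun ξ => by gcongr; exact hVW t ξ)⟩
  have hHt : ∀ᵐ t, MemLp (H t) 2 volume := by
    have h := memLp_two_iff.mp hH
    have h1 := h.2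
    rw [lintegral_prod _ (h.1.enorm.pow_const 2)] at h1
    filter_upwards [h.1.prodMk_left, ae_lt_top' (h.1.enorm.pow_const 2).lintegral_prod_right' h1]
      with t a b
    exact memLp_two_iff.mpr ⟨a, b.ne⟩
  have hFξ : ∀ᵐ ξ, Integrable (fun τ => F τ ξ) ∧ MemLp (fun τ => F τ ξ) 2 volume := by
    have h := memLp_two_iff.mp hF2
    have h1 := h.2
    rw [lintegral_prod_symm _ (h.1.enorm.pow_const 2)] at h1
    have h2 : AEMeasurable (fun ξ => ∫⁻ τ, ‖F τ ξ‖ₑ ^ 2) :=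
      (hFs.enorm.pow_const 2).lintegral_prod_left.aemeasurable
    filter_upwards [ae_lt_top' h2 h1, ae_lt_top (hFs.enorm.lintegral_prod_left.pow_const 2) hW]
      with ξ a b
    have hs : AEStronglyMeasurable (fun τ => F τ ξ) :=
      (hFs.comp_measurable measurable_prodMk_right).aestronglyMeasurable
    refine ⟨⟨hs, ?_⟩, memLp_two_iff.mpr ⟨hs, a.ne⟩⟩
    by_contra hc
    rw [HasFiniteIntegral, not_lt, top_le_iff] at hc
    simp [hc] at b
  obtain ⟨S, hSc, hS⟩ := exists_countable_schwartz
  -- The exceptional set of times may depend on ψ here; countability of `S` removes the dependence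
  -- at the end.
  have key : ∀ ψ ∈ S, ∀ᵐ t, ∫ ξ, V t ξ * ψ ξ = ∫ ξ, plancherel (H t) ξ * ψ ξ := by
    intro ψ _
    set G : ℝ → ℂ := fun ξ => ψ (-ξ) with hG
    have hψ2 : MemLp ψ 2 (volume : Measure ℝ) := ψ.memLp 2 volume
    have hG1 : Integrable G := ψ.integrable.comp_neg
    have hG2 : MemLp G 2 volume :=
      hψ2.comp_measurePreserving (Measure.measurePreserving_neg volume)
    obtain ⟨hh2, hhG⟩ := invFourierIntegral_memLp hG1 hG2
    set h := invFourierIntegral G with hh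
    have e2 : ∀ᵐ t, ∫ ξ, plancherel (H t) ξ * ψ ξ = (2 * π : ℝ) * ∫ x, H t x * h x := by
      filter_upwards [hHt] with t ht
      rw [integral_mul_eq_plancherel ht hh2, Module.finrank_self, pow_one, ← mul_assoc,
        ← Complex.ofReal_mul, mul_inv_cancel₀ two_pi_pos.ne', Complex.ofReal_one, one_mul]
      apply integral_congr_ae
      have := (Measure.measurePreserving_neg (volume : Measure ℝ)).quasiMeasurePreserving.ae hhG
      filter_upwards [this] with ξ hξ
      rw [hξ, hG]
      simp
    have hprod1 : ∀ a : ℝ → ℂ, MemLp a 2 volume →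
        Integrable (fun q : ℝ × ℝ => a q.1 * (H q.1 q.2 * h q.2)) (volume.prod volume) := by
      intro a ha
      have := (tensor_memLp_prod ha hh2).integrable_mul hH
      refine this.congr (ae_of_all _ fun q => ?_)
      simp only [Pi.mul_apply]
      ring
    have hVψ : ∫⁻ ξ, W ξ * ‖ψ ξ‖ₑ ≠ ⊤ := by
      intro hc
      have := sq_lintegral_mul_le volume hWm.aemeasurable hψ2.1.enorm
      rw [hc, ENNReal.top_pow two_ne_zero, top_le_iff] at this
      exact ENNReal.mul_ne_top hW2 (memLp_two_iff.mp hψ2).2 this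
    have hprod2 : ∀ a : ℝ → ℂ, Integrable a →
        Integrable (fun q : ℝ × ℝ => a q.1 * (V q.1 q.2 * ψ q.2)) (volume.prod volume) := by
      intro a ha
      have hm : AEStronglyMeasurable (fun q : ℝ × ℝ => a q.1 * (V q.1 q.2 * ψ q.2))
          (volume.prod volume) :=
        ha.1.comp_fst.mul (hVs.aestronglyMeasurable.mul hψ2.1.comp_snd)
      refine ⟨hm, ?_⟩
      rw [HasFiniteIntegral]
      calc _ ≤ ∫⁻ q : ℝ × ℝ, ‖a q.1‖ₑ * (W q.2 * ‖ψ q.2‖ₑ) ∂(volume.prod volume) := by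
            refine lintegral_mono fun q => ?_
            simp only [enorm_mul]
            gcongr
            exact hVW _ _
        _ = (∫⁻ t, ‖a t‖ₑ) * ∫⁻ ξ, W ξ * ‖ψ ξ‖ₑ :=
            lintegral_prod_mul ha.1.enorm (hWm.aemeasurable.mul hψ2.1.enorm)
        _ < ⊤ := ENNReal.mul_lt_top ha.2 hVψ.lt_top
    have hind : ∀ K : Set ℝ, IsCompact K →
        Integrable (K.indicator (1 : ℝ → ℂ)) ∧ MemLp (K.indicator (1 : ℝ → ℂ)) 2 volume := by
      intro K hK
      exact ⟨(integrable_indicator_iff hK.measurableSet).mpr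
        (integrableOn_const hK.measure_lt_top.ne),
        memLp_indicator_const 2 hK.measurableSet 1 (Or.inr hK.measure_lt_top.ne)⟩
    have hloc : ∀ Φ : ℝ → ℝ → ℂ, (∀ K : Set ℝ, IsCompact K →
        Integrable (fun q : ℝ × ℝ => K.indicator (1 : ℝ → ℂ) q.1 * Φ q.1 q.2)
          (volume.prod volume)) → LocallyIntegrable (fun t => ∫ ξ, Φ t ξ) := by
      intro Φ hΦ
      rw [locallyIntegrable_iff]
      intro K hK
      rw [← integrable_indicator_iff hK.measurableSet]
      refine (hΦ K hK).integral_prod_left.congr (ae_of_all _ fun t => ?_)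
      by_cases ht : t ∈ K <;> simp [ht]
    have hl1 : LocallyIntegrable (fun t => ∫ ξ, V t ξ * ψ ξ) :=
      hloc (fun t ξ => V t ξ * ψ ξ) fun K hK => hprod2 _ (hind K hK).1
    have hl2 : LocallyIntegrable (fun t => ((2 * π : ℝ) : ℂ) * ∫ x, H t x * h x) := by
      have := (hloc (fun t x => H t x * h x) fun K hK => hprod1 _ (hind K hK).2).smul
        ((2 * π : ℝ) : ℂ)
      exact this
    -- Both sides are locally integrable in t and are compared as distributions. Each pairing with a
    -- test function a becomes the same integral of F against α(-τ)ψ(ξ), where α is the transform of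
    -- a.
    have e1 : ∀ᵐ t, ∫ ξ, V t ξ * ψ ξ = ((2 * π : ℝ) : ℂ) * ∫ x, H t x * h x := by
      refine ae_eq_of_integral_contDiff_smul_eq hl1 hl2 fun a ha hac => ?_
      have hac' : HasCompactSupport (fun t => (a t : ℂ)) := hac.comp_left Complex.ofReal_zero
      set φ : SchwartzMap ℝ ℂ :=
        hac'.toSchwartzMap (Complex.ofRealCLM.contDiff.comp ha) with hφ
      have hφa : ∀ t, φ t = (a t : ℂ) := fun t => rfl
      obtain ⟨α, hα1, hα2, hα⟩ := exists_invFourierIntegral_eq φ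
      have hα' : ∀ t, invFourierIntegral α t = a t := fun t => by rw [hα, hφa]
      have hφ2 : MemLp φ 2 (volume : Measure ℝ) := φ.memLp 2 volume
      have hpα : plancherel φ =ᵐ[volume] α := by
        rw [← hα]
        exact (invFourierIntegral_memLp hα1 hα2).2
      have hFαG : Integrable (fun q : ℝ × ℝ => F q.1 q.2 * (α (-q.1) * ψ q.2))
          (volume.prod volume) :=
        hF2.integrable_mul (tensor_memLp_prod
          (hα2.comp_measurePreserving (Measure.measurePreserving_neg volume)) hψ2)
      -- Fubini, then Parseval in the time variable for each fixed ξ.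
      have hL : ∫ t, a t • ∫ ξ, V t ξ * ψ ξ =
          ((2 * π)⁻¹ : ℝ) * ∫ q : ℝ × ℝ, F q.1 q.2 * (α (-q.1) * ψ q.2) := by
        have s1 : ∀ t, a t • ∫ ξ, V t ξ * ψ ξ = ∫ ξ, φ t * (V t ξ * ψ ξ) := by
          intro t
          rw [integral_const_mul, hφa, Complex.real_smul]
        simp only [s1]
        rw [integral_integral_swap (f := fun t ξ => φ t * (V t ξ * ψ ξ)) (hprod2 φ φ.integrable),
          Measure.volume_eq_prod, integral_prod_symm _ hFαG, ← integral_const_mul]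
        apply integral_congr_ae
        filter_upwards [hFξ] with ξ hξ
        have s2 : (fun t => φ t * (V t ξ * ψ ξ)) = fun t => ψ ξ * (V t ξ * φ t) := by
          funext t
          ring
        rw [s2, integral_const_mul]
        obtain ⟨v1, v2⟩ := invFourierIntegral_memLp hξ.1 hξ.2
        have s3 := integral_mul_eq_plancherel v1 hφ2
        have s4 : ∫ t, V t ξ * φ t = ∫ t, invFourierIntegral (fun τ => F τ ξ) t * φ t := rfl
        rw [s4, s3, Module.finrank_self, pow_one]
        have s5 : ∫ τ, plancherel (invFourierIntegral fun τ => F τ ξ) τ * plancherel φ (-τ) =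
            ∫ τ, F τ ξ * α (-τ) := by
          apply integral_congr_ae
          have := (Measure.measurePreserving_neg (volume : Measure ℝ)).quasiMeasurePreserving.ae hpα
          filter_upwards [v2, this] with τ a b
          rw [a, b]
        rw [s5]
        have s6 : (fun τ => F τ ξ * (α (-τ) * ψ ξ)) = fun τ => ψ ξ * (F τ ξ * α (-τ)) := by
          funext τ
          ring
        rw [s6, integral_const_mul]
        ring
      -- Parseval in the plane, against the tensor product of a and h.
      have hR : ∫ t, a t • (((2 * π : ℝ) : ℂ) * ∫ x, H t x * h x) =
          ((2 * π)⁻¹ : ℝ) * ∫ q : ℝ × ℝ, F q.1 q.2 * (α (-q.1) * ψ q.2) := by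
        have s1 : ∀ t, a t • (((2 * π : ℝ) : ℂ) * ∫ x, H t x * h x) =
            ((2 * π : ℝ) : ℂ) * ∫ x, φ t * (H t x * h x) := by
          intro t
          rw [integral_const_mul, hφa, Complex.real_smul]
          ring
        simp only [s1]
        rw [integral_const_mul, ← integral_prod (fun q : ℝ × ℝ => φ q.1 * (H q.1 q.2 * h q.2))
          (hprod1 φ hφ2)]
        set Θ : EuclideanSpace ℝ (Fin 2) → ℂ := fun p => α (p 0) * G (p 1) with hΘ
        obtain ⟨t1, t2⟩ := invFourierIntegral_memLp (tensor_integrable hα1 hG1)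
          (tensor_memLp hα2 hG2)
        have s2 := integral_mul_eq_plancherel hHE2 t1
        rw [← planeEquiv_measurePreserving.integral_comp',
          ← planeEquiv_measurePreserving.integral_comp'] at s2
        have s3 : ∫ q : ℝ × ℝ, φ q.1 * (H q.1 q.2 * h q.2) ∂(volume.prod volume) =
            ∫ q : ℝ × ℝ, HE (planeEquiv q) * invFourierIntegral Θ (planeEquiv q)
              ∂(volume.prod volume) := by
          congr 1
          funext q
          rw [invFourierIntegral_plane, hα', hφa]
          show (a q.1 : ℂ) * (H q.1 q.2 * h q.2) = H q.1 q.2 * (a q.1 * h q.2)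
          ring
        rw [s3, s2]
        have s4 : ∫ q : ℝ × ℝ, plancherel HE (planeEquiv q) *
            plancherel (invFourierIntegral Θ) (-planeEquiv q) ∂(volume.prod volume) =
            ∫ q : ℝ × ℝ, F q.1 q.2 * (α (-q.1) * ψ q.2) := by
          apply integral_congr_ae
          have := ae_planeEquiv ((Measure.measurePreserving_neg (volume :
            Measure (EuclideanSpace ℝ (Fin 2)))).quasiMeasurePreserving.ae t2)
          filter_upwards [this] with q hq
          rw [hq, hF]
          show _ * (α (-q.1) * ψ (- -q.2)) = _
          rw [neg_neg]
          rfl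
        rw [s4, finrank_euclideanSpace, Fintype.card_fin, ← mul_assoc, ← Complex.ofReal_mul]
        congr 2
        field_simp
      rw [hL, hR]
    filter_upwards [e1, e2] with t a b
    rw [a, b]
  have key' : ∀ᵐ t, ∀ ψ ∈ S, ∫ ξ, V t ξ * ψ ξ = ∫ ξ, plancherel (H t) ξ * ψ ξ :=
    (ae_ball_iff hSc).mpr key
  filter_upwards [key'] with t ht
  have hD := hS (fun ξ => plancherel (H t) ξ - V t ξ) ((memLp_plancherel _).sub (hVt t))
    (fun ψ hψ => by
      have hψ2 : MemLp ψ 2 (volume : Measure ℝ) := ψ.memLp 2 volume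
      simp only [sub_mul]
      have i1 : Integrable (fun ξ => plancherel (H t) ξ * ψ ξ) :=
        (memLp_plancherel _).integrable_mul hψ2
      have i2 : Integrable (fun ξ => V t ξ * ψ ξ) := (hVt t).integrable_mul hψ2
      rw [integral_sub i1 i2, ht ψ hψ, sub_self])
  filter_upwards [hD] with ξ hξ
  exact sub_eq_zero.mp hξ


/-! ### The Bourgain norm on the space-time Fourier side -/

variable {l : ℝ} [hl : Fact (1 < l)]

/-- The dispersion relation on the frequency space. -/
noncomputable def disp (l : ℝ) (p : ℤ × ℝ) : ℝ := dispersion p.2 (p.1 / l)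

theorem disp_measurable (l : ℝ) : Measurable (disp l) := by
  unfold disp dispersion
  have h := fst_measurable l
  fun_prop

/-- The weight `⟨τ - σ(ζ)⟩^{2b}`. -/
noncomputable def modWeight (l b τ : ℝ) (p : ℤ × ℝ) : ℝ≥0∞ :=
  ENNReal.ofReal (bracket (τ - disp l p) ^ (2 * b))

theorem modWeight_measurable (l b : ℝ) :
    Measurable fun q : (ℤ × ℝ) × ℝ => modWeight l b q.2 q.1 := by
  unfold modWeight
  have h : Measurable fun q : (ℤ × ℝ) × ℝ => disp l q.1 := (disp_measurable l).comp measurable_fst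
  have h2 : Measurable fun q : (ℤ × ℝ) × ℝ => bracket (q.2 - disp l q.1) :=
    bracket_continuous.measurable.comp (measurable_snd.sub h)
  exact (h2.pow_const _).ennreal_ofReal

theorem one_le_modWeight {b : ℝ} (hb : 0 ≤ b) (l τ : ℝ) (p : ℤ × ℝ) : 1 ≤ modWeight l b τ p := by
  unfold modWeight
  rw [ENNReal.one_le_ofReal]
  exact Real.one_le_rpow (one_le_bracket _) (by linarith)

/-- `∫ ⟨x⟩^{-2b} dx`. -/
noncomputable def modConst (b : ℝ) : ℝ≥0∞ := ∫⁻ x : ℝ, ENNReal.ofReal (bracket x ^ (-(2 * b)))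

theorem modConst_ne_top {b : ℝ} (hb : 1 / 2 < b) : modConst b ≠ ⊤ :=
  lintegral_bracket_rpow_ne_top (by linarith)

/-- The square of the Bourgain norm in terms of the space-time Fourier transform. -/
noncomputable def modSq (l b : ℝ) (F : ℝ → ℤ × ℝ → ℂ) : ℝ≥0∞ :=
  ∫⁻ p, ENNReal.ofReal (radBr l p ^ 2) * (∫⁻ τ, modWeight l b τ p * ‖F τ p‖ₑ ^ 2) ∂freqMeasure l

/-- Cauchy–Schwarz against ⟨τ - σ⟩^{-b}; the integral of its square does not see the shift by σ, so
the constant depends on b only. It is finite for b > 1/2. -/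
theorem sq_lintegral_le_modConst {f : ℝ → ℂ} (hf : Measurable f) (l b : ℝ) (p : ℤ × ℝ) :
    (∫⁻ τ, ‖f τ‖ₑ) ^ 2 ≤ modConst b * ∫⁻ τ, modWeight l b τ p * ‖f τ‖ₑ ^ 2 := by
  have hpos : ∀ τ, 0 < bracket (τ - disp l p) := fun τ => one_pos.trans_le (one_le_bracket _)
  have hbm : Measurable fun τ => bracket (τ - disp l p) :=
    bracket_continuous.measurable.comp (measurable_id.sub_const _)
  have h1 : ∀ τ, ‖f τ‖ₑ = ENNReal.ofReal (bracket (τ - disp l p) ^ (-b)) *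
      (ENNReal.ofReal (bracket (τ - disp l p) ^ b) * ‖f τ‖ₑ) := by
    intro τ
    rw [← mul_assoc, ← ENNReal.ofReal_mul (Real.rpow_nonneg (hpos τ).le _),
      ← Real.rpow_add (hpos τ), neg_add_cancel, Real.rpow_zero, ENNReal.ofReal_one, one_mul]
  calc _ = (∫⁻ τ, ENNReal.ofReal (bracket (τ - disp l p) ^ (-b)) *
      (ENNReal.ofReal (bracket (τ - disp l p) ^ b) * ‖f τ‖ₑ)) ^ 2 := by
        congr 2
        funext τ
        exact h1 τ
    _ ≤ _ := sq_lintegral_mul_le _ (hbm.pow_const _).ennreal_ofReal.aemeasurable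
        ((hbm.pow_const _).ennreal_ofReal.mul hf.enorm).aemeasurable
    _ = _ := by
        congr 1
        · unfold modConst
          rw [← lintegral_sub_right_eq_self (fun x : ℝ => ENNReal.ofReal (bracket x ^ (-(2 * b))))
            (disp l p)]
          congr 1
          funext τ
          rw [← ENNReal.ofReal_pow (Real.rpow_nonneg (hpos τ).le _), ← Real.rpow_natCast,
            ← Real.rpow_mul (hpos τ).le]
          congr 2
          push_cast
          ring
        · congr 1
          funext τ
          rw [mul_pow, modWeight, ← ENNReal.ofReal_pow (Real.rpow_nonneg (hpos τ).le _),
            ← Real.rpow_natCast, ← Real.rpow_mul (hpos τ).le]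
          norm_num only [Nat.cast_ofNat]
          rw [mul_comm b 2]

theorem lintegral_sq_lintegral_le_modSq {F : ℝ → ℤ × ℝ → ℂ}
    (hF : Measurable fun q : ℝ × (ℤ × ℝ) => F q.1 q.2) (b : ℝ) :
    ∫⁻ p, (ENNReal.ofReal (radBr l p) * (∫⁻ τ, ‖F τ p‖ₑ)) ^ 2 ∂freqMeasure l ≤
      modConst b * modSq l b F := by
  unfold modSq
  rw [← lintegral_const_mul]
  · refine lintegral_mono fun p => ?_
    rw [mul_pow, ← ENNReal.ofReal_pow (zero_le_one.trans (one_le_radBr l p)), mul_left_comm]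
    gcongr
    exact sq_lintegral_le_modConst (hF.comp measurable_prodMk_right) l b p
  · refine ((radBr_measurable l).pow_const 2).ennreal_ofReal.mul (Measurable.lintegral_prod_right'
      (f := fun q : (ℤ × ℝ) × ℝ => modWeight l b q.2 q.1 * ‖F q.2 q.1‖ₑ ^ 2) ?_)
    exact (modWeight_measurable l b).mul ((hF.comp measurable_swap).enorm.pow_const 2)

/-- This turns `timeInv` into a convergent integral to which one-dimensional inversion applies, for
almost every spatial frequency. -/
theorem ae_integrable_memLp_of_modSq {F : ℝ → ℤ × ℝ → ℂ}
    (hF : Measurable fun q : ℝ × (ℤ × ℝ) => F q.1 q.2) {b : ℝ} (hb : 1 / 2 < b)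
    (h : modSq l b F ≠ ⊤) :
    ∀ᵐ p ∂freqMeasure l, Integrable (fun τ => F τ p) ∧ MemLp (fun τ => F τ p) 2 volume := by
  have hm : Measurable fun p => ENNReal.ofReal (radBr l p ^ 2) *
      ∫⁻ τ, modWeight l b τ p * ‖F τ p‖ₑ ^ 2 := by
    refine ((radBr_measurable l).pow_const 2).ennreal_ofReal.mul (Measurable.lintegral_prod_right'
      (f := fun q : (ℤ × ℝ) × ℝ => modWeight l b q.2 q.1 * ‖F q.2 q.1‖ₑ ^ 2) ?_)
    exact (modWeight_measurable l b).mul ((hF.comp measurable_swap).enorm.pow_const 2)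
  filter_upwards [ae_lt_top hm h] with p hp
  have hFp : Measurable fun τ => F τ p := hF.comp measurable_prodMk_right
  have h1 : ∫⁻ τ, modWeight l b τ p * ‖F τ p‖ₑ ^ 2 ≠ ⊤ := by
    refine ne_top_of_le_ne_top hp.ne (le_mul_of_one_le_left' ?_)
    rw [ENNReal.one_le_ofReal]
    exact one_le_pow₀ (one_le_radBr l p)
  refine ⟨⟨hFp.aestronglyMeasurable, ?_⟩, memLp_two_iff.mpr ⟨hFp.aestronglyMeasurable, ?_⟩⟩
  · rw [HasFiniteIntegral, lt_top_iff_ne_top]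
    intro hc
    have h2 := sq_lintegral_le_modConst hFp l b p
    rw [hc, ENNReal.top_pow two_ne_zero, top_le_iff] at h2
    exact ENNReal.mul_ne_top (modConst_ne_top hb) h1 h2
  · refine ne_top_of_le_ne_top h1 (lintegral_mono fun τ => ?_)
    exact le_mul_of_one_le_left' (one_le_modWeight (by linarith) l τ p)

/-- The space-time Fourier transform as a function on `ℝ × (ℤ × ℝ)`. -/
noncomputable def stHat (v : ℝ → Cyl l → ℂ) (τ : ℝ) (p : ℤ × ℝ) : ℂ :=
  spaceTimeFT l v p.1 !₂[τ, p.2]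

theorem stHat_measurable (v : ℝ → Cyl l → ℂ) :
    Measurable fun q : ℝ × (ℤ × ℝ) => stHat v q.1 q.2 := by
  have h : Measurable fun r : ℤ × (ℝ × ℝ) => spaceTimeFT l v r.1 (planeEquiv r.2) :=
    measurable_from_prod_countable_right fun k =>
      (plancherel_stronglyMeasurable fun p : EuclideanSpace ℝ (Fin 2) =>
        sliceCoeff (v (p 0)) k (p 1)).measurable.comp planeEquiv.measurable
  exact h.comp (f := fun q : ℝ × (ℤ × ℝ) => (q.2.1, (q.1, q.2.2))) (by fun_prop)

theorem memLp_of_bourgainNorm {s b : ℝ} {v : ℝ → Cyl l → ℂ} (h : bourgainNorm l s b v ≠ ⊤) :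
    MemLp (fun p : ℝ × Cyl l => v p.1 p.2) 2 volume := by
  by_contra hc
  exact h (if_neg hc)

theorem bourgainNorm_sq {b : ℝ} {v : ℝ → Cyl l → ℂ} (h : bourgainNorm l 1 b v ≠ ⊤) :
    bourgainNorm l 1 b v ^ 2 = modSq l b (stHat v) := by
  have hv := memLp_of_bourgainNorm h
  unfold bourgainNorm
  rw [if_pos hv, ← ENNReal.rpow_natCast, ← ENNReal.rpow_mul]
  rw [show (1 / 2 : ℝ) * ((2 : ℕ) : ℝ) = 1 by norm_num, ENNReal.rpow_one]
  unfold modSq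
  have hm : Measurable fun q : (ℤ × ℝ) × ℝ => modWeight l b q.2 q.1 * ‖stHat v q.2 q.1‖ₑ ^ 2 :=
    (modWeight_measurable l b).mul (((stHat_measurable v).comp measurable_swap).enorm.pow_const 2)
  have hm' : Measurable fun p => ENNReal.ofReal (radBr l p ^ 2) *
      ∫⁻ τ, modWeight l b τ p * ‖stHat v τ p‖ₑ ^ 2 :=
    ((radBr_measurable l).pow_const 2).ennreal_ofReal.mul hm.lintegral_prod_right'
  rw [lintegral_freqMeasure l hm']
  congr 2
  funext k
  rw [← planeEquiv_measurePreserving.lintegral_comp_emb planeEquiv.measurableEmbedding]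
  have e : ∀ q : ℝ × ℝ, ENNReal.ofReal (bracket (planeEquiv q 0 -
      dispersion (planeEquiv q 1) (k / l)) ^ (2 * b) *
      bracket (freqNorm (planeEquiv q 1) (k / l)) ^ (2 * (1 : ℝ))) *
      ‖spaceTimeFT l v k (planeEquiv q)‖ₑ ^ 2 =
      ENNReal.ofReal (radBr l (k, q.2) ^ 2) *
        (modWeight l b q.1 (k, q.2) * ‖stHat v q.1 (k, q.2)‖ₑ ^ 2) := by
    intro q
    rw [planeEquiv_zero, planeEquiv_one, ENNReal.ofReal_mul
      (Real.rpow_nonneg (zero_le_one.trans (one_le_bracket _)) _), mul_one, Real.rpow_two]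
    have := radBr_eq l (k, q.2)
    simp only at this
    rw [this, mul_comm (ENNReal.ofReal _) (ENNReal.ofReal _), mul_assoc]
    rfl
  simp only [e]
  rw [lintegral_prod_symm]
  · congr 1
    funext ξ
    exact lintegral_const_mul' (ENNReal.ofReal (radBr l (k, ξ) ^ 2))
      (fun τ => modWeight l b τ (k, ξ) * ‖stHat v τ (k, ξ)‖ₑ ^ 2) ENNReal.ofReal_ne_top
  · refine Measurable.aemeasurable ?_
    refine Measurable.mul ?_ (hm.comp (g := fun q : (ℤ × ℝ) × ℝ => modWeight l b q.2 q.1 *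
      ‖stHat v q.2 q.1‖ₑ ^ 2) (f := fun q : ℝ × ℝ => ((k, q.2), q.1)) (by fun_prop))
    exact (((radBr_measurable l).pow_const 2).ennreal_ofReal).comp
      (f := fun q : ℝ × ℝ => (k, q.2)) (by fun_prop)

theorem ae_memLp_section {v : ℝ → Cyl l → ℂ} {μ : Measure ℝ} [SFinite μ]
    (hv : MemLp (fun p : ℝ × Cyl l => v p.1 p.2) 2 (μ.prod volume)) :
    ∀ᵐ t ∂μ, MemLp (v t) 2 volume := by
  have h := memLp_two_iff.mp hv
  have h1 := h.2
  rw [lintegral_prod _ (h.1.enorm.pow_const 2)] at h1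
  filter_upwards [h.1.prodMk_left, ae_lt_top' (h.1.enorm.pow_const 2).lintegral_prod_right' h1]
    with t a b
  exact memLp_two_iff.mpr ⟨a, b.ne⟩

theorem memLp_sliceCoeff_prod {v : ℝ → Cyl l → ℂ}
    (hv : MemLp (fun p : ℝ × Cyl l => v p.1 p.2) 2 volume) (k : ℤ) :
    MemLp (fun q : ℝ × ℝ => sliceCoeff (v q.1) k q.2) 2 (volume.prod volume) := by
  have hm : AEStronglyMeasurable (fun q : ℝ × ℝ => sliceCoeff (v q.1) k q.2)
      (volume.prod volume) := by
    have h1 : AEStronglyMeasurable (fun z : (ℝ × ℝ) × AddCircle (2 * π * l) =>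
        v z.1.1 (z.1.2, z.2)) ((volume.prod volume).prod volume) :=
      hv.1.comp_measurePreserving (volume_preserving_prodAssoc (α₁ := ℝ) (β₁ := ℝ)
        (γ₁ := AddCircle (2 * π * l)))
    have h : AEStronglyMeasurable (fun z : (ℝ × ℝ) × AddCircle (2 * π * l) =>
        fourier (-k) z.2 * v z.1.1 (z.1.2, z.2)) ((volume.prod volume).prod volume) :=
      ((fourier (-k)).continuous.comp continuous_snd).aestronglyMeasurable.mul h1
    exact h.integral_prod_right'
  refine memLp_two_iff.mpr ⟨hm, ?_⟩
  rw [lintegral_prod _ (hm.enorm.pow_const 2)]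
  have h := memLp_two_iff.mp hv
  have h1 := h.2
  rw [Measure.volume_eq_prod, lintegral_prod _ (h.1.enorm.pow_const 2)] at h1
  refine ne_top_of_le_ne_top (ENNReal.mul_ne_top (ENNReal.ofReal_ne_top (r := 2 * π * l)) h1) ?_
  rw [← lintegral_const_mul' _ _ ENNReal.ofReal_ne_top]
  refine lintegral_mono_ae ?_
  filter_upwards [ae_memLp_section hv] with t ht
  rw [← tsum_lintegral_sliceCoeff ht.1 (ae_memLp_slice ht)]
  exact ENNReal.le_tsum (f := fun k => ∫⁻ x, ‖sliceCoeff (v t) k x‖ₑ ^ 2) k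

/-- The inverse Fourier transform in time of the space-time transform. -/
noncomputable def timeInv (F : ℝ → ℤ × ℝ → ℂ) (t : ℝ) (p : ℤ × ℝ) : ℂ :=
  invFourierIntegral (fun τ => F τ p) t

theorem timeInv_measurable {F : ℝ → ℤ × ℝ → ℂ}
    (hF : Measurable fun q : ℝ × (ℤ × ℝ) => F q.1 q.2) :
    Measurable fun q : ℝ × (ℤ × ℝ) => timeInv F q.1 q.2 :=
  (invFourierIntegral_stronglyMeasurable hF.stronglyMeasurable).measurable

/-- The bridge from the space-time norm to fixed times: the slice theorem in the plane for each of
the countably many k, with its integrability hypothesis supplied by b > 1/2. -/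
theorem cylFT_ae_eq_timeInv {b : ℝ} (hb : 1 / 2 < b) {v : ℝ → Cyl l → ℂ}
    (h : bourgainNorm l 1 b v ≠ ⊤) :
    ∀ᵐ t, MemLp (v t) 2 volume ∧ cylFT (v t) =ᵐ[freqMeasure l] timeInv (stHat v) t := by
  have hv := memLp_of_bourgainNorm h
  have hS : modSq l b (stHat v) ≠ ⊤ := by
    rw [← bourgainNorm_sq h]
    exact ENNReal.pow_ne_top h
  have hF := stHat_measurable v
  have hk : ∀ k : ℤ, ∀ᵐ t, plancherel (sliceCoeff (v t) k) =ᵐ[volume]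
      fun ξ => timeInv (stHat v) t (k, ξ) := by
    intro k
    refine plancherel_slice_ae_eq (H := fun t x => sliceCoeff (l := l) (v t) k x)
      (F := fun τ ξ => stHat v τ (k, ξ)) (memLp_sliceCoeff_prod hv k) (fun τ ξ => rfl) ?_
    have hm : Measurable fun p => (∫⁻ τ, ‖stHat v τ p‖ₑ) ^ 2 :=
      (hF.comp measurable_swap).enorm.lintegral_prod_right'.pow_const 2
    refine slice_lintegral_ne_top (l := l) hm ?_ k
    refine ne_top_of_le_ne_top (ENNReal.mul_ne_top (modConst_ne_top hb) hS)
      (le_trans (lintegral_mono fun p => ?_) (lintegral_sq_lintegral_le_modSq hF b))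
    gcongr
    refine le_mul_of_one_le_left' ?_
    rw [ENNReal.one_le_ofReal]
    exact one_le_radBr l p
  filter_upwards [ae_memLp_section hv, ae_all_iff.mpr hk] with t h1 h2
  exact ⟨h1, (ae_freqMeasure (l_pos (l := l))).mpr fun k => h2 k⟩


/-! ### Level sets of quadratic phases -/

/-- Change of variables on each of the two sets where the derivative has a fixed sign; the factor 2
counts the branches. The linear and constant cases are included. -/
theorem lintegral_abs_deriv_quadratic (A B D : ℝ) {g : ℝ → ℝ≥0∞} :
    ∫⁻ x, ENNReal.ofReal |2 * A * x + B| * g (A * x ^ 2 + B * x + D) ≤ 2 * ∫⁻ y, g y := by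
  have hd : ∀ x, HasDerivAt (fun x => A * x ^ 2 + B * x + D) (2 * A * x + B) x := by
    intro x
    have h := ((hasDerivAt_pow 2 x).const_mul A).add ((hasDerivAt_id' x).const_mul B)
    refine (h.add_const D).congr_deriv ?_
    norm_num
    ring
  have key : ∀ s : Set ℝ, MeasurableSet s →
      (∀ x ∈ s, ∀ y ∈ s, 0 < (2 * A * x + B) * (2 * A * y + B)) →
      ∫⁻ x in s, ENNReal.ofReal |2 * A * x + B| * g (A * x ^ 2 + B * x + D) ≤ ∫⁻ y, g y := by
    intro s hs hpos
    -- Two distinct points with equal value are symmetric about the vertex, so their derivatives sum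
    -- to zero and cannot have the same sign.
    have hinj : Set.InjOn (fun x => A * x ^ 2 + B * x + D) s := by
      intro x hx y hy hxy
      have h1 : (x - y) * (A * (x + y) + B) = 0 := by
        simp only at hxy
        linear_combination hxy
      rcases mul_eq_zero.mp h1 with h | h
      · exact sub_eq_zero.mp h
      · have h2 := hpos x hx y hy
        nlinarith [sq_nonneg (2 * A * x + B), sq_nonneg (2 * A * y + B)]
    rw [← lintegral_image_eq_lintegral_abs_deriv_mul hs (fun x _ => (hd x).hasDerivWithinAt) hinj]
    exact setLIntegral_le_lintegral _ _
  have hm : Measurable fun x : ℝ => 2 * A * x + B := by fun_prop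
  have hs1 : MeasurableSet {x : ℝ | 0 < 2 * A * x + B} := measurableSet_lt measurable_const hm
  have hs2 : MeasurableSet {x : ℝ | 2 * A * x + B < 0} := measurableSet_lt hm measurable_const
  have h1 := key _ hs1 fun x hx y hy => mul_pos hx hy
  have h2 := key _ hs2 fun x hx y hy => mul_pos_of_neg_of_neg hx hy
  set φ : ℝ → ℝ≥0∞ := fun x => ENNReal.ofReal |2 * A * x + B| * g (A * x ^ 2 + B * x + D) with hφ
  have hsplit : ∫⁻ x, φ x = (∫⁻ x in {x : ℝ | 0 < 2 * A * x + B}, φ x) +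
      ∫⁻ x in {x : ℝ | 0 < 2 * A * x + B}ᶜ, φ x := (lintegral_add_compl φ hs1).symm
  have h3 : ∫⁻ x in {x : ℝ | 0 < 2 * A * x + B}ᶜ, φ x =
      ∫⁻ x in {x : ℝ | 2 * A * x + B < 0}, φ x := by
    rw [← lintegral_indicator hs1.compl, ← lintegral_indicator hs2]
    congr 1
    funext x
    rcases lt_trichotomy (2 * A * x + B) 0 with h | h | h
    · rw [Set.indicator_of_mem (by simpa using h.le), Set.indicator_of_mem (by exact h)]
    · rw [Set.indicator_of_mem (by simp [h]), Set.indicator_of_notMem (by simp [h])]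
      simp [hφ, h]
    · rw [Set.indicator_of_notMem (by simpa using h), Set.indicator_of_notMem (by simpa using h.le)]
  rw [hsplit, h3]
  exact (add_le_add h1 h2).trans_eq (two_mul _).symm

/-- Within |A|^{-1/2} of the vertex g is bounded by 1. Farther away the derivative is at least
2|A|^{1/2}, and the previous change of variables applies. -/
theorem lintegral_quadratic_le {A : ℝ} (hA : A ≠ 0) (B D : ℝ) {g : ℝ → ℝ≥0∞}
    (hg1 : ∀ y, g y ≤ 1) :
    ∫⁻ x, g (A * x ^ 2 + B * x + D) ≤ ENNReal.ofReal |A|⁻¹.sqrt * (2 + ∫⁻ y, g y) := by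
  set a := √|A| with ha
  have ha0 : 0 < a := Real.sqrt_pos.mpr (abs_pos.mpr hA)
  have haa : a * a = |A| := Real.mul_self_sqrt (abs_nonneg A)
  have hinv : √|A|⁻¹ = a⁻¹ := Real.sqrt_inv _
  set h := -B / (2 * A) with hh
  set s : Set ℝ := Set.Icc (h - a⁻¹) (h + a⁻¹) with hs
  have hB : ∀ x, 2 * A * x + B = 2 * A * (x - h) := by
    intro x
    rw [hh]
    field_simp
    ring
  have hpt : ∀ x, g (A * x ^ 2 + B * x + D) ≤ s.indicator 1 x + ENNReal.ofReal (2 * a)⁻¹ *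
      (ENNReal.ofReal |2 * A * x + B| * g (A * x ^ 2 + B * x + D)) := by
    intro x
    by_cases hx : x ∈ s
    · rw [Set.indicator_of_mem hx]
      exact (hg1 _).trans (le_add_right le_rfl)
    · rw [Set.indicator_of_notMem hx, zero_add, ← mul_assoc, ← ENNReal.ofReal_mul (by positivity)]
      refine le_mul_of_one_le_left' ?_
      rw [ENNReal.one_le_ofReal, hB, abs_mul, abs_mul, abs_two, ← haa]
      have h1 : a⁻¹ ≤ |x - h| := by
        by_contra hc
        push Not at hc
        rw [abs_lt] at hc
        exact hx ⟨by linarith [hc.1], by linarith [hc.2]⟩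
      calc (1 : ℝ) = (2 * a)⁻¹ * (2 * (a * a) * a⁻¹) := by field_simp
        _ ≤ _ := by gcongr
  refine (lintegral_mono hpt).trans ?_
  have hsm : MeasurableSet s := measurableSet_Icc
  rw [lintegral_add_left (measurable_one.indicator hsm), lintegral_indicator_one hsm,
    lintegral_const_mul' _ _ ENNReal.ofReal_ne_top, hs, Real.volume_Icc, mul_add, hinv]
  have h2 : ENNReal.ofReal (h + a⁻¹ - (h - a⁻¹)) = ENNReal.ofReal a⁻¹ * 2 := by
    rw [← ENNReal.ofReal_ofNat 2, ← ENNReal.ofReal_mul (by positivity)]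
    congr 1
    ring
  rw [h2]
  refine add_le_add le_rfl ?_
  calc _ ≤ ENNReal.ofReal (2 * a)⁻¹ * (2 * ∫⁻ y, g y) := by
        gcongr
        exact lintegral_abs_deriv_quadratic A B D
    _ = _ := by
        rw [← mul_assoc, ← ENNReal.ofReal_ofNat 2, ← ENNReal.ofReal_mul (by positivity)]
        congr 2
        field_simp

/-- Each grid point counted owns a cell of length 1/l ≤ 1, and these disjoint cells lie in the
interval enlarged by 1. The bound is therefore uniform in l. -/
theorem tsum_near_le {l : ℝ} (hl : 1 < l) (x₀ L : ℝ) :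
    ENNReal.ofReal l⁻¹ * ∑' k : ℤ, {x : ℝ | |x - x₀| ≤ L}.indicator 1 ((k : ℝ) / l) ≤
      ENNReal.ofReal (2 * (L + 1)) := by
  have hl0 : 0 < l := one_pos.trans hl
  have hinv : l⁻¹ ≤ 1 := inv_le_one_of_one_le₀ hl.le
  have h0 : ENNReal.ofReal (2 * (L + 1)) =
      ∫⁻ x, (Set.Icc (x₀ - (L + 1)) (x₀ + (L + 1))).indicator 1 x := by
    rw [lintegral_indicator_one measurableSet_Icc, Real.volume_Icc]
    congr 1
    ring
  rw [h0, lintegral_eq_tsum_grid hl0, ← ENNReal.tsum_mul_left]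
  refine ENNReal.tsum_le_tsum fun k => ?_
  by_cases hk : (k : ℝ) / l ∈ {x : ℝ | |x - x₀| ≤ L}
  · rw [Set.indicator_of_mem hk]
    have hk' := abs_le.mp (show |(k : ℝ) / l - x₀| ≤ L from hk)
    have h1 : ∀ x ∈ Set.Ioc ((k : ℝ) / l) ((k + 1) / l),
        (1 : ℝ≥0∞) ≤ (Set.Icc (x₀ - (L + 1)) (x₀ + (L + 1))).indicator 1 x := by
      intro x hx
      have h5 : ((k : ℝ) + 1) / l = k / l + l⁻¹ := by rw [add_div, one_div]
      rw [Set.indicator_of_mem]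
      · rfl
      · constructor <;> linarith [hx.1, hx.2, hk'.1, hk'.2]
    refine le_trans (le_of_eq ?_) (setLIntegral_mono' measurableSet_Ioc h1)
    rw [setLIntegral_const, Real.volume_Ioc, one_mul, Pi.one_apply, mul_one]
    congr 1
    rw [← sub_div, add_sub_cancel_left, one_div]
  · rw [Set.indicator_of_notMem hk, mul_zero]
    exact zero_le

/-! ### The two resonance kernels -/

/-- The kernel for frequencies of different moduli. -/
noncomputable def gapKer (l : ℝ) (p p' : ℤ × ℝ) : ℝ :=
  bracket (p.1 / l) ^ (-(11 / 10) : ℝ) * |rad l p ^ 2 - rad l p' ^ 2|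

/-- The triples of frequencies of nearly equal moduli. -/
def nearSet (l : ℝ) : Set ((ℤ × ℝ) × (ℤ × ℝ)) :=
  {q | 1 / 4 ≤ rad l (-q.1 - q.2) ∧ rad l (-q.1 - q.2) / 6 ≤ |(-q.1 - q.2).2| ∧
    |rad l q.1 ^ 2 - rad l q.2 ^ 2| ≤ rad l (-q.1 - q.2) ^ (13 / 10 : ℝ) ∧
    |rad l q.1 ^ 2 - rad l (-q.1 - q.2) ^ 2| ≤ rad l (-q.1 - q.2) ^ (13 / 10 : ℝ) ∧
    |rad l q.2 ^ 2 - rad l (-q.1 - q.2) ^ 2| ≤ rad l (-q.1 - q.2) ^ (13 / 10 : ℝ)}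

open Classical in
/-- The kernel for frequencies of nearly equal moduli. -/
noncomputable def nearKer (l : ℝ) (p p' : ℤ × ℝ) : ℝ :=
  if (p, p') ∈ nearSet l then rad l (-p - p') ^ (1 / 5 : ℝ) else 0

theorem gapKer_nonneg (l : ℝ) (p p' : ℤ × ℝ) : 0 ≤ gapKer l p p' :=
  mul_nonneg (Real.rpow_nonneg (zero_le_one.trans (one_le_bracket _)) _) (abs_nonneg _)

theorem nearKer_nonneg (l : ℝ) (p p' : ℤ × ℝ) : 0 ≤ nearKer l p p' := by
  unfold nearKer
  split_ifs
  · exact Real.rpow_nonneg (rad_nonneg _ _) _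
  · exact le_rfl

theorem gapKer_measurable (l : ℝ) :
    Measurable fun q : (ℤ × ℝ) × (ℤ × ℝ) => gapKer l q.1 q.2 := by
  unfold gapKer
  have h1 : Measurable fun q : (ℤ × ℝ) × (ℤ × ℝ) => rad l q.1 :=
    (rad_measurable l).comp measurable_fst
  have h2 : Measurable fun q : (ℤ × ℝ) × (ℤ × ℝ) => rad l q.2 :=
    (rad_measurable l).comp measurable_snd
  have h3 : Measurable fun q : (ℤ × ℝ) × (ℤ × ℝ) => bracket (q.1.1 / l) :=
    (bracket_continuous.measurable.comp (fst_measurable l)).comp measurable_fst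
  exact (h3.pow_const _).mul ((h1.pow_const 2).sub (h2.pow_const 2)).abs

theorem nearSet_measurable (l : ℝ) : MeasurableSet (nearSet l) := by
  have h1 : Measurable fun q : (ℤ × ℝ) × (ℤ × ℝ) => rad l q.1 :=
    (rad_measurable l).comp measurable_fst
  have h2 : Measurable fun q : (ℤ × ℝ) × (ℤ × ℝ) => rad l q.2 :=
    (rad_measurable l).comp measurable_snd
  have h3 : Measurable fun q : (ℤ × ℝ) × (ℤ × ℝ) => rad l (-q.1 - q.2) :=
    (rad_measurable l).comp (by fun_prop)
  have h4 : Measurable fun q : (ℤ × ℝ) × (ℤ × ℝ) => (-q.1 - q.2).2 := by fun_prop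
  refine MeasurableSet.inter (measurableSet_le measurable_const h3) ?_
  refine MeasurableSet.inter (measurableSet_le (h3.div_const 6) h4.abs) ?_
  refine MeasurableSet.inter (measurableSet_le ((h1.pow_const 2).sub (h2.pow_const 2)).abs
    (h3.pow_const _)) ?_
  exact MeasurableSet.inter (measurableSet_le ((h1.pow_const 2).sub (h3.pow_const 2)).abs
    (h3.pow_const _)) (measurableSet_le ((h2.pow_const 2).sub (h3.pow_const 2)).abs
    (h3.pow_const _))

theorem nearKer_measurable (l : ℝ) :
    Measurable fun q : (ℤ × ℝ) × (ℤ × ℝ) => nearKer l q.1 q.2 := by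
  unfold nearKer
  have h3 : Measurable fun q : (ℤ × ℝ) × (ℤ × ℝ) => rad l (-q.1 - q.2) :=
    (rad_measurable l).comp (by fun_prop)
  exact Measurable.ite (nearSet_measurable l) (h3.pow_const _) measurable_const

/-- The phase restricted to a line `k = const` is quadratic. -/
theorem disp_add_disp_sub (l : ℝ) (k : ℤ) (q₀ : ℤ × ℝ) : ∃ B D : ℝ, ∀ ξ : ℝ,
    disp l (k, ξ) + disp l (q₀ - (k, ξ)) = 3 * q₀.2 * ξ ^ 2 + B * ξ + D ∧
    rad l (k, ξ) ^ 2 - rad l (q₀ - (k, ξ)) ^ 2 = 2 * (3 * q₀.2) * ξ + B := by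
  refine ⟨-(3 * q₀.2 ^ 2) + (k / l) ^ 2 - (q₀.1 / l - k / l) ^ 2,
    q₀.2 ^ 3 + q₀.2 * (q₀.1 / l - k / l) ^ 2, fun ξ => ?_⟩
  simp only [rad_sq, disp, dispersion, Prod.fst_sub, Prod.snd_sub, Int.cast_sub, sub_div]
  constructor <;> ring

theorem bracket_rpow_neg_le_one {r : ℝ} (hr : 0 ≤ r) (x : ℝ) : bracket x ^ (-r) ≤ 1 :=
  Real.rpow_le_one_of_one_le_of_nonpos (one_le_bracket x) (by linarith)

theorem measurable_bracket_sub (τ r : ℝ) :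
    Measurable fun y : ℝ => ENNReal.ofReal (bracket (τ - y) ^ r) :=
  ((bracket_continuous.comp (continuous_const.sub continuous_id)).measurable.pow_const
    r).ennreal_ofReal

theorem lintegral_bracket_sub (τ b : ℝ) :
    ∫⁻ y : ℝ, ENNReal.ofReal (bracket (τ - y) ^ (-(2 * b))) = modConst b :=
  lintegral_sub_left_eq_self (fun x : ℝ => ENNReal.ofReal (bracket x ^ (-(2 * b)))) τ

/-- `2^{11/10} ∫ ⟨x⟩^{-11/10}`. -/
noncomputable def gridConst : ℝ≥0∞ :=
  ENNReal.ofReal (2 ^ (11 / 10 : ℝ)) * ∫⁻ x : ℝ, ENNReal.ofReal (bracket x ^ (-(11 / 10) : ℝ))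

theorem gridConst_ne_top : gridConst ≠ ⊤ :=
  ENNReal.mul_ne_top ENNReal.ofReal_ne_top (lintegral_bracket_rpow_ne_top (by norm_num))

variable {l : ℝ} [hl : Fact (1 < l)]

theorem phaseWeight_measurable (l b τ : ℝ) (q₀ : ℤ × ℝ) : Measurable fun p : ℤ × ℝ =>
    ENNReal.ofReal (bracket (τ - (disp l p + disp l (q₀ - p))) ^ (-(2 * b))) := by
  have h1 := disp_measurable l
  have h2 : Measurable fun p : ℤ × ℝ => disp l (q₀ - p) := h1.comp (by fun_prop)
  exact (measurable_bracket_sub τ (-(2 * b))).comp (h1.add h2)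

/-- For fixed k the difference of squared moduli is exactly the ξ-derivative of the phase, so
integration in ξ costs an absolute multiple of `modConst b`. The remaining weight has exponent 11/10
> 1 and sums over the grid uniformly in l. -/
theorem lintegral_gapKer_le (b τ : ℝ) (q₀ : ℤ × ℝ) :
    ∫⁻ p, ENNReal.ofReal (gapKer l p (q₀ - p)) *
      ENNReal.ofReal (bracket (τ - (disp l p + disp l (q₀ - p))) ^ (-(2 * b))) ∂freqMeasure l ≤
      2 * modConst b * gridConst := by
  have hm : Measurable fun p => ENNReal.ofReal (gapKer l p (q₀ - p)) *
      ENNReal.ofReal (bracket (τ - (disp l p + disp l (q₀ - p))) ^ (-(2 * b))) :=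
    (((gapKer_measurable l).comp (f := fun p => (p, q₀ - p)) (by fun_prop)).ennreal_ofReal).mul
      (phaseWeight_measurable l b τ q₀)
  rw [lintegral_freqMeasure l hm]
  have hk : ∀ k : ℤ, ∫⁻ ξ, ENNReal.ofReal (gapKer l (k, ξ) (q₀ - (k, ξ))) *
      ENNReal.ofReal (bracket (τ - (disp l (k, ξ) + disp l (q₀ - (k, ξ)))) ^ (-(2 * b))) ≤
      (2 * modConst b) * ENNReal.ofReal (bracket (k / l) ^ (-(11 / 10) : ℝ)) := by
    intro k
    obtain ⟨B, D, hBD⟩ := disp_add_disp_sub l k q₀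
    have e : ∀ ξ, ENNReal.ofReal (gapKer l (k, ξ) (q₀ - (k, ξ))) *
      ENNReal.ofReal (bracket (τ - (disp l (k, ξ) + disp l (q₀ - (k, ξ)))) ^ (-(2 * b))) =
      ENNReal.ofReal (bracket (k / l) ^ (-(11 / 10) : ℝ)) *
      (ENNReal.ofReal |2 * (3 * q₀.2) * ξ + B| *
      ENNReal.ofReal (bracket (τ - (3 * q₀.2 * ξ ^ 2 + B * ξ + D)) ^ (-(2 * b)))) := by
      intro ξ
      rw [gapKer, (hBD ξ).1, (hBD ξ).2, ENNReal.ofReal_mul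
        (Real.rpow_nonneg (zero_le_one.trans (one_le_bracket _)) _), mul_assoc]
    simp only [e]
    rw [lintegral_const_mul' _ _ ENNReal.ofReal_ne_top, mul_comm]
    gcongr
    refine (lintegral_abs_deriv_quadratic (3 * q₀.2) B D
      (g := fun y => ENNReal.ofReal (bracket (τ - y) ^ (-(2 * b))))).trans_eq ?_
    rw [lintegral_bracket_sub]
  calc _ ≤ ENNReal.ofReal l⁻¹ * ∑' k : ℤ, (2 * modConst b) *
        ENNReal.ofReal (bracket (k / l) ^ (-(11 / 10) : ℝ)) := by
        gcongr with k
        exact hk k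
    _ = (2 * modConst b) * (ENNReal.ofReal l⁻¹ * ∑' k : ℤ,
        ENNReal.ofReal (bracket (k / l) ^ (-(11 / 10) : ℝ))) := by
        rw [ENNReal.tsum_mul_left, mul_left_comm]
    _ ≤ _ := by
        gcongr
        exact tsum_bracket_rpow_le hl.out (by norm_num)

/-- The vector (a', d), equal to a + c/2, is nearly orthogonal to c and has squared length nearly
3R²/4: an almost equilateral triangle. In the exact case d = ±(3/2)ξ_c. The error in d² is
O(R^{13/10}), and division by |d| + (3/2)|ξ_c| ≥ R/4 leaves R^{3/10}. -/
theorem resonant_abs_sub_le {ξa qa ξc qc R : ℝ} (hR : R ^ 2 = 3 * ξc ^ 2 + qc ^ 2)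
    (hR4 : 1 / 4 ≤ R) (hξ : R / 6 ≤ |ξc|)
    (h1 : |(3 * ξa ^ 2 + qa ^ 2) - (3 * (-ξc - ξa) ^ 2 + (-qc - qa) ^ 2)| ≤ R ^ (13 / 10 : ℝ))
    (h2 : |(3 * ξa ^ 2 + qa ^ 2) - R ^ 2| ≤ R ^ (13 / 10 : ℝ))
    (h3 : |(3 * (-ξc - ξa) ^ 2 + (-qc - qa) ^ 2) - R ^ 2| ≤ R ^ (13 / 10 : ℝ)) :
    abs (|qa + qc / 2| - 3 / 2 * |ξc|) ≤ 20 * R ^ (3 / 10 : ℝ) := by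
  have hR0 : 0 < R := by linarith
  set T := R ^ (13 / 10 : ℝ) with hT
  have hT0 : 0 < T := Real.rpow_pos_of_pos hR0 _
  have hT1 : T = R * R ^ (3 / 10 : ℝ) := by
    rw [hT, ← Real.rpow_one_add' hR0.le (by norm_num)]
    norm_num
  have hT4 : T ≤ 4 * R ^ 2 := by
    have e1 : (4 * R) ^ (13 / 10 : ℝ) ≤ (4 * R) ^ (2 : ℝ) :=
      Real.rpow_le_rpow_of_exponent_le (by linarith) (by norm_num)
    rw [Real.mul_rpow (by norm_num) hR0.le, Real.rpow_two] at e1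
    have e2 : (4 : ℝ) ≤ 4 ^ (13 / 10 : ℝ) := by
      conv_lhs => rw [← Real.rpow_one 4]
      exact Real.rpow_le_rpow_of_exponent_le (by norm_num) (by norm_num)
    nlinarith
  set d := qa + qc / 2 with hd
  set a' := ξa + ξc / 2 with ha'
  set E1 := 3 * ξc * a' + qc * d with hE1
  set E2 := 3 * a' ^ 2 + d ^ 2 - 3 / 4 * R ^ 2 with hE2
  have hE1' : |E1| ≤ T / 2 := by
    have : (3 * ξa ^ 2 + qa ^ 2) - (3 * (-ξc - ξa) ^ 2 + (-qc - qa) ^ 2) = -2 * E1 := by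
      rw [hE1, ha', hd]; ring
    rw [this, abs_mul, abs_neg, abs_two] at h1
    linarith
  have hE2' : |E2| ≤ T := by
    have : E2 = (((3 * ξa ^ 2 + qa ^ 2) - R ^ 2) +
        ((3 * (-ξc - ξa) ^ 2 + (-qc - qa) ^ 2) - R ^ 2)) / 2 := by
      rw [hE2, hR, ha', hd]; ring
    rw [this, abs_div, abs_two]
    have := abs_add_le ((3 * ξa ^ 2 + qa ^ 2) - R ^ 2)
      ((3 * (-ξc - ξa) ^ 2 + (-qc - qa) ^ 2) - R ^ 2)
    linarith
  have hqc : |qc| ≤ R := abs_le_of_sq_le_sq (by linarith [sq_nonneg ξc]) hR0.le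
  have hqa : |qa| ≤ 5 / 2 * R :=
    abs_le_of_sq_le_sq (by linarith [sq_nonneg ξa, (abs_le.mp h2).2, sq_nonneg R, mul_pow (5 / 2 : ℝ) R 2]) (by linarith)
  have hdR : |d| ≤ 3 * R := by
    have := abs_add_le qa (qc / 2)
    rw [abs_div, abs_two] at this
    linarith
  -- Elimination of a' between the orthogonality defect E1 and the length defect E2.
  have hid : R ^ 2 * (d ^ 2 - 9 / 4 * ξc ^ 2) = 3 * ξc ^ 2 * E2 - E1 ^ 2 + 2 * E1 * (qc * d) := by
    rw [hE2, hE1, hR]; ring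
  have hX : |d ^ 2 - 9 / 4 * ξc ^ 2| ≤ 5 * T := by
    have b1 : |3 * ξc ^ 2 * E2| ≤ R ^ 2 * T := by
      rw [abs_mul, abs_of_nonneg (by positivity : (0 : ℝ) ≤ 3 * ξc ^ 2)]
      exact mul_le_mul (by linarith [sq_nonneg qc]) hE2' (abs_nonneg _) (by positivity)
    have b2 : |E1 ^ 2| ≤ R ^ 2 * T := by
      rw [abs_of_nonneg (sq_nonneg _), ← sq_abs]
      have c1 : |E1| ^ 2 ≤ (T / 2) ^ 2 := pow_le_pow_left₀ (abs_nonneg E1) hE1' 2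
      have c2 : T * T ≤ T * (4 * R ^ 2) := mul_le_mul_of_nonneg_left hT4 hT0.le
      linarith
    have b3 : |2 * E1 * (qc * d)| ≤ 3 * (R ^ 2 * T) := by
      rw [abs_mul, abs_mul, abs_two, abs_mul]
      calc 2 * |E1| * (|qc| * |d|) ≤ 2 * (T / 2) * (R * (3 * R)) := by gcongr
        _ = _ := by ring
    have b4 : R ^ 2 * |d ^ 2 - 9 / 4 * ξc ^ 2| ≤ R ^ 2 * (5 * T) := by
      rw [← abs_of_pos (pow_pos hR0 2), ← abs_mul, hid, abs_of_pos (pow_pos hR0 2)]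
      have c1 := abs_add_le (3 * ξc ^ 2 * E2 - E1 ^ 2) (2 * E1 * (qc * d))
      have c2 := abs_sub (3 * ξc ^ 2 * E2) (E1 ^ 2)
      linarith
    exact le_of_mul_le_mul_left b4 (by positivity)
  set y := |d| - 3 / 2 * |ξc| with hy
  have hfac : |y| * (|d| + 3 / 2 * |ξc|) = |d ^ 2 - 9 / 4 * ξc ^ 2| := by
    rw [← abs_of_nonneg (by positivity : (0 : ℝ) ≤ |d| + 3 / 2 * |ξc|), ← abs_mul, hy]
    congr 1
    linear_combination sq_abs d - 9 / 4 * sq_abs ξc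
  have hfin : |y| * (R / 4) ≤ 5 * (R * R ^ (3 / 10 : ℝ)) := by
    rw [← hT1]
    calc |y| * (R / 4) ≤ |y| * (|d| + 3 / 2 * |ξc|) := by
          gcongr
          linarith [abs_nonneg d]
      _ ≤ 5 * T := by rw [hfac]; exact hX
  have : |y| * R ≤ 20 * R ^ (3 / 10 : ℝ) * R := by linarith
  exact le_of_mul_le_mul_right this hR0

/-- The grid points k/l that contribute lie in two intervals of radius about R^{3/10}. On each line
the quadratic phase with leading coefficient 3ξ₀, |ξ₀| ≥ R/6, contributes at most a multiple of
R^{-1/2}. These and the kernel's R^{1/5} multiply to a constant. -/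
theorem lintegral_nearKer_le {b : ℝ} (hb : 0 ≤ b) (τ : ℝ) (q₀ : ℤ × ℝ) :
    ∫⁻ p, ENNReal.ofReal (nearKer l p (q₀ - p)) *
      ENNReal.ofReal (bracket (τ - (disp l p + disp l (q₀ - p))) ^ (-(2 * b))) ∂freqMeasure l ≤
      ENNReal.ofReal 200 * (2 + modConst b) := by
  have hm : Measurable fun p => ENNReal.ofReal (nearKer l p (q₀ - p)) *
      ENNReal.ofReal (bracket (τ - (disp l p + disp l (q₀ - p))) ^ (-(2 * b))) :=
    (((nearKer_measurable l).comp (f := fun p => (p, q₀ - p)) (by fun_prop)).ennreal_ofReal).mul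
      (phaseWeight_measurable l b τ q₀)
  rw [lintegral_freqMeasure l hm]
  set R := rad l q₀ with hR
  have hc : ∀ p : ℤ × ℝ, -p - (q₀ - p) = -q₀ := fun p => by abel
  have hrad : ∀ p : ℤ × ℝ, rad l (-p - (q₀ - p)) = R := fun p => by rw [hc, rad_neg]
  by_cases hcond : 1 / 4 ≤ R ∧ R / 6 ≤ |q₀.2|
  swap
  · have : ∀ p : ℤ × ℝ, nearKer l p (q₀ - p) = 0 := by
      intro p
      rw [nearKer, if_neg]
      intro hp
      refine hcond ⟨?_, ?_⟩
      · rw [← hrad p]; exact hp.1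
      · have h2 := hp.2.1
        simp only [hc, rad_neg, Prod.snd_neg, abs_neg] at h2
        exact h2
    simp [this]
  obtain ⟨hR4, hξ⟩ := hcond
  have hR0 : 0 < R := by linarith
  set L := 20 * R ^ (3 / 10 : ℝ) with hL
  have hL0 : 0 ≤ L := by positivity
  set x1 := q₀.1 / l / 2 + 3 / 2 * |q₀.2| with hx1
  set x2 := q₀.1 / l / 2 - 3 / 2 * |q₀.2| with hx2
  set ind : ℤ → ℝ≥0∞ := fun k => {x : ℝ | |x - x1| ≤ L}.indicator 1 ((k : ℝ) / l) +
    {x : ℝ | |x - x2| ≤ L}.indicator 1 ((k : ℝ) / l) with hind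
  have hmem : ∀ k : ℤ, ∀ ξ : ℝ, ENNReal.ofReal (nearKer l (k, ξ) (q₀ - (k, ξ))) ≤
      ENNReal.ofReal (R ^ (1 / 5 : ℝ)) * ind k := by
    intro k ξ
    unfold nearKer
    split_ifs with hS
    swap
    · rw [ENNReal.ofReal_zero]; exact zero_le
    rw [hrad]
    refine le_mul_of_one_le_right' ?_
    obtain ⟨-, -, s1, s2, s3⟩ := hS
    rw [hrad] at s1 s2 s3
    simp only [rad_sq, Prod.fst_sub, Prod.snd_sub, Int.cast_sub] at s1 s2 s3
    have hres := resonant_abs_sub_le (ξa := ξ) (qa := k / l) (ξc := -q₀.2) (qc := -(q₀.1 / l))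
      (R := R) (by rw [hR, rad_sq]; ring) hR4 (by rwa [abs_neg])
      (by rw [neg_neg, neg_neg, ← sub_div]; exact s1) s2
      (by rw [neg_neg, neg_neg, ← sub_div]; exact s3)
    rw [abs_neg, abs_le] at hres
    rcases abs_choice ((k : ℝ) / l + -(q₀.1 / l) / 2) with hch | hch
    · rw [hch] at hres
      have : (k : ℝ) / l ∈ {x : ℝ | |x - x1| ≤ L} := by
        rw [Set.mem_ofPred_eq, abs_le, hx1]
        constructor <;> linarith [hres.1, hres.2]
      rw [hind]
      simp only [Set.indicator_of_mem this, Pi.one_apply]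
      exact le_add_right le_rfl
    · rw [hch] at hres
      have : (k : ℝ) / l ∈ {x : ℝ | |x - x2| ≤ L} := by
        rw [Set.mem_ofPred_eq, abs_le, hx2]
        constructor <;> linarith [hres.1, hres.2]
      rw [hind]
      simp only [Set.indicator_of_mem this, Pi.one_apply]
      exact le_add_left le_rfl
  have hq0 : q₀.2 ≠ 0 := by
    intro h
    rw [h, abs_zero] at hξ
    linarith
  have hk : ∀ k : ℤ, ∫⁻ ξ, ENNReal.ofReal (nearKer l (k, ξ) (q₀ - (k, ξ))) *
      ENNReal.ofReal (bracket (τ - (disp l (k, ξ) + disp l (q₀ - (k, ξ)))) ^ (-(2 * b))) ≤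
      ENNReal.ofReal (R ^ (1 / 5 : ℝ)) * ind k *
        (ENNReal.ofReal √|3 * q₀.2|⁻¹ * (2 + modConst b)) := by
    intro k
    obtain ⟨B, D, hBD⟩ := disp_add_disp_sub l k q₀
    have hindtop : ENNReal.ofReal (R ^ (1 / 5 : ℝ)) * ind k ≠ ⊤ := by
      refine ENNReal.mul_ne_top ENNReal.ofReal_ne_top ?_
      rw [hind]
      refine ENNReal.add_ne_top.mpr ⟨?_, ?_⟩ <;>
      · unfold Set.indicator
        split_ifs <;> simp
    calc _ ≤ ∫⁻ ξ, ENNReal.ofReal (R ^ (1 / 5 : ℝ)) * ind k *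
          ENNReal.ofReal (bracket (τ - (3 * q₀.2 * ξ ^ 2 + B * ξ + D)) ^ (-(2 * b))) := by
          refine lintegral_mono fun ξ => ?_
          rw [(hBD ξ).1]
          gcongr
          exact hmem k ξ
      _ = ENNReal.ofReal (R ^ (1 / 5 : ℝ)) * ind k * ∫⁻ ξ,
          ENNReal.ofReal (bracket (τ - (3 * q₀.2 * ξ ^ 2 + B * ξ + D)) ^ (-(2 * b))) :=
          lintegral_const_mul' _ _ hindtop
      _ ≤ _ := by
          gcongr
          refine (lintegral_quadratic_le (mul_ne_zero three_ne_zero hq0) B D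
            (g := fun y => ENNReal.ofReal (bracket (τ - y) ^ (-(2 * b)))) fun y => ?_).trans_eq ?_
          · rw [← ENNReal.ofReal_one]
            exact ENNReal.ofReal_le_ofReal (bracket_rpow_neg_le_one (by linarith) _)
          · rw [lintegral_bracket_sub]
  have hcount : ENNReal.ofReal l⁻¹ * ∑' k, ind k ≤ ENNReal.ofReal (4 * (L + 1)) := by
    rw [hind, ENNReal.tsum_add, mul_add]
    refine (add_le_add (tsum_near_le hl.out x1 L) (tsum_near_le hl.out x2 L)).trans_eq ?_
    rw [← ENNReal.ofReal_add (by positivity) (by positivity)]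
    congr 1
    ring
  calc _ ≤ ENNReal.ofReal l⁻¹ * ∑' k : ℤ, ENNReal.ofReal (R ^ (1 / 5 : ℝ)) * ind k *
        (ENNReal.ofReal √|3 * q₀.2|⁻¹ * (2 + modConst b)) := by
        gcongr with k
        exact hk k
    _ = (ENNReal.ofReal (R ^ (1 / 5 : ℝ)) * (ENNReal.ofReal l⁻¹ * ∑' k, ind k) *
        ENNReal.ofReal √|3 * q₀.2|⁻¹) * (2 + modConst b) := by
        rw [ENNReal.tsum_mul_right, ENNReal.tsum_mul_left]
        ring
    _ ≤ (ENNReal.ofReal (R ^ (1 / 5 : ℝ)) * ENNReal.ofReal (4 * (L + 1)) *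
        ENNReal.ofReal √|3 * q₀.2|⁻¹) * (2 + modConst b) := by gcongr
    _ ≤ _ := by
        gcongr
        rw [← ENNReal.ofReal_mul (by positivity), ← ENNReal.ofReal_mul (by positivity)]
        apply ENNReal.ofReal_le_ofReal
        -- R ≥ 1/4 lets the extra grid cell, the 1 in L + 1, be absorbed.
        have e1 : (1 : ℝ) ≤ 4 * R ^ (3 / 10 : ℝ) := by
          have : (1 : ℝ) ≤ (4 * R) ^ (3 / 10 : ℝ) := Real.one_le_rpow (by linarith) (by norm_num)
          rw [Real.mul_rpow (by norm_num) hR0.le] at this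
          have e2 : (4 : ℝ) ^ (3 / 10 : ℝ) ≤ 4 := by
            conv_rhs => rw [← Real.rpow_one 4]
            exact Real.rpow_le_rpow_of_exponent_le (by norm_num) (by norm_num)
          have e3 : 0 ≤ R ^ (3 / 10 : ℝ) := by positivity
          nlinarith
        have e2 : √|3 * q₀.2|⁻¹ ≤ 2 * (R ^ (1 / 2 : ℝ))⁻¹ := by
          rw [Real.sqrt_inv, ← Real.sqrt_eq_rpow]
          have : √R / 2 ≤ √|3 * q₀.2| := by
            rw [show √R / 2 = √(R / 4) by
              rw [Real.sqrt_div' _ (by norm_num : (0 : ℝ) ≤ 4)]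
              congr 1
              rw [show (4 : ℝ) = 2 ^ 2 by norm_num, Real.sqrt_sq (by norm_num)]]
            apply Real.sqrt_le_sqrt
            rw [abs_mul, abs_of_pos (by norm_num : (0 : ℝ) < 3)]
            linarith
          have hsR : 0 < √R := Real.sqrt_pos.mpr hR0
          calc (√|3 * q₀.2|)⁻¹ ≤ (√R / 2)⁻¹ := inv_anti₀ (by positivity) this
            _ = _ := by field_simp
        have e3 : R ^ (1 / 5 : ℝ) * R ^ (3 / 10 : ℝ) = R ^ (1 / 2 : ℝ) := by
          rw [← Real.rpow_add hR0]; norm_num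
        have hh : 0 < R ^ (1 / 2 : ℝ) := by positivity
        calc R ^ (1 / 5 : ℝ) * (4 * (L + 1)) * √|3 * q₀.2|⁻¹
            ≤ R ^ (1 / 5 : ℝ) * (4 * (20 * R ^ (3 / 10 : ℝ) + 4 * R ^ (3 / 10 : ℝ))) *
              (2 * (R ^ (1 / 2 : ℝ))⁻¹) := by
              rw [hL]
              gcongr
          _ = 192 * (R ^ (1 / 5 : ℝ) * R ^ (3 / 10 : ℝ)) * (R ^ (1 / 2 : ℝ))⁻¹ := by ring
          _ ≤ 200 := by
              rw [e3]
              field_simp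
              norm_num


variable {l : ℝ} [hl : Fact (1 < l)]

/-! ### The trilinear estimate -/

/-- The measure on space-time frequencies `(ζ, τ)`. -/
noncomputable def stMeasure (l : ℝ) : Measure ((ℤ × ℝ) × ℝ) := (freqMeasure l).prod volume

instance (l : ℝ) : SigmaFinite (stMeasure l) := by unfold stMeasure; infer_instance

instance (l : ℝ) : (stMeasure l).IsAddLeftInvariant := by unfold stMeasure; infer_instance

/-- The weight `⟨τ - σ(ζ)⟩^r`. -/
noncomputable def stWeight (l r : ℝ) (y : (ℤ × ℝ) × ℝ) : ℝ≥0∞ :=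
  ENNReal.ofReal (bracket (y.2 - disp l y.1) ^ r)

theorem stWeight_measurable (l r : ℝ) : Measurable (stWeight l r) := by
  unfold stWeight
  have h : Measurable fun q : (ℤ × ℝ) × ℝ => disp l q.1 := (disp_measurable l).comp measurable_fst
  have h2 : Measurable fun q : (ℤ × ℝ) × ℝ => bracket (q.2 - disp l q.1) :=
    bracket_continuous.measurable.comp (measurable_snd.sub h)
  exact (h2.pow_const _).ennreal_ofReal

theorem stWeight_mul_neg (l r : ℝ) (y : (ℤ × ℝ) × ℝ) : stWeight l r y * stWeight l (-r) y = 1 := by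
  have h : 0 < bracket (y.2 - disp l y.1) := one_pos.trans_le (one_le_bracket _)
  unfold stWeight
  rw [← ENNReal.ofReal_mul (by positivity), ← Real.rpow_add h, add_neg_cancel, Real.rpow_zero,
    ENNReal.ofReal_one]

theorem stWeight_sq (l r : ℝ) (y : (ℤ × ℝ) × ℝ) : stWeight l r y ^ 2 = stWeight l (2 * r) y := by
  have h : 0 < bracket (y.2 - disp l y.1) := one_pos.trans_le (one_le_bracket _)
  unfold stWeight
  rw [← ENNReal.ofReal_pow (by positivity), ← Real.rpow_natCast, ← Real.rpow_mul h.le, mul_comm r]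
  norm_num

/-- With x = τ - σ(ζ), the second modulation becomes τ₀ - x minus the phase. For fixed x the
ζ-integral is the hypothesis at time τ₀ - x, and ⟨x⟩^{-2b} is integrated last. -/
theorem lintegral_kernel_weight_le {b : ℝ} {κ : ℤ × ℝ → ℤ × ℝ → ℝ≥0∞}
    (hκ : Measurable fun q : (ℤ × ℝ) × (ℤ × ℝ) => κ q.1 q.2) {B : ℝ≥0∞}
    (hB : ∀ (τ : ℝ) (q₀ : ℤ × ℝ), ∫⁻ p, κ p (q₀ - p) ^ 2 *
      ENNReal.ofReal (bracket (τ - (disp l p + disp l (q₀ - p))) ^ (-(2 * b))) ∂freqMeasure l ≤ B)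
    (y₀ : (ℤ × ℝ) × ℝ) :
    ∫⁻ y, κ y.1 (y₀.1 - y.1) ^ 2 * (stWeight l (-(2 * b)) y * stWeight l (-(2 * b)) (y₀ - y))
      ∂stMeasure l ≤ modConst b * B := by
  have hw := stWeight_measurable l (-(2 * b))
  have hκ0 : Measurable fun p => κ p (y₀.1 - p) := hκ.comp (f := fun p => (p, y₀.1 - p)) (by fun_prop)
  have hw0 : Measurable fun y => stWeight l (-(2 * b)) (y₀ - y) := hw.comp (by fun_prop)
  have hm : Measurable fun y : (ℤ × ℝ) × ℝ => κ y.1 (y₀.1 - y.1) ^ 2 *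
      (stWeight l (-(2 * b)) y * stWeight l (-(2 * b)) (y₀ - y)) :=
    ((hκ0.comp measurable_fst).pow_const 2).mul (hw.mul hw0)
  unfold stMeasure
  rw [lintegral_prod _ hm.aemeasurable]
  have e : ∀ p : ℤ × ℝ, ∫⁻ τ, κ p (y₀.1 - p) ^ 2 *
      (stWeight l (-(2 * b)) (p, τ) * stWeight l (-(2 * b)) (y₀ - (p, τ))) =
      ∫⁻ x, κ p (y₀.1 - p) ^ 2 * (ENNReal.ofReal (bracket x ^ (-(2 * b))) *
        ENNReal.ofReal (bracket (y₀.2 - x - (disp l p + disp l (y₀.1 - p))) ^ (-(2 * b)))) := by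
    intro p
    rw [← lintegral_add_right_eq_self _ (disp l p)]
    congr 1
    funext x
    unfold stWeight
    simp only [Prod.fst_sub, Prod.snd_sub, add_sub_cancel_right]
    rw [show y₀.2 - (x + disp l p) - disp l (y₀.1 - p) =
      y₀.2 - x - (disp l p + disp l (y₀.1 - p)) by ring]
  simp only [e]
  have hm2 : Measurable fun q : (ℤ × ℝ) × ℝ => κ q.1 (y₀.1 - q.1) ^ 2 *
      (ENNReal.ofReal (bracket q.2 ^ (-(2 * b))) * ENNReal.ofReal
        (bracket (y₀.2 - q.2 - (disp l q.1 + disp l (y₀.1 - q.1))) ^ (-(2 * b)))) := by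
    have h1 : Measurable fun q : (ℤ × ℝ) × ℝ => disp l q.1 :=
      (disp_measurable l).comp measurable_fst
    have h2 : Measurable fun q : (ℤ × ℝ) × ℝ => disp l (y₀.1 - q.1) :=
      (disp_measurable l).comp (by fun_prop)
    have h3 : Measurable fun q : (ℤ × ℝ) × ℝ => bracket q.2 :=
      bracket_continuous.measurable.comp measurable_snd
    have h4 : Measurable fun q : (ℤ × ℝ) × ℝ =>
        bracket (y₀.2 - q.2 - (disp l q.1 + disp l (y₀.1 - q.1))) :=
      bracket_continuous.measurable.comp ((measurable_snd.const_sub _).sub (h1.add h2))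
    exact ((hκ0.comp measurable_fst).pow_const 2).mul
      ((h3.pow_const _).ennreal_ofReal.mul (h4.pow_const _).ennreal_ofReal)
  rw [lintegral_lintegral_swap hm2.aemeasurable]
  calc _ ≤ ∫⁻ x : ℝ, ENNReal.ofReal (bracket x ^ (-(2 * b))) * B := by
        refine lintegral_mono fun x => ?_
        have : ∀ p, κ p (y₀.1 - p) ^ 2 * (ENNReal.ofReal (bracket x ^ (-(2 * b))) *
            ENNReal.ofReal (bracket (y₀.2 - x - (disp l p + disp l (y₀.1 - p))) ^ (-(2 * b)))) =
            ENNReal.ofReal (bracket x ^ (-(2 * b))) * (κ p (y₀.1 - p) ^ 2 *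
            ENNReal.ofReal (bracket (y₀.2 - x - (disp l p + disp l (y₀.1 - p))) ^ (-(2 * b)))) :=
          fun p => mul_left_comm _ _ _
        simp only [this]
        rw [lintegral_const_mul' _ _ ENNReal.ofReal_ne_top]
        gcongr
        exact hB (y₀.2 - x) y₀.1
    _ = modConst b * B := lintegral_mul_const _
        ((bracket_continuous.measurable.pow_const _).ennreal_ofReal)

/-- Cauchy–Schwarz on pairs (y, y'): the weights ⟨τ - σ⟩^b go with f f, their inverses with κ q. In
the second factor the integral over y at fixed y + y' is the kernel bound. No modulation weight
falls on q. -/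
theorem sq_trilinear_le {b : ℝ} {κ : ℤ × ℝ → ℤ × ℝ → ℝ≥0∞}
    (hκ : Measurable fun q : (ℤ × ℝ) × (ℤ × ℝ) => κ q.1 q.2) {B : ℝ≥0∞}
    (hB : ∀ (τ : ℝ) (q₀ : ℤ × ℝ), ∫⁻ p, κ p (q₀ - p) ^ 2 *
      ENNReal.ofReal (bracket (τ - (disp l p + disp l (q₀ - p))) ^ (-(2 * b))) ∂freqMeasure l ≤ B)
    {f q : (ℤ × ℝ) × ℝ → ℝ≥0∞} (hf : Measurable f) (hq : Measurable q) :
    (∫⁻ y, ∫⁻ y', κ y.1 y'.1 * (f y * f y' * q (y + y')) ∂stMeasure l ∂stMeasure l) ^ 2 ≤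
      (∫⁻ y, stWeight l (2 * b) y * f y ^ 2 ∂stMeasure l) ^ 2 *
        (modConst b * B * ∫⁻ y, q y ^ 2 ∂stMeasure l) := by
  have hw := stWeight_measurable l (-b)
  have hw' := stWeight_measurable l b
  have hw2 := stWeight_measurable l (-(2 * b))
  have hκ' : Measurable fun z : ((ℤ × ℝ) × ℝ) × ((ℤ × ℝ) × ℝ) => κ z.1.1 z.2.1 :=
    hκ.comp (f := fun z : ((ℤ × ℝ) × ℝ) × ((ℤ × ℝ) × ℝ) => (z.1.1, z.2.1)) (by fun_prop)
  set g : (ℤ × ℝ) × ℝ → ℝ≥0∞ := fun y => stWeight l b y * f y with hg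
  have hgm : Measurable g := hw'.mul hf
  set G : ((ℤ × ℝ) × ℝ) × ((ℤ × ℝ) × ℝ) → ℝ≥0∞ := fun z => g z.1 * g z.2 with hG
  set H : ((ℤ × ℝ) × ℝ) × ((ℤ × ℝ) × ℝ) → ℝ≥0∞ := fun z =>
    κ z.1.1 z.2.1 * (stWeight l (-b) z.1 * stWeight l (-b) z.2) * q (z.1 + z.2) with hH
  have hGm : Measurable G := (hgm.comp measurable_fst).mul (hgm.comp measurable_snd)
  have hHm : Measurable H := (hκ'.mul ((hw.comp measurable_fst).mul (hw.comp measurable_snd))).mul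
    (hq.comp (by fun_prop))
  have e1 : ∀ y y', κ y.1 y'.1 * (f y * f y' * q (y + y')) = G (y, y') * H (y, y') := by
    intro y y'
    rw [hG, hH, hg]
    calc _ = κ y.1 y'.1 * (f y * f y' * q (y + y')) * (stWeight l b y * stWeight l (-b) y) *
          (stWeight l b y' * stWeight l (-b) y') := by
          rw [stWeight_mul_neg, stWeight_mul_neg, mul_one, mul_one]
      _ = _ := by ring
  simp only [e1]
  rw [lintegral_lintegral (hGm.mul hHm).aemeasurable]
  refine (sq_lintegral_mul_le _ hGm.aemeasurable hHm.aemeasurable).trans ?_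
  have hgsq : ∀ y, g y ^ 2 = stWeight l (2 * b) y * f y ^ 2 := by
    intro y
    rw [hg]
    simp only [mul_pow, stWeight_sq]
  refine mul_le_mul' (le_of_eq ?_) ?_
  · rw [hG]
    simp only [mul_pow]
    rw [lintegral_prod_mul (hgm.pow_const 2).aemeasurable (hgm.pow_const 2).aemeasurable, sq]
    simp only [hgsq]
  · rw [lintegral_prod _ (hHm.pow_const 2).aemeasurable]
    have e2 : ∀ y, ∫⁻ y', H (y, y') ^ 2 ∂stMeasure l = ∫⁻ y', κ y.1 (y'.1 - y.1) ^ 2 *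
        (stWeight l (-(2 * b)) y * stWeight l (-(2 * b)) (y' - y)) * q y' ^ 2 ∂stMeasure l := by
      intro y
      rw [← lintegral_sub_right_eq_self _ y]
      congr 1
      funext y'
      rw [hH]
      simp only [mul_pow, stWeight_sq, mul_neg, Prod.fst_sub, add_sub_cancel]
    simp only [e2]
    have hm3 : Measurable fun z : ((ℤ × ℝ) × ℝ) × ((ℤ × ℝ) × ℝ) => κ z.1.1 (z.2.1 - z.1.1) ^ 2 *
        (stWeight l (-(2 * b)) z.1 * stWeight l (-(2 * b)) (z.2 - z.1)) * q z.2 ^ 2 := by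
      have h1 : Measurable fun z : ((ℤ × ℝ) × ℝ) × ((ℤ × ℝ) × ℝ) => κ z.1.1 (z.2.1 - z.1.1) :=
        hκ.comp (f := fun z : ((ℤ × ℝ) × ℝ) × ((ℤ × ℝ) × ℝ) => (z.1.1, z.2.1 - z.1.1))
          (by fun_prop)
      exact ((h1.pow_const 2).mul ((hw2.comp measurable_fst).mul
        (hw2.comp (measurable_snd.sub measurable_fst)))).mul ((hq.comp measurable_snd).pow_const 2)
    rw [lintegral_lintegral_swap hm3.aemeasurable]
    calc _ ≤ ∫⁻ y', modConst b * B * q y' ^ 2 ∂stMeasure l := by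
          refine lintegral_mono fun y' => ?_
          rw [lintegral_mul_const]
          · gcongr
            exact lintegral_kernel_weight_le hκ hB y'
          · have h1 : Measurable fun y : (ℤ × ℝ) × ℝ => κ y.1 (y'.1 - y.1) :=
              hκ.comp (f := fun y : (ℤ × ℝ) × ℝ => (y.1, y'.1 - y.1)) (by fun_prop)
            exact (h1.pow_const 2).mul (hw2.mul (hw2.comp (by fun_prop)))
      _ = _ := lintegral_const_mul _ (hq.pow_const 2)

/-! ### Time integrals of products -/

theorem invFourierIntegral_real (f : ℝ → ℂ) (t : ℝ) :
    invFourierIntegral f t =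
      ((2 * π)⁻¹ : ℝ) * ∫ τ, Complex.exp (((t * τ : ℝ) : ℂ) * Complex.I) * f τ := by
  unfold invFourierIntegral
  rw [Module.finrank_self, pow_one]
  congr 2
  funext τ
  rw [mul_comm Complex.I]
  rfl

/-- The Fourier integral `∫_0^δ e^{itτ} h(t) dt`. -/
noncomputable def windowFT (δ : ℝ) (h : ℝ → ℂ) (τ : ℝ) : ℂ :=
  ∫ t in Set.Ioc 0 δ, Complex.exp (((t * τ : ℝ) : ℂ) * Complex.I) * h t

/-- Two of the three factors are expanded in τ and τ'. What remains is the transform of the third,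
restricted to the time window, at τ + τ'. -/
theorem enorm_integral_inv_mul_inv_le {f g h : ℝ → ℂ} {δ : ℝ} (hf : Integrable f)
    (hg : Integrable g) (hh : IntegrableOn h (Set.Ioc 0 δ)) :
    ‖∫ t in Set.Ioc 0 δ, invFourierIntegral f t * invFourierIntegral g t * h t‖ₑ ≤
      ∫⁻ τ, ∫⁻ τ', ‖f τ‖ₑ * ‖g τ'‖ₑ * ‖windowFT δ h (τ + τ')‖ₑ := by
  set E : ℝ → ℝ × ℝ → ℂ := fun t q =>
    Complex.exp (((t * (q.1 + q.2) : ℝ) : ℂ) * Complex.I) with hE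
  have hEc : Continuous fun r : ℝ × (ℝ × ℝ) => E r.1 r.2 := by
    simp only [hE]
    fun_prop
  have h1 : ∀ t, invFourierIntegral f t * invFourierIntegral g t * h t =
      (((2 * π)⁻¹ * (2 * π)⁻¹ : ℝ) : ℂ) * ∫ q : ℝ × ℝ, E t q * (f q.1 * g q.2) * h t := by
    intro t
    rw [invFourierIntegral_real, invFourierIntegral_real, integral_mul_const]
    have : ∫ q : ℝ × ℝ, E t q * (f q.1 * g q.2) =
        (∫ τ, Complex.exp (((t * τ : ℝ) : ℂ) * Complex.I) * f τ) *
        ∫ τ, Complex.exp (((t * τ : ℝ) : ℂ) * Complex.I) * g τ := by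
      rw [Measure.volume_eq_prod, ← integral_prod_mul]
      congr 1
      funext q
      rw [hE]
      simp only [mul_add, Complex.ofReal_add, add_mul, Complex.exp_add]
      ring
    rw [this]
    push_cast
    ring
  simp only [h1]
  rw [integral_const_mul, enorm_mul]
  have hint : Integrable (Function.uncurry fun (t : ℝ) (q : ℝ × ℝ) => E t q * (f q.1 * g q.2) * h t)
      ((volume.restrict (Set.Ioc 0 δ)).prod volume) := by
    have i1 : Integrable (fun r : ℝ × (ℝ × ℝ) => h r.1 * (f r.2.1 * g r.2.2))
        ((volume.restrict (Set.Ioc 0 δ)).prod volume) := hh.mul_prod (hf.mul_prod hg)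
    have i2 := i1.bdd_mul (c := 1) hEc.aestronglyMeasurable
      (ae_of_all _ fun r => (Complex.norm_exp_ofReal_mul_I _).le)
    refine i2.congr (ae_of_all _ fun r => ?_)
    simp only [Function.uncurry]
    ring
  rw [integral_integral_swap hint]
  have h2 : ∀ q : ℝ × ℝ, ∫ t in Set.Ioc 0 δ, E t q * (f q.1 * g q.2) * h t =
      f q.1 * g q.2 * windowFT δ h (q.1 + q.2) := by
    intro q
    unfold windowFT
    rw [← integral_const_mul]
    congr 1
    funext t
    rw [hE]
    ring
  simp only [h2]
  have h0 : ‖(((2 * π)⁻¹ * (2 * π)⁻¹ : ℝ) : ℂ)‖ₑ ≤ 1 := by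
    rw [← ofReal_norm, Complex.norm_real, Real.norm_of_nonneg (by positivity),
      ENNReal.ofReal_le_one, ← mul_inv]
    apply inv_le_one_of_one_le₀
    nlinarith [pi_gt_three]
  refine (mul_le_of_le_one_left' h0).trans ((enorm_integral_le_lintegral_enorm _).trans ?_)
  have hm : AEMeasurable (fun q : ℝ × ℝ => ‖f q.1 * g q.2 * windowFT δ h (q.1 + q.2)‖ₑ)
      (volume.prod volume) := by
    have i3 := hint.integral_prod_right.aestronglyMeasurable.enorm
    refine i3.congr (ae_of_all _ fun q => ?_)
    simp only [Function.uncurry, h2]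
  rw [Measure.volume_eq_prod, lintegral_prod _ hm]
  simp only [enorm_mul]
  exact le_rfl

/-- By Plancherel, cutting off sharply in time is a contraction on L². A sharp cutoff need not
respect ⟨τ - σ⟩^b with b > 1/2, which is why it is placed on the factor without weight. -/
theorem lintegral_windowFT_sq_le {f : ℝ → ℂ} (hf : Integrable f) (hf2 : MemLp f 2 volume) (δ : ℝ) :
    IntegrableOn (invFourierIntegral f) (Set.Ioc 0 δ) ∧
    ∫⁻ τ, ‖windowFT δ (invFourierIntegral f) τ‖ₑ ^ 2 ≤ ∫⁻ τ, ‖f τ‖ₑ ^ 2 := by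
  obtain ⟨hV2, hVf⟩ := invFourierIntegral_memLp hf hf2
  set V := invFourierIntegral f with hV
  have hVi : IntegrableOn V (Set.Ioc 0 δ) := by
    have : MemLp V 2 (volume.restrict (Set.Ioc 0 δ)) := hV2.restrict _
    exact this.integrable (by norm_num)
  refine ⟨hVi, ?_⟩
  set h := (Set.Ioc 0 δ).indicator V with hh
  have h1 : Integrable h := (integrable_indicator_iff measurableSet_Ioc).mpr hVi
  have h2 : MemLp h 2 volume := hV2.indicator measurableSet_Ioc
  have hp := plancherel_ae_eq_integral h1 h2
  have hp' := (Measure.measurePreserving_neg (volume : Measure ℝ)).quasiMeasurePreserving.ae hp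
  have e1 : ∀ τ, ∫ x, Complex.exp (-(Complex.I * (inner ℝ x (-τ) : ℝ))) * h x =
      windowFT δ V τ := by
    intro τ
    unfold windowFT
    rw [← integral_indicator measurableSet_Ioc]
    congr 1
    funext t
    by_cases ht : t ∈ Set.Ioc 0 δ
    · rw [hh, Set.indicator_of_mem ht, Set.indicator_of_mem ht, inner_neg_right]
      congr 2
      have : (inner ℝ t τ : ℝ) = t * τ := mul_comm _ _
      rw [this]
      push_cast
      ring
    · rw [hh, Set.indicator_of_notMem ht, Set.indicator_of_notMem ht, mul_zero]
  calc ∫⁻ τ, ‖windowFT δ V τ‖ₑ ^ 2 = ∫⁻ τ, ‖plancherel h (-τ)‖ₑ ^ 2 := by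
        apply lintegral_congr_ae
        filter_upwards [hp'] with τ hτ
        rw [hτ, e1]
    _ = ∫⁻ τ, ‖plancherel h τ‖ₑ ^ 2 := lintegral_neg_eq_self (fun τ => ‖plancherel h τ‖ₑ ^ 2)
    _ = ENNReal.ofReal ((2 * π) ^ Module.finrank ℝ ℝ) * ∫⁻ x, ‖h x‖ₑ ^ 2 := lintegral_plancherel h2
    _ ≤ ENNReal.ofReal ((2 * π) ^ Module.finrank ℝ ℝ) * ∫⁻ x, ‖V x‖ₑ ^ 2 := by
        gcongr with x
        by_cases ht : x ∈ Set.Ioc 0 δ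
        · rw [hh, Set.indicator_of_mem ht]
        · rw [hh, Set.indicator_of_notMem ht, enorm_zero]
          exact zero_le
    _ = ∫⁻ τ, ‖plancherel V τ‖ₑ ^ 2 := (lintegral_plancherel hV2).symm
    _ = _ := by
        apply lintegral_congr_ae
        filter_upwards [hVf] with τ hτ
        rw [hτ]

/-- The time integral `∫_0^δ V(t, ζ₁) V(t, ζ₂) V(t, ζ₃) dt`, `ζ₃ = -ζ₁ - ζ₂`. -/
noncomputable def timeKer (δ : ℝ) (F : ℝ → ℤ × ℝ → ℂ) (p p' : ℤ × ℝ) : ℂ :=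
  ∫ t in Set.Ioc 0 δ, timeInv F t p * timeInv F t p' * timeInv F t (-p - p')

theorem timeKer_measurable (δ : ℝ) {F : ℝ → ℤ × ℝ → ℂ}
    (hF : Measurable fun q : ℝ × (ℤ × ℝ) => F q.1 q.2) :
    Measurable fun q : (ℤ × ℝ) × (ℤ × ℝ) => timeKer δ F q.1 q.2 := by
  have hV := timeInv_measurable hF
  have h : Measurable fun r : ((ℤ × ℝ) × (ℤ × ℝ)) × ℝ =>
      timeInv F r.2 r.1.1 * timeInv F r.2 r.1.2 * timeInv F r.2 (-r.1.1 - r.1.2) :=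
    ((hV.comp (f := fun r : ((ℤ × ℝ) × (ℤ × ℝ)) × ℝ => (r.2, r.1.1)) (by fun_prop)).mul
      (hV.comp (f := fun r : ((ℤ × ℝ) × (ℤ × ℝ)) × ℝ => (r.2, r.1.2)) (by fun_prop))).mul
      (hV.comp (f := fun r : ((ℤ × ℝ) × (ℤ × ℝ)) × ℝ => (r.2, -r.1.1 - r.1.2)) (by fun_prop))
  exact h.stronglyMeasurable.integral_prod_right.measurable

/-- Together with `timeKer_rotate` this gives full symmetry in the three frequencies, which later
allows the arguments of the kernels to be permuted. -/
theorem timeKer_comm (δ : ℝ) (F : ℝ → ℤ × ℝ → ℂ) (p p' : ℤ × ℝ) :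
    timeKer δ F p p' = timeKer δ F p' p := by
  unfold timeKer
  congr 1
  funext t
  rw [show -p' - p = -p - p' by abel]
  ring

theorem timeKer_rotate (δ : ℝ) (F : ℝ → ℤ × ℝ → ℂ) (p p' : ℤ × ℝ) :
    timeKer δ F p (-p - p') = timeKer δ F p p' := by
  unfold timeKer
  congr 1
  funext t
  rw [show -p - (-p - p') = p' by abel]
  ring

theorem windowFT_timeInv_measurable (δ : ℝ) {F : ℝ → ℤ × ℝ → ℂ}
    (hF : Measurable fun q : ℝ × (ℤ × ℝ) => F q.1 q.2) :
    Measurable fun y : (ℤ × ℝ) × ℝ => windowFT δ (fun t => timeInv F t y.1) y.2 := by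
  have hV := timeInv_measurable hF
  have h : Measurable fun r : ((ℤ × ℝ) × ℝ) × ℝ =>
      Complex.exp (((r.2 * r.1.2 : ℝ) : ℂ) * Complex.I) * timeInv F r.2 r.1.1 := by
    refine Measurable.mul (by fun_prop) ?_
    exact hV.comp (f := fun r : ((ℤ × ℝ) × ℝ) × ℝ => (r.2, r.1.1)) (by fun_prop)
  exact h.stronglyMeasurable.integral_prod_right.measurable

theorem ae_neg_sub {P : ℤ × ℝ → Prop} (h : ∀ᵐ p ∂freqMeasure l, P p) (p : ℤ × ℝ) :
    ∀ᵐ p' ∂freqMeasure l, P (-p - p') := by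
  have h1 := (Measure.measurePreserving_neg (freqMeasure l)).quasiMeasurePreserving.ae h
  have h2 := (measurePreserving_add_left (freqMeasure l) p).quasiMeasurePreserving.ae h1
  filter_upwards [h2] with p' hp'
  rwa [neg_add'] at hp'

/-- The Cauchy–Schwarz criterion with f the weighted space-time transform, taken twice, and q the
transform of the third factor cut off to the time window. Each contributes one factor `modSq`, so δ
drops out. -/
theorem sq_lintegral_kernel_timeKer_le {b : ℝ} (hb : 1 / 2 < b) {κ : ℤ × ℝ → ℤ × ℝ → ℝ≥0∞}
    (hκ : Measurable fun q : (ℤ × ℝ) × (ℤ × ℝ) => κ q.1 q.2) {B : ℝ≥0∞}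
    (hB : ∀ (τ : ℝ) (q₀ : ℤ × ℝ), ∫⁻ p, κ p (q₀ - p) ^ 2 *
      ENNReal.ofReal (bracket (τ - (disp l p + disp l (q₀ - p))) ^ (-(2 * b))) ∂freqMeasure l ≤ B)
    {F : ℝ → ℤ × ℝ → ℂ} (hF : Measurable fun q : ℝ × (ℤ × ℝ) => F q.1 q.2)
    (hS : modSq l b F ≠ ⊤) (δ : ℝ) :
    (∫⁻ p, ∫⁻ p', κ p p' * (ENNReal.ofReal (radBr l p * radBr l p' * radBr l (-p - p')) *
      ‖timeKer δ F p p'‖ₑ) ∂freqMeasure l ∂freqMeasure l) ^ 2 ≤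
      modConst b * B * modSq l b F ^ 3 := by
  have hgood := ae_integrable_memLp_of_modSq hF hb hS
  have hr0 : ∀ p, 0 ≤ radBr l p := fun p => zero_le_one.trans (one_le_radBr l p)
  have hFs : Measurable fun y : (ℤ × ℝ) × ℝ => F y.2 y.1 := hF.comp measurable_swap
  have hrm : Measurable fun y : (ℤ × ℝ) × ℝ => ENNReal.ofReal (radBr l y.1) :=
    (radBr_measurable l).ennreal_ofReal.comp measurable_fst
  set f : (ℤ × ℝ) × ℝ → ℝ≥0∞ := fun y => ENNReal.ofReal (radBr l y.1) * ‖F y.2 y.1‖ₑ with hf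
  have hfm : Measurable f := hrm.mul hFs.enorm
  have hwm := windowFT_timeInv_measurable δ hF
  -- The reflection is needed because the third frequency is -(ζ₁ + ζ₂), whereas the criterion
  -- evaluates q at y + y'.
  set q : (ℤ × ℝ) × ℝ → ℝ≥0∞ := fun y => ENNReal.ofReal (radBr l (-y.1)) *
    ‖windowFT δ (fun t => timeInv F t (-y.1)) y.2‖ₑ with hq
  have hqm : Measurable q := by
    have h1 : Measurable fun y : (ℤ × ℝ) × ℝ => windowFT δ (fun t => timeInv F t (-y.1)) y.2 :=
      hwm.comp (f := fun y : (ℤ × ℝ) × ℝ => (-y.1, y.2)) (by fun_prop)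
    refine Measurable.mul ?_ h1.enorm
    exact (radBr_measurable l).ennreal_ofReal.comp (by fun_prop)
  have hmod : Measurable fun y : (ℤ × ℝ) × ℝ => modWeight l b y.2 y.1 * ‖F y.2 y.1‖ₑ ^ 2 :=
    (modWeight_measurable l b).mul (hFs.enorm.pow_const 2)
  have hfS : ∫⁻ y, stWeight l (2 * b) y * f y ^ 2 ∂stMeasure l = modSq l b F := by
    unfold stMeasure modSq
    have hm0 : Measurable fun y => stWeight l (2 * b) y * f y ^ 2 :=
      (stWeight_measurable l (2 * b)).mul (hfm.pow_const 2)
    rw [lintegral_prod _ hm0.aemeasurable]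
    congr 1
    funext p
    rw [← lintegral_const_mul' _ _ ENNReal.ofReal_ne_top]
    congr 1
    funext τ
    rw [hf]
    simp only [mul_pow]
    rw [← ENNReal.ofReal_pow (hr0 p), mul_left_comm]
    rfl
  have hqS : ∫⁻ y, q y ^ 2 ∂stMeasure l ≤ modSq l b F := by
    unfold stMeasure modSq
    rw [lintegral_prod _ (hqm.pow_const 2).aemeasurable]
    set φ : ℤ × ℝ → ℝ≥0∞ := fun p => ∫⁻ τ, (ENNReal.ofReal (radBr l p) *
      ‖windowFT δ (fun t => timeInv F t p) τ‖ₑ) ^ 2 with hφ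
    have e : ∀ p, ∫⁻ τ, q (p, τ) ^ 2 = φ (-p) := fun p => rfl
    simp only [e]
    rw [lintegral_neg_eq_self φ]
    refine lintegral_mono_ae ?_
    filter_upwards [hgood] with p hp
    rw [hφ]
    simp only [mul_pow]
    rw [lintegral_const_mul' _ _ (ENNReal.pow_ne_top ENNReal.ofReal_ne_top),
      ← ENNReal.ofReal_pow (hr0 p)]
    refine mul_le_mul_right ?_ _
    refine (lintegral_windowFT_sq_le hp.1 hp.2 δ).2.trans (lintegral_mono fun τ => ?_)
    exact le_mul_of_one_le_left' (one_le_modWeight (by linarith) l τ p)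
  have hmain := sq_trilinear_le hκ hB hfm hqm
  rw [hfS] at hmain
  calc _ ≤ (∫⁻ y, ∫⁻ y', κ y.1 y'.1 * (f y * f y' * q (y + y')) ∂stMeasure l ∂stMeasure l) ^ 2 := by
        gcongr
        have hm3 : Measurable fun z : ((ℤ × ℝ) × ℝ) × ((ℤ × ℝ) × ℝ) =>
            κ z.1.1 z.2.1 * (f z.1 * f z.2 * q (z.1 + z.2)) := by
          have h1 : Measurable fun z : ((ℤ × ℝ) × ℝ) × ((ℤ × ℝ) × ℝ) => κ z.1.1 z.2.1 :=
            hκ.comp (f := fun z : ((ℤ × ℝ) × ℝ) × ((ℤ × ℝ) × ℝ) => (z.1.1, z.2.1)) (by fun_prop)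
          exact h1.mul (((hfm.comp measurable_fst).mul (hfm.comp measurable_snd)).mul
            (hqm.comp (by fun_prop)))
        have hunf : ∀ φ : (ℤ × ℝ) × ℝ → ℝ≥0∞, Measurable φ →
            ∫⁻ y, φ y ∂stMeasure l = ∫⁻ p, ∫⁻ τ, φ (p, τ) ∂volume ∂freqMeasure l := fun φ hφ =>
          lintegral_prod _ hφ.aemeasurable
        rw [hunf _ hm3.lintegral_prod_right']
        refine lintegral_mono_ae ?_
        filter_upwards [hgood] with p hp
        have e1 : ∀ τ, ∫⁻ y', κ p y'.1 * (f (p, τ) * f y' * q ((p, τ) + y')) ∂stMeasure l =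
            ∫⁻ p', ∫⁻ τ', κ p p' * (f (p, τ) * f (p', τ') * q ((p, τ) + (p', τ')))
              ∂volume ∂freqMeasure l := fun τ => hunf (fun y' => κ p y'.1 * (f (p, τ) * f y' * q ((p, τ) + y')))
            (hm3.comp (measurable_prodMk_left (x := (p, τ))))
        simp only [e1]
        have hm4 : Measurable fun r : ℝ × (ℤ × ℝ) => ∫⁻ τ' : ℝ, κ p r.2 *
            (f (p, r.1) * f (r.2, τ') * q ((p, r.1) + (r.2, τ'))) := by
          refine Measurable.lintegral_prod_right' (f := fun s : (ℝ × (ℤ × ℝ)) × ℝ => κ p s.1.2 *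
            (f (p, s.1.1) * f (s.1.2, s.2) * q ((p, s.1.1) + (s.1.2, s.2)))) ?_
          exact hm3.comp (f := fun s : (ℝ × (ℤ × ℝ)) × ℝ => ((p, s.1.1), (s.1.2, s.2)))
            (by fun_prop)
        rw [lintegral_lintegral_swap hm4.aemeasurable]
        refine lintegral_mono_ae ?_
        filter_upwards [hgood, ae_neg_sub hgood p] with p' hp' hpc
        have e2 : ∀ τ τ', κ p p' * (f (p, τ) * f (p', τ') * q ((p, τ) + (p', τ'))) =
            κ p p' * (ENNReal.ofReal (radBr l p * radBr l p' * radBr l (-p - p')) *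
            (‖F τ p‖ₑ * ‖F τ' p'‖ₑ * ‖windowFT δ (fun t => timeInv F t (-p - p')) (τ + τ')‖ₑ)) := by
          intro τ τ'
          rw [hf, hq]
          simp only [Prod.mk_add_mk, neg_add']
          rw [ENNReal.ofReal_mul (mul_nonneg (hr0 _) (hr0 _)), ENNReal.ofReal_mul (hr0 _)]
          ring
        simp only [e2]
        have hwm' : Measurable fun τ => windowFT δ (fun t => timeInv F t (-p - p')) τ :=
          hwm.comp measurable_prodMk_left
        have hFp : ∀ p, Measurable fun τ => F τ p := fun p => hF.comp measurable_prodMk_right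
        have hm5 : Measurable fun r : ℝ × ℝ => ‖F r.1 p‖ₑ * ‖F r.2 p'‖ₑ *
            ‖windowFT δ (fun t => timeInv F t (-p - p')) (r.1 + r.2)‖ₑ :=
          ((((hFp p).comp measurable_fst).enorm).mul (((hFp p').comp measurable_snd).enorm)).mul
            ((hwm'.comp (measurable_fst.add measurable_snd)).enorm)
        have e3 : ∀ τ, ∫⁻ τ', κ p p' *
            (ENNReal.ofReal (radBr l p * radBr l p' * radBr l (-p - p')) *
            (‖F τ p‖ₑ * ‖F τ' p'‖ₑ * ‖windowFT δ (fun t => timeInv F t (-p - p')) (τ + τ')‖ₑ)) =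
            κ p p' * (ENNReal.ofReal (radBr l p * radBr l p' * radBr l (-p - p')) * ∫⁻ τ',
            (‖F τ p‖ₑ * ‖F τ' p'‖ₑ *
              ‖windowFT δ (fun t => timeInv F t (-p - p')) (τ + τ')‖ₑ)) := by
          intro τ
          have hm6 : Measurable fun τ' => ‖F τ p‖ₑ * ‖F τ' p'‖ₑ *
              ‖windowFT δ (fun t => timeInv F t (-p - p')) (τ + τ')‖ₑ :=
            hm5.comp (measurable_prodMk_left (x := τ))
          rw [lintegral_const_mul _ (hm6.const_mul _), lintegral_const_mul _ hm6]
        simp only [e3]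
        rw [lintegral_const_mul _ (hm5.lintegral_prod_right'.const_mul _),
          lintegral_const_mul _ hm5.lintegral_prod_right']
        gcongr
        exact enorm_integral_inv_mul_inv_le hp.1 hp'.1
          (lintegral_windowFT_sq_le hpc.1 hpc.2 δ).1
    _ ≤ modSq l b F ^ 2 * (modConst b * B * ∫⁻ y, q y ^ 2 ∂stMeasure l) := hmain
    _ ≤ modSq l b F ^ 2 * (modConst b * B * modSq l b F) := by gcongr
    _ = _ := by ring


/-! ### Bounds for the multiplier -/

section Multiplier

variable {s A N : ℝ} {m : ℝ → ℝ}

theorem IsMultiplier.s_le_one (h : IsMultiplier s A N m) (hN : 1 ≤ N) : s ≤ 1 := by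
  by_contra hc
  push Not at hc
  have h1 := h.high (2 * N) le_rfl
  have h2 := h.low N le_rfl
  have h3 := h.antitone (by linarith : N ≤ 2 * N)
  rw [h1, h2, mul_div_assoc, div_self (by linarith), mul_one] at h3
  have h4 : (1 : ℝ) < 2 ^ (s - 1) := Real.one_lt_rpow (by norm_num) (by linarith)
  linarith

theorem IsMultiplier.pos (h : IsMultiplier s A N m) (hN : 1 ≤ N) (r : ℝ) : 0 < m r := by
  have h1 := h.high (max r (2 * N)) (le_max_right _ _)
  have h2 := h.antitone (le_max_left r (2 * N))
  refine lt_of_lt_of_le ?_ h2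
  rw [h1]
  have : 0 < max r (2 * N) := lt_of_lt_of_le (by linarith) (le_max_right _ _)
  exact Real.rpow_pos_of_pos (div_pos this (by linarith)) _

theorem IsMultiplier.le_one (h : IsMultiplier s A N m) (r : ℝ) : m r ≤ 1 := by
  rw [← h.low (min r N) (min_le_right _ _)]
  exact h.antitone (min_le_left _ _)

/-- By monotonicity the worst case is m(16N) = 16^{s-1} ≥ 16^{-1/4} = 1/2. -/
theorem IsMultiplier.half_le (h : IsMultiplier s A N m) (hs : 9 / 10 < s) (hN : 1 ≤ N) {r : ℝ}
    (hr : r ≤ 16 * N) : 1 / 2 ≤ m r := by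
  have h0 : 0 < N := by linarith
  refine le_trans ?_ (h.antitone hr)
  rw [h.high _ (by linarith), mul_div_assoc, div_self h0.ne', mul_one]
  calc (1 / 2 : ℝ) ≤ (16 : ℝ) ^ (-(1 / 4) : ℝ) := by
        rw [show (16 : ℝ) = 2 ^ (4 : ℝ) by norm_num, ← Real.rpow_mul (by norm_num)]
        norm_num
    _ ≤ _ := Real.rpow_le_rpow_of_exponent_le (by norm_num) (by linarith)

/-- This is where s > 9/10 fixes the exponent 1/10: beyond 16N the multiplier is the pure power
(r/N)^{s-1}. -/
theorem IsMultiplier.inv_le (h : IsMultiplier s A N m) (hs : 9 / 10 < s) (hN : 1 ≤ N) (r : ℝ) :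
    (m r)⁻¹ ≤ 2 * max (r / N) 1 ^ (1 / 10 : ℝ) := by
  have h0 : 0 < N := by linarith
  have h1 : 1 ≤ max (r / N) 1 ^ (1 / 10 : ℝ) := Real.one_le_rpow (le_max_right _ _) (by norm_num)
  by_cases hr : r ≤ 16 * N
  · have h2 := h.half_le hs hN hr
    have : (m r)⁻¹ ≤ (1 / 2)⁻¹ := inv_anti₀ (by norm_num) h2
    norm_num at this
    linarith
  · push Not at hr
    have h3 : 1 ≤ r / N := by rw [le_div_iff₀ h0]; linarith
    rw [h.high r (by linarith), ← Real.rpow_neg (by linarith), max_eq_left h3]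
    have h4 : (r / N) ^ (-(s - 1)) ≤ (r / N) ^ (1 / 10 : ℝ) :=
      Real.rpow_le_rpow_of_exponent_le h3 (by linarith)
    have h5 : 0 ≤ (r / N) ^ (1 / 10 : ℝ) := by positivity
    linarith

theorem IsMultiplier.doubling (h : IsMultiplier s A N m) (hs : 9 / 10 < s) (hN : 1 ≤ N)
    {r₁ r₂ : ℝ} (hr : r₂ / 8 ≤ r₁) : m r₁ ≤ 2 * m r₂ := by
  have h0 : 0 < N := by linarith
  by_cases h2 : r₂ ≤ 16 * N
  · linarith [h.half_le hs hN h2, h.le_one r₁]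
  · push Not at h2
    refine (h.antitone hr).trans ?_
    rw [h.high r₂ (by linarith), h.high (r₂ / 8) (by linarith)]
    have h3 : 0 < r₂ / N := div_pos (by linarith) h0
    rw [show r₂ / 8 / N = (r₂ / N) / 8 by ring, Real.div_rpow h3.le (by norm_num), div_eq_mul_inv,
      mul_comm, ← Real.rpow_neg (by norm_num)]
    gcongr
    calc (8 : ℝ) ^ (-(s - 1)) ≤ 8 ^ (1 / 3 : ℝ) :=
          Real.rpow_le_rpow_of_exponent_le (by norm_num) (by linarith)
      _ = 2 := by
          rw [show (8 : ℝ) = 2 ^ (3 : ℝ) by norm_num, ← Real.rpow_mul (by norm_num)]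
          norm_num

/-- For exponents between -1 and 0 the power lies between 1 and 1/x, so the case α = -1 decides. -/
theorem abs_rpow_sub_one_le {x α : ℝ} (hx : 3 / 4 ≤ x) (hα0 : α ≤ 0) (hα1 : -1 ≤ α) :
    |x ^ α - 1| ≤ 2 * |x - 1| := by
  have hx0 : 0 < x := by linarith
  rcases le_total 1 x with h | h
  · have h1 : x ^ α ≤ 1 := Real.rpow_le_one_of_one_le_of_nonpos h hα0
    have h2 : x ^ (-1 : ℝ) ≤ x ^ α := Real.rpow_le_rpow_of_exponent_le h hα1
    rw [Real.rpow_neg_one] at h2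
    have h3 : 1 - (x - 1) ≤ x⁻¹ := by
      rw [← mul_le_mul_iff_of_pos_right hx0, inv_mul_cancel₀ hx0.ne']
      nlinarith [sq_nonneg (x - 1)]
    rw [abs_of_nonpos (by linarith), abs_of_nonneg (by linarith)]
    linarith
  · have h1 : 1 ≤ x ^ α := Real.one_le_rpow_of_pos_of_le_one_of_nonpos hx0 h hα0
    have h2 : x ^ α ≤ x ^ (-1 : ℝ) := Real.rpow_le_rpow_of_exponent_ge hx0 h hα1
    rw [Real.rpow_neg_one] at h2
    have h3 : x⁻¹ ≤ 1 + 2 * (1 - x) := by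
      rw [← mul_le_mul_iff_of_pos_right hx0, inv_mul_cancel₀ hx0.ne']
      nlinarith
    rw [abs_of_nonneg (by linarith), abs_of_nonpos (by linarith)]
    linarith

theorem IsMultiplier.A_nonneg (h : IsMultiplier s A N m) (hN : 1 ≤ N) : 0 ≤ A := by
  have h0 : 0 < N := by linarith
  have h1 := (abs_nonneg _).trans (h.deriv_le 0)
  rwa [le_div_iff₀ h0, zero_mul] at h1

/-- For r₂ ≤ 8N this is the mean value theorem with |m'| ≤ A/N, and m(r₂) ≥ 1/2 makes it relative.
For r₂ > 8N both radii exceed 2N and homogeneity of the power reduces it to a ratio near 1. -/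
theorem IsMultiplier.abs_sub_le (h : IsMultiplier s A N m) (hs : 9 / 10 < s) (hN : 1 ≤ N)
    {r₁ r₂ r₃ : ℝ} (hr2 : 0 < r₂) (h12 : |r₁ - r₂| ≤ r₃) (h32 : r₃ ≤ r₂ / 4) :
    |m r₁ - m r₂| ≤ (16 * A + 2) * (m r₂ * (r₃ / r₂)) := by
  have h0 : 0 < N := by linarith
  have hA := h.A_nonneg hN
  have hm2 := h.pos hN r₂
  have hr3 : 0 ≤ r₃ := (abs_nonneg _).trans h12
  by_cases hc : r₂ ≤ 8 * N
  · have h1 : |m r₁ - m r₂| ≤ A / N * |r₁ - r₂| := by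
      have := Convex.norm_image_sub_le_of_norm_deriv_le (f := m) (C := A / N) (s := Set.univ)
        (fun x _ => (h.smooth.differentiable (by simp)).differentiableAt)
        (fun x _ => h.deriv_le x) convex_univ (Set.mem_univ r₂) (Set.mem_univ r₁)
      exact this
    have h2 := h.half_le hs hN (r := r₂) (by linarith)
    have h3 : N⁻¹ ≤ 8 * r₂⁻¹ := by
      rw [← div_eq_mul_inv, le_div_iff₀ hr2, inv_mul_le_iff₀ h0]
      linarith
    calc |m r₁ - m r₂| ≤ A / N * |r₁ - r₂| := h1
      _ ≤ A * (8 * r₂⁻¹) * r₃ := by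
          rw [div_eq_mul_inv]
          gcongr
      _ = 16 * A * (1 / 2 * (r₃ / r₂)) := by ring
      _ ≤ (16 * A + 2) * (m r₂ * (r₃ / r₂)) := by
          gcongr
          linarith
  · push Not at hc
    have h1 := abs_le.mp h12
    set x := r₁ / r₂ with hx
    have hx34 : 3 / 4 ≤ x := by rw [hx, le_div_iff₀ hr2]; linarith [h1.1]
    have hr1 : r₁ = x * r₂ := by rw [hx]; field_simp
    have hm1 : m r₁ = x ^ (s - 1) * m r₂ := by
      rw [h.high r₁ (by linarith [h1.1]), h.high r₂ (by linarith), ← Real.mul_rpow (by linarith)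
        (by positivity), hr1, mul_div_assoc]
    have hs1 := h.s_le_one hN
    have h2 := abs_rpow_sub_one_le hx34 (α := s - 1) (by linarith) (by linarith)
    have h3 : |x - 1| ≤ r₃ / r₂ := by
      rw [hx, div_sub_one hr2.ne', abs_div, abs_of_pos hr2]
      gcongr
    rw [hm1, ← sub_one_mul, abs_mul, abs_of_pos hm2]
    have h4 : 0 ≤ m r₂ * (r₃ / r₂) := by positivity
    calc |x ^ (s - 1) - 1| * m r₂ ≤ (2 * (r₃ / r₂)) * m r₂ := by
          gcongr
          linarith
      _ = 2 * (m r₂ * (r₃ / r₂)) := by ring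
      _ ≤ _ := by
          gcongr
          linarith

theorem abs_one_sub_le {x : ℝ} (hx : 0 ≤ x) : |1 - x| ≤ 1 + x := by
  rw [abs_le]
  constructor <;> linarith

/-- The defect when the third frequency is small. -/
theorem IsMultiplier.defect_low (h : IsMultiplier s A N m) (hs : 9 / 10 < s) (hN : 1 ≤ N)
    {r₁ r₂ r₃ : ℝ} (hr2 : N / 2 < r₂) (h12 : |r₁ - r₂| ≤ r₃) (h32 : r₃ ≤ r₂ / 4) :
    |1 - m r₁ / (m r₂ * m r₃)| ^ 2 ≤
      (2 * (16 * A + 2) ^ 2 + 25) * (N ^ (-(1 / 5) : ℝ) * (1 + r₃) ^ (9 / 10 : ℝ)) := by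
  have h0 : 0 < N := by linarith
  have hA := h.A_nonneg hN
  have hm2 := h.pos hN r₂
  have hm3 := h.pos hN r₃
  have hr3 : 0 ≤ r₃ := (abs_nonneg _).trans h12
  have hr20 : 0 < r₂ := by linarith
  -- If r₃ ≤ N then m(r₃) = 1 and the defect is a difference of values of m, which gains r₃/r₂. If
  -- r₃ > N no cancellation is needed: m(r₁) ≲ m(r₂), and 1/m(r₃) costs (r₃/N)^{1/10}.
  rcases le_or_gt r₃ N with hc | hc
  · have e1 : |1 - m r₁ / (m r₂ * m r₃)| ≤ (16 * A + 2) * (r₃ / r₂) := by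
      have h1 := h.abs_sub_le hs hN hr20 h12 h32
      rw [h.low r₃ hc, mul_one, one_sub_div hm2.ne', abs_div, abs_of_pos hm2, abs_sub_comm,
        div_le_iff₀ hm2]
      linarith
    have e2 : r₃ / r₂ ≤ 2 * ((1 + r₃) / N) := by
      rw [div_le_iff₀ hr20, mul_assoc, div_mul_eq_mul_div, mul_div_assoc']
      rw [le_div_iff₀ h0]
      nlinarith
    have e3 : r₃ / r₂ ≤ 1 := by rw [div_le_one hr20]; linarith
    -- The exponent is lowered to 9/10 = 2 - 11/10, the power of ⟨ζ₃⟩ left by the gap kernel.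
    have e4 : (r₃ / r₂) ^ 2 ≤ (r₃ / r₂) ^ (9 / 10 : ℝ) := by
      rw [← Real.rpow_two]
      exact Real.rpow_le_rpow_of_exponent_ge_of_imp (by positivity) e3 (by norm_num)
        (fun _ h => by norm_num at h)
    have e5 : (r₃ / r₂) ^ (9 / 10 : ℝ) ≤ 2 * (N ^ (-(1 / 5) : ℝ) * (1 + r₃) ^ (9 / 10 : ℝ)) := by
      calc (r₃ / r₂) ^ (9 / 10 : ℝ) ≤ (2 * ((1 + r₃) / N)) ^ (9 / 10 : ℝ) :=
            Real.rpow_le_rpow (by positivity) e2 (by norm_num)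
        _ = 2 ^ (9 / 10 : ℝ) * ((1 + r₃) ^ (9 / 10 : ℝ) * N ^ (-(9 / 10) : ℝ)) := by
            rw [Real.mul_rpow (by norm_num) (by positivity), Real.div_rpow (by positivity) h0.le,
              div_eq_mul_inv ((1 + r₃) ^ (9 / 10 : ℝ)), Real.rpow_neg h0.le]
        _ ≤ 2 ^ (1 : ℝ) * ((1 + r₃) ^ (9 / 10 : ℝ) * N ^ (-(1 / 5) : ℝ)) := by
            have c1 : (2 : ℝ) ^ (9 / 10 : ℝ) ≤ 2 ^ (1 : ℝ) :=
              Real.rpow_le_rpow_of_exponent_le (by norm_num) (by norm_num)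
            have c2 : N ^ (-(9 / 10) : ℝ) ≤ N ^ (-(1 / 5) : ℝ) :=
              Real.rpow_le_rpow_of_exponent_le hN (by norm_num)
            exact mul_le_mul c1 (mul_le_mul_of_nonneg_left c2 (by positivity)) (by positivity)
              (by positivity)
        _ = _ := by rw [Real.rpow_one]; ring
    have hP : 0 ≤ N ^ (-(1 / 5) : ℝ) * (1 + r₃) ^ (9 / 10 : ℝ) := by positivity
    calc |1 - m r₁ / (m r₂ * m r₃)| ^ 2 ≤ ((16 * A + 2) * (r₃ / r₂)) ^ 2 := by gcongr
      _ = (16 * A + 2) ^ 2 * (r₃ / r₂) ^ 2 := by ring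
      _ ≤ (16 * A + 2) ^ 2 * (2 * (N ^ (-(1 / 5) : ℝ) * (1 + r₃) ^ (9 / 10 : ℝ))) := by
          gcongr
          exact e4.trans e5
      _ ≤ _ := by linarith
  · have hr1 : r₂ / 8 ≤ r₁ := by linarith [(abs_le.mp h12).1]
    have e1 := h.doubling hs hN hr1
    have e2 := h.inv_le hs hN r₃
    have e3 : 1 ≤ r₃ / N := by rw [le_div_iff₀ h0]; linarith
    rw [max_eq_left e3] at e2
    have e4 : 1 ≤ (r₃ / N) ^ (1 / 10 : ℝ) := Real.one_le_rpow e3 (by norm_num)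
    have e5 : m r₁ / (m r₂ * m r₃) ≤ 4 * (r₃ / N) ^ (1 / 10 : ℝ) := by
      calc m r₁ / (m r₂ * m r₃) ≤ 2 * m r₂ / (m r₂ * m r₃) := by gcongr
        _ = 2 * (m r₃)⁻¹ := by field_simp
        _ ≤ _ := by linarith
    have e6 : |1 - m r₁ / (m r₂ * m r₃)| ≤ 5 * (r₃ / N) ^ (1 / 10 : ℝ) :=
      (abs_one_sub_le (by have := h.pos hN r₁; positivity)).trans (by linarith)
    have hP : 0 ≤ N ^ (-(1 / 5) : ℝ) * (1 + r₃) ^ (9 / 10 : ℝ) := by positivity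
    calc |1 - m r₁ / (m r₂ * m r₃)| ^ 2 ≤ (5 * (r₃ / N) ^ (1 / 10 : ℝ)) ^ 2 := by gcongr
      _ = 25 * (N ^ (-(1 / 5) : ℝ) * r₃ ^ (1 / 5 : ℝ)) := by
          rw [mul_pow, ← Real.rpow_natCast ((r₃ / N) ^ (1 / 10 : ℝ)), ← Real.rpow_mul (by positivity),
            Real.div_rpow hr3 h0.le, Real.rpow_neg h0.le]
          norm_num
          ring
      _ ≤ 25 * (N ^ (-(1 / 5) : ℝ) * (1 + r₃) ^ (9 / 10 : ℝ)) := by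
          have : r₃ ^ (1 / 5 : ℝ) ≤ (1 + r₃) ^ (9 / 10 : ℝ) :=
            (Real.rpow_le_rpow hr3 (by linarith) (by norm_num)).trans
              (Real.rpow_le_rpow_of_exponent_le (by linarith) (by norm_num))
          gcongr
      _ ≤ _ := by nlinarith [sq_nonneg (16 * A + 2)]

theorem max_div_rpow_le {r N a : ℝ} (hN : 1 ≤ N) (hr : N / 2 < r) (ha : 0 ≤ a) (ha1 : a ≤ 1) :
    max (r / N) 1 ^ a ≤ 2 * (r ^ a * N ^ (-a)) := by
  have h0 : 0 < N := by linarith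
  have h1 : max (r / N) 1 ≤ 2 * (r / N) := by
    refine max_le ?_ ?_
    · have : 0 ≤ r / N := div_nonneg (by linarith) h0.le
      linarith
    · rw [← mul_div_assoc, le_div_iff₀ h0]
      linarith
  have hr0 : 0 < r := by linarith
  calc max (r / N) 1 ^ a ≤ (2 * (r / N)) ^ a :=
        Real.rpow_le_rpow (le_trans zero_le_one (le_max_right _ _)) h1 ha
    _ = 2 ^ a * (r ^ a * N ^ (-a)) := by
        rw [Real.mul_rpow (by norm_num) (by positivity), Real.div_rpow hr0.le h0.le,
          div_eq_mul_inv, Real.rpow_neg h0.le]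
    _ ≤ _ := by
        gcongr
        conv_rhs => rw [← Real.rpow_one 2]
        exact Real.rpow_le_rpow_of_exponent_le (by norm_num) ha1

/-- No cancellation is used. In general both 1/m(r₂) and 1/m(r₃) are paid for; when r₁ is not much
smaller than r₂, doubling cancels m(r₁) against m(r₂) and only one remains. -/
theorem IsMultiplier.defect_high (h : IsMultiplier s A N m) (hs : 9 / 10 < s) (hN : 1 ≤ N)
    {r₁ r₂ r₃ : ℝ} (hr2 : N / 2 < r₂) (h32 : r₃ ≤ r₂) :
    |1 - m r₁ / (m r₂ * m r₃)| ^ 2 ≤ 50 * (r₂ ^ (2 / 5 : ℝ) * N ^ (-(2 / 5) : ℝ)) ∧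
    (r₂ / 8 ≤ r₁ →
      |1 - m r₁ / (m r₂ * m r₃)| ^ 2 ≤ 50 * (r₂ ^ (1 / 5 : ℝ) * N ^ (-(1 / 5) : ℝ))) := by
  have h0 : 0 < N := by linarith
  have hm1 := h.pos hN r₁
  have hm2 := h.pos hN r₂
  have hm3 := h.pos hN r₃
  set w := max (r₂ / N) 1 with hw
  have hw1 : 1 ≤ w := le_max_right _ _
  have hw0 : 0 ≤ w := by linarith
  have e2 : (m r₂)⁻¹ ≤ 2 * w ^ (1 / 10 : ℝ) := h.inv_le hs hN r₂
  have e3 : (m r₃)⁻¹ ≤ 2 * w ^ (1 / 10 : ℝ) :=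
    (inv_anti₀ hm2 (h.antitone h32)).trans e2
  have e4 : 1 ≤ w ^ (1 / 10 : ℝ) := Real.one_le_rpow hw1 (by norm_num)
  have hsq : ∀ a : ℝ, (w ^ a) ^ 2 = w ^ (2 * a) := by
    intro a
    rw [← Real.rpow_natCast, ← Real.rpow_mul hw0, mul_comm a]
    norm_num
  constructor
  · have e5 : m r₁ / (m r₂ * m r₃) ≤ 4 * w ^ (1 / 5 : ℝ) := by
      calc m r₁ / (m r₂ * m r₃) ≤ 1 / (m r₂ * m r₃) := by gcongr; exact h.le_one r₁
        _ = (m r₂)⁻¹ * (m r₃)⁻¹ := by rw [one_div, mul_inv]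
        _ ≤ (2 * w ^ (1 / 10 : ℝ)) * (2 * w ^ (1 / 10 : ℝ)) := by gcongr
        _ = 4 * (w ^ (1 / 10 : ℝ)) ^ 2 := by ring
        _ = _ := by rw [hsq]; norm_num
    have e6 : 1 ≤ w ^ (1 / 5 : ℝ) := Real.one_le_rpow hw1 (by norm_num)
    have e7 : |1 - m r₁ / (m r₂ * m r₃)| ≤ 5 * w ^ (1 / 5 : ℝ) :=
      (abs_one_sub_le (by positivity)).trans (by linarith)
    calc |1 - m r₁ / (m r₂ * m r₃)| ^ 2 ≤ (5 * w ^ (1 / 5 : ℝ)) ^ 2 := by gcongr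
      _ = 25 * w ^ (2 / 5 : ℝ) := by rw [mul_pow, hsq]; norm_num
      _ ≤ _ := by linarith [max_div_rpow_le (a := 2 / 5) hN hr2 (by norm_num) (by norm_num)]
  · intro hr1
    have e5 : m r₁ / (m r₂ * m r₃) ≤ 4 * w ^ (1 / 10 : ℝ) := by
      calc m r₁ / (m r₂ * m r₃) ≤ 2 * m r₂ / (m r₂ * m r₃) := by
            gcongr
            exact h.doubling hs hN hr1
        _ = 2 * (m r₃)⁻¹ := by field_simp
        _ ≤ _ := by linarith
    have e7 : |1 - m r₁ / (m r₂ * m r₃)| ≤ 5 * w ^ (1 / 10 : ℝ) :=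
      (abs_one_sub_le (by positivity)).trans (by linarith)
    calc |1 - m r₁ / (m r₂ * m r₃)| ^ 2 ≤ (5 * w ^ (1 / 10 : ℝ)) ^ 2 := by gcongr
      _ = 25 * w ^ (1 / 5 : ℝ) := by rw [mul_pow, hsq]; norm_num
      _ ≤ _ := by linarith [max_div_rpow_le (a := 1 / 5) hN hr2 (by norm_num) (by norm_num)]

end Multiplier


/-! ### The symbol is controlled by the resonance kernels -/

/-- The symbol of the cubic increment acting on `Iu`. -/
noncomputable def redSymbol (l : ℝ) (m : ℝ → ℝ) (p p' : ℤ × ℝ) : ℝ :=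
  p.2 * (p.2 ^ 2 + (p.1 / l) ^ 2) * (1 - m (rad l p) / (m (rad l p') * m (rad l (-p - p'))))

/-- The sum of the two resonance kernels. -/
noncomputable def resKer (l : ℝ) (p p' : ℤ × ℝ) : ℝ := gapKer l p p' + nearKer l p p'

theorem resKer_nonneg (l : ℝ) (p p' : ℤ × ℝ) : 0 ≤ resKer l p p' :=
  add_nonneg (gapKer_nonneg l p p') (nearKer_nonneg l p p')

theorem rad_sub_le (l : ℝ) (p p' : ℤ × ℝ) : rad l (-p - p') ≤ rad l p + rad l p' := by
  have h1 := rad_nonneg l p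
  have h2 := rad_nonneg l p'
  refine abs_le_of_sq_le_sq' ?_ (by positivity) |>.2
  have e1 := rad_sq l p
  have e2 := rad_sq l p'
  have e3 := rad_sq l (-p - p')
  simp only [Prod.fst_sub, Prod.snd_sub, Prod.fst_neg, Prod.snd_neg, Int.cast_sub, Int.cast_neg,
    sub_div, neg_div] at e3
  have hcs : 3 * (p.2 * p'.2) + p.1 / l * (p'.1 / l) ≤ rad l p * rad l p' := by
    refine abs_le_of_sq_le_sq' ?_ (by positivity) |>.2
    rw [mul_pow, e1, e2]
    nlinarith [sq_nonneg (p.2 * (p'.1 / l) - p.1 / l * p'.2)]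
  nlinarith

theorem abs_rad_sub_rad_le (l : ℝ) (p p' : ℤ × ℝ) : |rad l p - rad l p'| ≤ rad l (-p - p') := by
  have h1 := rad_sub_le l p (-p - p')
  have h2 := rad_sub_le l p' (-p - p')
  rw [show -p - (-p - p') = p' by abel] at h1
  rw [show -p' - (-p - p') = p by abel] at h2
  rw [abs_le]
  constructor <;> linarith

theorem le_gapKer (l : ℝ) (p p' : ℤ × ℝ) :
    (1 + rad l p) ^ (-(11 / 10) : ℝ) * |rad l p ^ 2 - rad l p' ^ 2| ≤ gapKer l p p' := by
  unfold gapKer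
  have h : bracket (p.1 / l) ≤ 1 + rad l p := by
    unfold bracket
    linarith [abs_fst_le_rad l p]
  have h2 : (1 + rad l p) ^ (-(11 / 10) : ℝ) ≤ bracket (p.1 / l) ^ (-(11 / 10) : ℝ) :=
    Real.rpow_le_rpow_of_nonpos (one_pos.trans_le (one_le_bracket _)) h (by norm_num)
  gcongr

theorem nearKer_eq {l : ℝ} {a b c : ℤ × ℝ} (hc : -a - b = c) (h1 : 1 / 4 ≤ rad l c)
    (h2 : rad l c / 6 ≤ |c.2|) (h3 : |rad l a ^ 2 - rad l b ^ 2| ≤ rad l c ^ (13 / 10 : ℝ))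
    (h4 : |rad l a ^ 2 - rad l c ^ 2| ≤ rad l c ^ (13 / 10 : ℝ))
    (h5 : |rad l b ^ 2 - rad l c ^ 2| ≤ rad l c ^ (13 / 10 : ℝ)) :
    nearKer l a b = rad l c ^ (1 / 5 : ℝ) := by
  subst hc
  unfold nearKer
  rw [if_pos]
  exact ⟨h1, h2, h3, h4, h5⟩

/-- Among three vectors of nearly equal moduli and zero sum, one has a large first component. -/
theorem exists_large_component {x₁ x₂ x₃ y₁ y₂ y₃ R₁ R₂ R₃ T R : ℝ}
    (hy : y₁ + y₂ + y₃ = 0) (h1 : R₁ = 3 * x₁ ^ 2 + y₁ ^ 2)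
    (h2 : R₂ = 3 * x₂ ^ 2 + y₂ ^ 2) (h3 : R₃ = 3 * x₃ ^ 2 + y₃ ^ 2) (hR : 0 < R)
    (hT : T ≤ R / 50) (hR2 : R₂ = R)
    (h12 : |R₁ - R₂| ≤ T) (h13 : |R₁ - R₃| ≤ T) (h23 : |R₂ - R₃| ≤ T) :
    R₁ ≤ 36 * x₁ ^ 2 ∨ R₂ ≤ 36 * x₂ ^ 2 ∨ R₃ ≤ 36 * x₃ ^ 2 := by
  by_contra hc
  push Not at hc
  obtain ⟨c1, c2, c3⟩ := hc
  have a12 := abs_le.mp h12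
  have a13 := abs_le.mp h13
  have a23 := abs_le.mp h23
  have k1 : 11 / 12 * R₁ ≤ y₁ ^ 2 := by linarith
  have k2 : 11 / 12 * R₂ ≤ y₂ ^ 2 := by linarith
  have k3 : 11 / 12 * R₃ ≤ y₃ ^ 2 := by linarith
  -- If every first component were small, the yⱼ would have nearly equal size. Two of equal sign
  -- would force the square of the third to be nearly four times as large, yet among three numbers
  -- two must share a sign.
  have s1 : ¬ 0 ≤ y₁ * y₂ := by
    intro h
    have : y₃ ^ 2 = y₁ ^ 2 + y₂ ^ 2 + 2 * (y₁ * y₂) := by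
      rw [show y₃ = -(y₁ + y₂) by linarith]; ring
    linarith [sq_nonneg x₃]
  have s2 : ¬ 0 ≤ y₁ * y₃ := by
    intro h
    have : y₂ ^ 2 = y₁ ^ 2 + y₃ ^ 2 + 2 * (y₁ * y₃) := by
      rw [show y₂ = -(y₁ + y₃) by linarith]; ring
    linarith [sq_nonneg x₂]
  push Not at s1 s2
  have s3 : 0 < (y₁ * y₂) * (y₁ * y₃) := mul_pos_of_neg_of_neg s1 s2
  have s4 : 0 ≤ y₂ * y₃ := by
    by_contra h
    push Not at h
    nlinarith [sq_nonneg y₁]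
  have : y₁ ^ 2 = y₂ ^ 2 + y₃ ^ 2 + 2 * (y₂ * y₃) := by
    rw [show y₁ = -(y₂ + y₃) by linarith]; ring
  linarith [sq_nonneg x₁]

theorem rpow_div_nine_le {r₂ r : ℝ} (hr2half : 1 / 2 < r₂) (hr0 : 0 ≤ r) (hr : r ≤ r₂) :
    r₂ ^ (-(11 / 10) : ℝ) / 9 ≤ (1 + r) ^ (-(11 / 10) : ℝ) := by
  have hr2pos : 0 < r₂ := by linarith
  have c1 : (3 * r₂) ^ (-(11 / 10) : ℝ) ≤ (1 + r) ^ (-(11 / 10) : ℝ) :=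
    Real.rpow_le_rpow_of_nonpos (by linarith) (by linarith) (by norm_num)
  rw [Real.mul_rpow (by norm_num) hr2pos.le] at c1
  have c2 : (1 / 9 : ℝ) ≤ 3 ^ (-(11 / 10) : ℝ) := by
    rw [show (1 / 9 : ℝ) = 3 ^ (-2 : ℝ) by
      rw [Real.rpow_neg (by norm_num), Real.rpow_two]; norm_num]
    exact Real.rpow_le_rpow_of_exponent_le (by norm_num) (by norm_num)
  have c3 : 0 ≤ r₂ ^ (-(11 / 10) : ℝ) := by positivity
  nlinarith

theorem rpow_two_fifths_le {r₂ : ℝ} (hr2half : 1 / 2 < r₂) :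
    r₂ ^ (2 / 5 : ℝ) ≤ 2 * (r₂ ^ (-(11 / 10) : ℝ) * r₂ ^ 2) := by
  have hr2pos : 0 < r₂ := by linarith
  rw [← Real.rpow_two, ← Real.rpow_add hr2pos]
  have c1 : (2 * r₂) ^ (2 / 5 : ℝ) ≤ (2 * r₂) ^ (-(11 / 10) + 2 : ℝ) :=
    Real.rpow_le_rpow_of_exponent_le (by linarith) (by norm_num)
  rw [Real.mul_rpow (by norm_num) hr2pos.le, Real.mul_rpow (by norm_num) hr2pos.le] at c1
  have c2 : (1 : ℝ) ≤ 2 ^ (2 / 5 : ℝ) := Real.one_le_rpow (by norm_num) (by norm_num)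
  have c3 : (2 : ℝ) ^ (-(11 / 10) + 2 : ℝ) ≤ 2 := by
    conv_rhs => rw [← Real.rpow_one 2]
    exact Real.rpow_le_rpow_of_exponent_le (by norm_num) (by norm_num)
  have c4 : 0 ≤ r₂ ^ (2 / 5 : ℝ) := by positivity
  have c5 : 0 ≤ r₂ ^ (-(11 / 10) + 2 : ℝ) := by positivity
  nlinarith

-- If two squared moduli differ by T ~ r₂^{13/10}, a gap kernel is at least of order r₂^{-11/10} ·
-- r₂^{13/10} = r₂^{1/5}. Otherwise all three nearly agree, one of the vectors has a large
-- ξ-component, and the near kernel with that vector in the implicit third slot equals its modulus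
-- to the power 1/5.
set_option maxHeartbeats 1000000 in
theorem rpow_le_resKer_of_comparable (l : ℝ) {p₁ p₂ p₃ : ℤ × ℝ} (hp : -p₁ - p₂ = p₃)
    (hr2half : 1 / 2 < rad l p₂) (h32 : rad l p₃ ≤ rad l p₂) :
    rad l p₂ ^ (1 / 5 : ℝ) / 900 ≤ resKer l p₃ p₁ + resKer l p₂ p₁ + resKer l p₂ p₃ := by
  have g1 := rad_nonneg l p₁
  have g2 := rad_nonneg l p₂
  have g3 := rad_nonneg l p₃
  have q31 := le_gapKer l p₃ p₁
  have q21 := le_gapKer l p₂ p₁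
  have q23 := le_gapKer l p₂ p₃
  have n31 := nearKer_nonneg l p₃ p₁
  have n21 := nearKer_nonneg l p₂ p₁
  have n23 := nearKer_nonneg l p₂ p₃
  have z31 := gapKer_nonneg l p₃ p₁
  have z21 := gapKer_nonneg l p₂ p₁
  have z23 := gapKer_nonneg l p₂ p₃
  set S := resKer l p₃ p₁ + resKer l p₂ p₁ + resKer l p₂ p₃ with hS
  have u31 : gapKer l p₃ p₁ ≤ S := by rw [hS]; unfold resKer; linarith
  have u21 : gapKer l p₂ p₁ ≤ S := by rw [hS]; unfold resKer; linarith
  have u23 : gapKer l p₂ p₃ ≤ S := by rw [hS]; unfold resKer; linarith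
  have v31 : nearKer l p₃ p₁ ≤ S := by rw [hS]; unfold resKer; linarith
  have v21 : nearKer l p₂ p₁ ≤ S := by rw [hS]; unfold resKer; linarith
  have v23 : nearKer l p₂ p₃ ≤ S := by rw [hS]; unfold resKer; linarith
  set r₁ := rad l p₁ with hr₁
  set r₂ := rad l p₂ with hr₂
  set r₃ := rad l p₃ with hr₃
  have hr2pos : 0 < r₂ := by linarith
  have hw : ∀ r, 0 ≤ r → r ≤ r₂ →
      r₂ ^ (-(11 / 10) : ℝ) / 9 ≤ (1 + r) ^ (-(11 / 10) : ℝ) := fun r =>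
    rpow_div_nine_le hr2half
  set T := r₂ ^ (13 / 10 : ℝ) / 100 with hT
  have hTgap : ∀ r x, 0 ≤ r → r ≤ r₂ → T ≤ x →
      r₂ ^ (1 / 5 : ℝ) / 900 ≤ (1 + r) ^ (-(11 / 10) : ℝ) * x := by
    intro r x hr0 hr hx
    calc r₂ ^ (1 / 5 : ℝ) / 900 = r₂ ^ (-(11 / 10) : ℝ) / 9 * T := by
          rw [hT, div_mul_div_comm, ← Real.rpow_add hr2pos]
          norm_num
      _ ≤ _ := mul_le_mul (hw r hr0 hr) hx (by positivity) (by positivity)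
  rcases le_or_gt T |r₃ ^ 2 - r₁ ^ 2| with c31 | c31
  · exact (hTgap r₃ _ g3 h32 c31).trans (q31.trans u31)
  rcases le_or_gt T |r₂ ^ 2 - r₁ ^ 2| with c21 | c21
  · exact (hTgap r₂ _ g2 le_rfl c21).trans (q21.trans u21)
  rcases le_or_gt T |r₂ ^ 2 - r₃ ^ 2| with c23 | c23
  · exact (hTgap r₂ _ g2 le_rfl c23).trans (q23.trans u23)
  have hT50 : T ≤ r₂ ^ 2 / 50 := by
    have c1 : (2 * r₂) ^ (13 / 10 : ℝ) ≤ (2 * r₂) ^ (2 : ℝ) :=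
      Real.rpow_le_rpow_of_exponent_le (by linarith) (by norm_num)
    rw [Real.mul_rpow (by norm_num) hr2pos.le, Real.rpow_two] at c1
    have c2 : (2 : ℝ) ≤ 2 ^ (13 / 10 : ℝ) := by
      conv_lhs => rw [← Real.rpow_one 2]
      exact Real.rpow_le_rpow_of_exponent_le (by norm_num) (by norm_num)
    have c3 : 0 ≤ r₂ ^ (13 / 10 : ℝ) := by positivity
    have c4 : 2 * r₂ ^ (13 / 10 : ℝ) ≤ 2 ^ (13 / 10 : ℝ) * r₂ ^ (13 / 10 : ℝ) := by gcongr
    rw [hT]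
    linarith
  -- The threshold T is stated in terms of r₂, but `nearSet` measures against whichever modulus is
  -- in the third slot. Comparability of the radii and the margin 1/100 in T absorb the change.
  have hclose : ∀ r, 0 ≤ r → |r₂ ^ 2 - r ^ 2| ≤ T → r₂ / 2 ≤ r ∧ T ≤ r ^ (13 / 10 : ℝ) ∧
      r₂ ^ (1 / 5 : ℝ) / 900 ≤ r ^ (1 / 5 : ℝ) := by
    intro r hr0 hr
    have c1 : r₂ / 2 ≤ r := by
      by_contra hc
      push Not at hc
      have a1 := (abs_le.mp hr).2
      have a2 := pow_le_pow_left₀ hr0 hc.le 2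
      linarith [pow_pos hr2pos 2]
    have c2 : ∀ a : ℝ, 0 ≤ a → a ≤ 2 → r₂ ^ a / 4 ≤ r ^ a := by
      intro a ha ha2
      refine le_trans ?_ (Real.rpow_le_rpow (by positivity) c1 ha)
      rw [Real.div_rpow hr2pos.le (by norm_num)]
      gcongr
      calc (2 : ℝ) ^ a ≤ 2 ^ (2 : ℝ) := Real.rpow_le_rpow_of_exponent_le (by norm_num) ha2
        _ = 4 := by rw [Real.rpow_two]; norm_num
    have c3 := c2 (13 / 10) (by norm_num) (by norm_num)
    have c4 := c2 (1 / 5) (by norm_num) (by norm_num)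
    have c5 : 0 ≤ r₂ ^ (13 / 10 : ℝ) := by positivity
    have c6 : 0 ≤ r₂ ^ (1 / 5 : ℝ) := by positivity
    refine ⟨c1, ?_, ?_⟩
    · rw [hT]; linarith
    · linarith
  have w2 : |r₂ ^ 2 - r₂ ^ 2| ≤ T := by rw [sub_self, abs_zero]; positivity
  obtain ⟨b1, b1', b1''⟩ := hclose r₁ g1 c21.le
  obtain ⟨b2, b2', b2''⟩ := hclose r₂ g2 w2
  obtain ⟨b3, b3', b3''⟩ := hclose r₃ g3 c23.le
  have hsum : (p₁.1 : ℝ) / l + p₂.1 / l + p₃.1 / l = 0 := by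
    rw [← hp]
    simp only [Prod.fst_sub, Prod.fst_neg, Int.cast_sub, Int.cast_neg, sub_div, neg_div]
    ring
  have hcomp : ∀ r x : ℝ, 0 ≤ r → r ^ 2 ≤ 36 * x ^ 2 → r / 6 ≤ |x| := by
    intro r x hr hx
    have : |r| ≤ |6 * x| := sq_le_sq.mp (by rw [mul_pow]; linarith)
    rw [abs_of_nonneg hr, abs_mul, abs_of_pos (by norm_num : (0 : ℝ) < 6)] at this
    linarith
  have c12 := c21
  have c13 := c31
  have c32 := c23
  rw [abs_sub_comm] at c12 c13 c32
  rcases exists_large_component (R := r₂ ^ 2) hsum (rad_sq l p₁) (rad_sq l p₂) (rad_sq l p₃)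
    (by positivity) hT50 rfl c12.le c13.le c23.le with hx | hx | hx
  · have := nearKer_eq (l := l) (a := p₂) (b := p₃) (c := p₁) (by rw [← hp]; abel) (by linarith)
      (hcomp _ _ g1 hx) (c23.le.trans b1') (c21.le.trans b1') (c31.le.trans b1')
    exact b1''.trans (this.symm.le.trans v23)
  · have := nearKer_eq (l := l) (a := p₃) (b := p₁) (c := p₂) (by rw [← hp]; abel) (by linarith)
      (hcomp _ _ g2 hx) (c31.le.trans b2') (c32.le.trans b2') (c12.le.trans b2')
    exact b2''.trans (this.symm.le.trans v31)
  · have := nearKer_eq (l := l) (a := p₂) (b := p₁) (c := p₃) (by rw [← hp]; abel) (by linarith)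
      (hcomp _ _ g3 hx) (c21.le.trans b3') (c23.le.trans b3') (c13.le.trans b3')
    exact b3''.trans (this.symm.le.trans v21)

section

variable {s A N : ℝ} {m : ℝ → ℝ}

/-- The constant of the symbol bound. -/
noncomputable def symConst (A : ℝ) : ℝ := 10 ^ 8 * ((16 * A + 2) ^ 2 + 1)

-- The larger of the second and third frequencies is p₂, so r₁ ≤ 2r₂. The cases are: all moduli at
-- most N; r₃ small; r₁ small; all three comparable. In the middle two a gap kernel between p₃ and
-- p₁ is large of itself.
set_option maxHeartbeats 1000000 in
theorem sq_redSymbol_le_aux (h : IsMultiplier s A N m) (hs : 9 / 10 < s) (hN : 1 ≤ N) (l : ℝ)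
    {p₁ p₂ p₃ : ℤ × ℝ} (hp : -p₁ - p₂ = p₃) (h32 : rad l p₃ ≤ rad l p₂) :
    (rad l p₂ ^ 2 * |1 - m (rad l p₁) / (m (rad l p₂) * m (rad l p₃))| ^ 2) ≤
      symConst A / 100 * (N ^ (-(1 / 5) : ℝ) * ((1 + rad l p₃) ^ 2 *
        (resKer l p₃ p₁ + resKer l p₂ p₁ + resKer l p₂ p₃))) := by
  have h0 : 0 < N := by linarith
  have g1 := rad_nonneg l p₁
  have g2 := rad_nonneg l p₂
  have g3 := rad_nonneg l p₃
  have k31 := resKer_nonneg l p₃ p₁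
  have k21 := resKer_nonneg l p₂ p₁
  have k23 := resKer_nonneg l p₂ p₃
  have q31 := le_gapKer l p₃ p₁
  have n31 := nearKer_nonneg l p₃ p₁
  have t1 := abs_rad_sub_rad_le l p₁ p₂
  rw [hp] at t1
  have t2 : rad l p₁ ≤ rad l p₂ + rad l p₃ := by linarith [(abs_le.mp t1).2]
  set S := resKer l p₃ p₁ + resKer l p₂ p₁ + resKer l p₂ p₃ with hS
  have hS0 : 0 ≤ S := by positivity
  have u31 : gapKer l p₃ p₁ ≤ S :=
    (show gapKer l p₃ p₁ ≤ resKer l p₃ p₁ from le_add_of_nonneg_right n31).trans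
      (show resKer l p₃ p₁ ≤ S by rw [hS]; linarith)
  set r₁ := rad l p₁ with hr₁
  set r₂ := rad l p₂ with hr₂
  set r₃ := rad l p₃ with hr₃
  set P := N ^ (-(1 / 5) : ℝ) with hP
  have hP0 : 0 < P := Real.rpow_pos_of_pos h0 _
  set D := |1 - m r₁ / (m r₂ * m r₃)| ^ 2 with hD
  have hC1 : 10 ^ 6 ≤ symConst A / 100 := by
    unfold symConst
    linarith [sq_nonneg (16 * A + 2)]
  have hC2 : 2 * (2 * (16 * A + 2) ^ 2 + 25) ≤ symConst A / 100 := by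
    unfold symConst
    linarith [sq_nonneg (16 * A + 2)]
  -- All three moduli are then at most N, so m = 1 throughout and the defect vanishes.
  rcases le_or_gt r₂ (N / 2) with hlow | hlow
  · have d0 : D = 0 := by
      rw [hD, h.low r₁ (by linarith), h.low r₂ (by linarith), h.low r₃ (by linarith)]
      norm_num
    rw [d0, mul_zero]
    have : 0 ≤ symConst A / 100 := by linarith
    positivity
  have hr2half : 1 / 2 < r₂ := by linarith
  have hr2pos : 0 < r₂ := by linarith
  rcases le_or_gt r₃ (r₂ / 4) with hR1 | hR1
  · have d1 := h.defect_low hs hN hlow t1 hR1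
    have hgap : r₂ ^ 2 / 2 ≤ |r₃ ^ 2 - r₁ ^ 2| := by
      rw [abs_sub_comm]
      refine le_trans ?_ (le_abs_self _)
      have a0 : 3 / 4 * r₂ ≤ r₁ := by linarith [(abs_le.mp t1).1]
      have a1 := pow_le_pow_left₀ (by positivity) a0 2
      have a2 := pow_le_pow_left₀ g3 hR1 2
      linarith [sq_nonneg r₂]
    have e1 : (1 + r₃) ^ (-(11 / 10) : ℝ) * (r₂ ^ 2 / 2) ≤ S :=
      le_trans (by gcongr) (q31.trans u31)
    have e2 : (1 + r₃) ^ (9 / 10 : ℝ) = (1 + r₃) ^ 2 * (1 + r₃) ^ (-(11 / 10) : ℝ) := by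
      rw [← Real.rpow_two, ← Real.rpow_add (by linarith)]
      norm_num
    calc r₂ ^ 2 * D ≤ r₂ ^ 2 * ((2 * (16 * A + 2) ^ 2 + 25) * (P * (1 + r₃) ^ (9 / 10 : ℝ))) := by
          gcongr
      _ = 2 * (2 * (16 * A + 2) ^ 2 + 25) * (P * ((1 + r₃) ^ 2 *
          ((1 + r₃) ^ (-(11 / 10) : ℝ) * (r₂ ^ 2 / 2)))) := by rw [e2]; ring
      _ ≤ _ := by gcongr
  obtain ⟨d1, d2⟩ := h.defect_high (r₁ := r₁) hs hN hlow h32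
  have hw : ∀ r, 0 ≤ r → r ≤ r₂ →
      r₂ ^ (-(11 / 10) : ℝ) / 9 ≤ (1 + r) ^ (-(11 / 10) : ℝ) := fun r =>
    rpow_div_nine_le hr2half
  have hbr : r₂ ^ 2 / 16 ≤ (1 + r₃) ^ 2 := by
    have a2 := pow_le_pow_left₀ (by positivity) hR1.le 2
    linarith [sq_nonneg r₂]
  -- With r₁ small only the costlier defect bound is available, r₂^{2/5}N^{-2/5}. The gap kernel is
  -- of order r₂^{9/10}, which dominates r₂^{2/5}, and N^{-2/5} ≤ N^{-1/5}.
  rcases le_or_gt r₁ (r₂ / 8) with hR2 | hR2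
  · have hgap : r₂ ^ 2 / 32 ≤ |r₃ ^ 2 - r₁ ^ 2| := by
      refine le_trans ?_ (le_abs_self _)
      have a1 := pow_le_pow_left₀ g1 hR2 2
      have a2 := pow_le_pow_left₀ (by positivity) hR1.le 2
      linarith [sq_nonneg r₂]
    have e1 : r₂ ^ (-(11 / 10) : ℝ) / 9 * (r₂ ^ 2 / 32) ≤ S := by
      refine le_trans ?_ (q31.trans u31)
      exact mul_le_mul (hw r₃ g3 h32) hgap (by positivity) (by positivity)
    have e2 := rpow_two_fifths_le hr2half
    have e3 : N ^ (-(2 / 5) : ℝ) ≤ P :=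
      Real.rpow_le_rpow_of_exponent_le hN (by norm_num)
    calc r₂ ^ 2 * D ≤ r₂ ^ 2 * (50 * ((2 * (r₂ ^ (-(11 / 10) : ℝ) * r₂ ^ 2)) * P)) := by
          gcongr
          refine d1.trans ?_
          gcongr
      _ = 460800 * (P * ((r₂ ^ 2 / 16) * (r₂ ^ (-(11 / 10) : ℝ) / 9 * (r₂ ^ 2 / 32)))) := by ring
      _ ≤ 10 ^ 6 * (P * ((r₂ ^ 2 / 16) * (r₂ ^ (-(11 / 10) : ℝ) / 9 * (r₂ ^ 2 / 32)))) := by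
          gcongr
          norm_num
      _ ≤ _ := by gcongr
  have d3 := d2 hR2.le
  suffices hK : r₂ ^ (1 / 5 : ℝ) / 900 ≤ S by
    calc r₂ ^ 2 * D ≤ r₂ ^ 2 * (50 * (r₂ ^ (1 / 5 : ℝ) * P)) := by gcongr
      _ = 720000 * (P * ((r₂ ^ 2 / 16) * (r₂ ^ (1 / 5 : ℝ) / 900))) := by ring
      _ ≤ 10 ^ 6 * (P * ((r₂ ^ 2 / 16) * (r₂ ^ (1 / 5 : ℝ) / 900))) := by
          gcongr
          norm_num
      _ ≤ _ := by gcongr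
  exact rpow_le_resKer_of_comparable l hp hr2half h32

/-- The symbol is symmetric in ζ₂ and ζ₃, and the four kernels cover either ordering of their
moduli. Of the three derivatives r₁³, two are moved to the larger of these by r₁ ≤ 2r₂; its surplus
r₂² multiplies the squared defect. -/
theorem sq_redSymbol_le (h : IsMultiplier s A N m) (hs : 9 / 10 < s) (hN : 1 ≤ N) (l : ℝ)
    (p₁ p₂ : ℤ × ℝ) :
    redSymbol l m p₁ p₂ ^ 2 ≤ symConst A * N ^ (-(1 / 5) : ℝ) *
      ((radBr l p₁ * radBr l p₂ * radBr l (-p₁ - p₂)) ^ 2 *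
        (resKer l p₂ p₁ + resKer l (-p₁ - p₂) p₁ + resKer l p₂ (-p₁ - p₂) +
          resKer l (-p₁ - p₂) p₂)) := by
  have h0 : 0 < N := by linarith
  have hP0 : 0 < N ^ (-(1 / 5) : ℝ) := Real.rpow_pos_of_pos h0 _
  have hC : 0 ≤ symConst A := by unfold symConst; positivity
  obtain ⟨p₃, hp⟩ : ∃ p₃, -p₁ - p₂ = p₃ := ⟨_, rfl⟩
  have main : ∀ a b : ℤ × ℝ, ∀ S : ℝ, 0 ≤ S → -p₁ - a = b → rad l b ≤ rad l a →
      resKer l b p₁ + resKer l a p₁ + resKer l a b ≤ S →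
      redSymbol l m p₁ a ^ 2 ≤ symConst A * N ^ (-(1 / 5) : ℝ) *
      ((radBr l p₁ * radBr l a * radBr l b) ^ 2 * S) := by
    intro a b S hS0 hab hba hS
    have e := sq_redSymbol_le_aux h hs hN l hab hba
    have g1 := rad_nonneg l p₁
    have g2 := rad_nonneg l a
    have g3 := rad_nonneg l b
    have hr1 : rad l p₁ ≤ 2 * rad l a := by
      have := (abs_le.mp (abs_rad_sub_rad_le l p₁ a)).2
      rw [hab] at this
      linarith
    unfold redSymbol
    rw [hab]
    set D := 1 - m (rad l p₁) / (m (rad l a) * m (rad l b)) with hD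
    have f1 : p₁.2 ^ 2 ≤ rad l p₁ ^ 2 := by
      rw [rad_sq]; linarith [sq_nonneg p₁.2, sq_nonneg ((p₁.1 : ℝ) / l)]
    have f2 : p₁.2 ^ 2 + (p₁.1 / l) ^ 2 ≤ rad l p₁ ^ 2 := by
      rw [rad_sq]; linarith [sq_nonneg p₁.2]
    calc (p₁.2 * (p₁.2 ^ 2 + (p₁.1 / l) ^ 2) * D) ^ 2
        = p₁.2 ^ 2 * (p₁.2 ^ 2 + (p₁.1 / l) ^ 2) ^ 2 * |D| ^ 2 := by rw [sq_abs]; ring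
      _ ≤ rad l p₁ ^ 2 * (rad l p₁ ^ 2) ^ 2 * |D| ^ 2 := by gcongr
      _ ≤ rad l p₁ ^ 2 * ((2 * rad l a) ^ 2) ^ 2 * |D| ^ 2 := by gcongr
      _ = 16 * (rad l p₁ ^ 2 * rad l a ^ 2) * (rad l a ^ 2 * |D| ^ 2) := by ring
      _ ≤ 16 * (rad l p₁ ^ 2 * rad l a ^ 2) * (symConst A / 100 * (N ^ (-(1 / 5) : ℝ) *
          ((1 + rad l b) ^ 2 * S))) := by
          refine mul_le_mul_of_nonneg_left (e.trans ?_) (by positivity)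
          gcongr
      _ ≤ 16 * (radBr l p₁ ^ 2 * radBr l a ^ 2) * (symConst A / 100 * (N ^ (-(1 / 5) : ℝ) *
          (radBr l b ^ 2 * S))) := by
          unfold radBr
          gcongr <;> linarith
      _ = 16 / 100 * (symConst A * N ^ (-(1 / 5) : ℝ) *
          ((radBr l p₁ * radBr l a * radBr l b) ^ 2 * S)) := by ring
      _ ≤ _ := by
          have : 0 ≤ symConst A * N ^ (-(1 / 5) : ℝ) *
            ((radBr l p₁ * radBr l a * radBr l b) ^ 2 * S) := by positivity
          linarith
  have k1 := resKer_nonneg l p₂ p₁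
  have k2 := resKer_nonneg l p₃ p₁
  have k3 := resKer_nonneg l p₂ p₃
  have k4 := resKer_nonneg l p₃ p₂
  rw [hp]
  rcases le_total (rad l p₃) (rad l p₂) with hle | hle
  · exact main p₂ p₃ _ (by positivity) hp hle (by linarith)
  · have h1 := main p₃ p₂ (resKer l p₂ p₁ + resKer l p₃ p₁ + resKer l p₂ p₃ + resKer l p₃ p₂)
      (by positivity) (by rw [← hp]; abel) hle (by linarith)
    have h2 : redSymbol l m p₁ p₃ = redSymbol l m p₁ p₂ := by
      unfold redSymbol
      rw [show -p₁ - p₃ = p₂ by rw [← hp]; abel, hp, mul_comm (m (rad l p₃))]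
    rw [h2] at h1
    refine h1.trans_eq ?_
    ring

end


variable {l : ℝ} [hl : Fact (1 < l)]

/-! ### The main estimate -/

theorem lintegral_rotate (Φ : ℤ × ℝ → ℤ × ℝ → ℝ≥0∞) :
    ∫⁻ p, ∫⁻ p', Φ p (-p - p') ∂freqMeasure l ∂freqMeasure l =
      ∫⁻ p, ∫⁻ p', Φ p p' ∂freqMeasure l ∂freqMeasure l := by
  congr 1
  funext p
  exact lintegral_neg_sub_eq (Φ p) p

theorem lintegral_add_four {α : Type*} [MeasurableSpace α] {μ : Measure α} {f g h : α → ℝ≥0∞}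
    (hf : Measurable f) (hg : Measurable g) (hh : Measurable h) (k : α → ℝ≥0∞) :
    ∫⁻ x, (f x + g x + h x + k x) ∂μ =
      (∫⁻ x, f x ∂μ) + (∫⁻ x, g x ∂μ) + (∫⁻ x, h x ∂μ) + ∫⁻ x, k x ∂μ := by
  have hfg : Measurable fun x => f x + g x := hf.add hg
  have hfgh : Measurable fun x => f x + g x + h x := hfg.add hh
  rw [lintegral_add_left hfgh, lintegral_add_left hfg, lintegral_add_left hf]

/-- G is symmetric in the three frequencies and the relabellings preserve the measure, so every
placement of the arguments of κ gives the same integral. -/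
theorem lintegral_relabel {κ G : ℤ × ℝ → ℤ × ℝ → ℝ≥0∞}
    (hκ : Measurable fun q : (ℤ × ℝ) × (ℤ × ℝ) => κ q.1 q.2)
    (hG : Measurable fun q : (ℤ × ℝ) × (ℤ × ℝ) => G q.1 q.2)
    (hs : ∀ p p', G p' p = G p p') (hr : ∀ p p', G p (-p - p') = G p p') :
    ∫⁻ p, ∫⁻ p', (κ p' p + κ (-p - p') p + κ p' (-p - p') + κ (-p - p') p') * G p p'
      ∂freqMeasure l ∂freqMeasure l =
      4 * ∫⁻ p, ∫⁻ p', κ p p' * G p p' ∂freqMeasure l ∂freqMeasure l := by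
  set T := ∫⁻ p, ∫⁻ p', κ p p' * G p p' ∂freqMeasure l ∂freqMeasure l with hT
  have m0 : Measurable fun q : (ℤ × ℝ) × (ℤ × ℝ) => κ q.1 q.2 * G q.1 q.2 := hκ.mul hG
  have m1 : Measurable fun q : (ℤ × ℝ) × (ℤ × ℝ) => κ q.2 q.1 * G q.1 q.2 :=
    (hκ.comp measurable_swap).mul hG
  have m2 : Measurable fun q : (ℤ × ℝ) × (ℤ × ℝ) => κ (-q.1 - q.2) q.1 * G q.1 q.2 :=
    (hκ.comp (f := fun q : (ℤ × ℝ) × (ℤ × ℝ) => (-q.1 - q.2, q.1)) (by fun_prop)).mul hG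
  have m3 : Measurable fun q : (ℤ × ℝ) × (ℤ × ℝ) => κ q.2 (-q.1 - q.2) * G q.1 q.2 :=
    (hκ.comp (f := fun q : (ℤ × ℝ) × (ℤ × ℝ) => (q.2, -q.1 - q.2)) (by fun_prop)).mul hG
  have m4 : Measurable fun q : (ℤ × ℝ) × (ℤ × ℝ) => κ (-q.1 - q.2) q.2 * G q.1 q.2 :=
    (hκ.comp (f := fun q : (ℤ × ℝ) × (ℤ × ℝ) => (-q.1 - q.2, q.2)) (by fun_prop)).mul hG
  have i1 : ∫⁻ p, ∫⁻ p', κ p' p * G p p' ∂freqMeasure l ∂freqMeasure l = T := by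
    rw [lintegral_lintegral_swap m1.aemeasurable, hT]
    simp only [hs]
  have i2 : ∫⁻ p, ∫⁻ p', κ (-p - p') p * G p p' ∂freqMeasure l ∂freqMeasure l = T := by
    rw [← i1, ← lintegral_rotate]
    simp only [hr, sub_sub_cancel]
  have i3 : ∫⁻ p, ∫⁻ p', κ p' (-p - p') * G p p' ∂freqMeasure l ∂freqMeasure l = T := by
    rw [lintegral_lintegral_swap m3.aemeasurable, hT]
    have e : ∀ a b : ℤ × ℝ, κ b (-a - b) * G a b = κ b (-b - a) * G b (-b - a) := by
      intro a b
      rw [hr, hs a b, show -a - b = -b - a by abel]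
    calc _ = ∫⁻ b, ∫⁻ a, κ b (-b - a) * G b (-b - a) ∂freqMeasure l ∂freqMeasure l := by
          simp only [e]
      _ = _ := lintegral_rotate fun p p' => κ p p' * G p p'
  have i4 : ∫⁻ p, ∫⁻ p', κ (-p - p') p' * G p p' ∂freqMeasure l ∂freqMeasure l = T := by
    rw [lintegral_lintegral_swap m4.aemeasurable, ← i2]
    have e : ∀ a b : ℤ × ℝ, κ (-a - b) b * G a b = κ (-b - a) b * G b a := by
      intro a b
      rw [hs a b, show -a - b = -b - a by abel]
    simp only [e]
  have hin : ∀ p, ∫⁻ p', (κ p' p + κ (-p - p') p + κ p' (-p - p') + κ (-p - p') p') * G p p'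
      ∂freqMeasure l = (∫⁻ p', κ p' p * G p p' ∂freqMeasure l) +
      (∫⁻ p', κ (-p - p') p * G p p' ∂freqMeasure l) +
      (∫⁻ p', κ p' (-p - p') * G p p' ∂freqMeasure l) +
      ∫⁻ p', κ (-p - p') p' * G p p' ∂freqMeasure l := by
    intro p
    have n1 : Measurable fun p' => κ p' p * G p p' := m1.comp measurable_prodMk_left
    have n2 : Measurable fun p' => κ (-p - p') p * G p p' := m2.comp measurable_prodMk_left
    have n3 : Measurable fun p' => κ p' (-p - p') * G p p' := m3.comp measurable_prodMk_left
    simp only [add_mul]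
    exact lintegral_add_four n1 n2 n3 _
  simp only [hin]
  rw [lintegral_add_four m1.lintegral_prod_right' m2.lintegral_prod_right'
    m3.lintegral_prod_right', i1, i2, i3, i4]
  ring

/-- The square root of the resonance kernel. -/
noncomputable def rootKer (l : ℝ) (p p' : ℤ × ℝ) : ℝ≥0∞ := ENNReal.ofReal √(resKer l p p')

theorem rootKer_measurable (l : ℝ) :
    Measurable fun q : (ℤ × ℝ) × (ℤ × ℝ) => rootKer l q.1 q.2 := by
  unfold rootKer resKer
  exact ((gapKer_measurable l).add (nearKer_measurable l)).sqrt.ennreal_ofReal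

/-- The uniform bound for the kernel integrals. -/
noncomputable def kerConst (b : ℝ) : ℝ≥0∞ :=
  2 * modConst b * gridConst + ENNReal.ofReal 200 * (2 + modConst b)

theorem lintegral_rootKer_le {b : ℝ} (hb : 0 ≤ b) (τ : ℝ) (q₀ : ℤ × ℝ) :
    ∫⁻ p, rootKer l p (q₀ - p) ^ 2 *
      ENNReal.ofReal (bracket (τ - (disp l p + disp l (q₀ - p))) ^ (-(2 * b))) ∂freqMeasure l ≤
      kerConst b := by
  have e : ∀ p, rootKer l p (q₀ - p) ^ 2 *
      ENNReal.ofReal (bracket (τ - (disp l p + disp l (q₀ - p))) ^ (-(2 * b))) =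
      ENNReal.ofReal (gapKer l p (q₀ - p)) *
      ENNReal.ofReal (bracket (τ - (disp l p + disp l (q₀ - p))) ^ (-(2 * b))) +
      ENNReal.ofReal (nearKer l p (q₀ - p)) *
      ENNReal.ofReal (bracket (τ - (disp l p + disp l (q₀ - p))) ^ (-(2 * b))) := by
    intro p
    unfold rootKer
    rw [← ENNReal.ofReal_pow (Real.sqrt_nonneg _), Real.sq_sqrt (resKer_nonneg _ _ _), resKer,
      ENNReal.ofReal_add (gapKer_nonneg _ _ _) (nearKer_nonneg _ _ _), add_mul]
  simp only [e]
  rw [lintegral_add_left]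
  · exact add_le_add (lintegral_gapKer_le b τ q₀) (lintegral_nearKer_le hb τ q₀)
  · exact (((gapKer_measurable l).comp (f := fun p => (p, q₀ - p)) (by fun_prop)).ennreal_ofReal).mul
      (phaseWeight_measurable l b τ q₀)

/-- Square root of the pointwise bound, split by subadditivity so that each kernel can be treated on
its own. Here N^{-1/5} becomes N^{-1/10}. -/
theorem enorm_redSymbol_le {s A N : ℝ} {m : ℝ → ℝ} (h : IsMultiplier s A N m) (hs : 9 / 10 < s)
    (hN : 1 ≤ N) (l : ℝ) (p p' : ℤ × ℝ) :
    ‖redSymbol l m p p'‖ₑ ≤ ENNReal.ofReal √(symConst A * N ^ (-(1 / 5) : ℝ)) *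
      (ENNReal.ofReal (radBr l p * radBr l p' * radBr l (-p - p')) *
      (rootKer l p' p + rootKer l (-p - p') p + rootKer l p' (-p - p') +
        rootKer l (-p - p') p')) := by
  have hsq := sq_redSymbol_le h hs hN l p p'
  have k1 := resKer_nonneg l p' p
  have k2 := resKer_nonneg l (-p - p') p
  have k3 := resKer_nonneg l p' (-p - p')
  have k4 := resKer_nonneg l (-p - p') p'
  have hr : ∀ p, 0 ≤ radBr l p := fun p => zero_le_one.trans (one_le_radBr l p)
  have hb : 0 ≤ radBr l p * radBr l p' * radBr l (-p - p') :=
    mul_nonneg (mul_nonneg (hr _) (hr _)) (hr _)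
  have hC : 0 ≤ symConst A * N ^ (-(1 / 5) : ℝ) := by
    unfold symConst
    have : 0 ≤ N ^ (-(1 / 5) : ℝ) := Real.rpow_nonneg (by linarith) _
    positivity
  unfold rootKer
  rw [← ENNReal.ofReal_add (by positivity) (by positivity),
    ← ENNReal.ofReal_add (by positivity) (by positivity),
    ← ENNReal.ofReal_add (by positivity) (by positivity), ← ENNReal.ofReal_mul hb,
    ← ENNReal.ofReal_mul (by positivity), ← ofReal_norm]
  apply ENNReal.ofReal_le_ofReal
  rw [Real.norm_eq_abs]
  refine (Real.abs_le_sqrt hsq).trans ?_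
  rw [Real.sqrt_mul hC, Real.sqrt_mul (sq_nonneg _), Real.sqrt_sq hb]
  gcongr
  have hadd : ∀ x y : ℝ, 0 ≤ x → 0 ≤ y → √(x + y) ≤ √x + √y := by
    intro x y hx hy
    rw [Real.sqrt_le_left (by positivity)]
    nlinarith [Real.sq_sqrt hx, Real.sq_sqrt hy, Real.sqrt_nonneg x, Real.sqrt_nonneg y,
      mul_nonneg (Real.sqrt_nonneg x) (Real.sqrt_nonneg y)]
  have a1 := hadd _ _ (add_nonneg (add_nonneg k1 k2) k3) k4
  have a2 := hadd _ _ (add_nonneg k1 k2) k3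
  have a3 := hadd _ _ k1 k2
  linarith

/-- The constant in the main estimate. -/
noncomputable def mainConst (A b : ℝ) : ℝ≥0∞ :=
  ENNReal.ofReal (symConst A) * (16 * (modConst b * kerConst b))

theorem mainConst_ne_top (A : ℝ) {b : ℝ} (hb : 1 / 2 < b) : mainConst A b ≠ ⊤ := by
  have h1 := modConst_ne_top hb
  have h2 := gridConst_ne_top
  unfold mainConst kerConst
  finiteness

theorem sq_lintegral_redSymbol_timeKer_le {s A N b : ℝ} {m : ℝ → ℝ} (h : IsMultiplier s A N m)
    (hs : 9 / 10 < s) (hN : 1 ≤ N) (hb : 1 / 2 < b) {F : ℝ → ℤ × ℝ → ℂ}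
    (hF : Measurable fun q : ℝ × (ℤ × ℝ) => F q.1 q.2) (hS : modSq l b F ≠ ⊤) (δ : ℝ) :
    (∫⁻ p, ∫⁻ p', ‖redSymbol l m p p'‖ₑ * ‖timeKer δ F p p'‖ₑ
      ∂freqMeasure l ∂freqMeasure l) ^ 2 ≤
      mainConst A b * ENNReal.ofReal (N ^ (-(1 / 5) : ℝ)) * modSq l b F ^ 3 := by
  set G : ℤ × ℝ → ℤ × ℝ → ℝ≥0∞ := fun p p' =>
    ENNReal.ofReal (radBr l p * radBr l p' * radBr l (-p - p')) * ‖timeKer δ F p p'‖ₑ with hG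
  have hGm : Measurable fun q : (ℤ × ℝ) × (ℤ × ℝ) => G q.1 q.2 := by
    have h1 : Measurable fun q : (ℤ × ℝ) × (ℤ × ℝ) => radBr l q.1 :=
      (radBr_measurable l).comp measurable_fst
    have h2 : Measurable fun q : (ℤ × ℝ) × (ℤ × ℝ) => radBr l q.2 :=
      (radBr_measurable l).comp measurable_snd
    have h3 : Measurable fun q : (ℤ × ℝ) × (ℤ × ℝ) => radBr l (-q.1 - q.2) :=
      (radBr_measurable l).comp (by fun_prop)
    exact ((h1.mul h2).mul h3).ennreal_ofReal.mul (timeKer_measurable δ hF).enorm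
  have hGs : ∀ p p', G p' p = G p p' := by
    intro p p'
    simp only [hG]
    rw [timeKer_comm δ F p' p, mul_comm (radBr l p'), show -p' - p = -p - p' by abel]
  have hGr : ∀ p p', G p (-p - p') = G p p' := by
    intro p p'
    simp only [hG]
    rw [timeKer_rotate δ F p p', sub_sub_cancel, mul_right_comm]
  have hN0 : 0 < N := by linarith
  have hC : 0 ≤ symConst A := by unfold symConst; positivity
  set c := ENNReal.ofReal √(symConst A * N ^ (-(1 / 5) : ℝ)) with hc
  have hc2 : c ^ 2 = ENNReal.ofReal (symConst A) * ENNReal.ofReal (N ^ (-(1 / 5) : ℝ)) := by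
    rw [hc, ← ENNReal.ofReal_pow (Real.sqrt_nonneg _), Real.sq_sqrt (by positivity),
      ENNReal.ofReal_mul hC]
  have hpt : ∀ p p', ‖redSymbol l m p p'‖ₑ * ‖timeKer δ F p p'‖ₑ ≤
      c * ((rootKer l p' p + rootKer l (-p - p') p + rootKer l p' (-p - p') +
        rootKer l (-p - p') p') * G p p') := by
    intro p p'
    refine (mul_le_mul_left (enorm_redSymbol_le h hs hN l p p') _).trans_eq ?_
    simp only [hG]
    ring
  have hT := sq_lintegral_kernel_timeKer_le hb (rootKer_measurable l)
    (fun τ q₀ => lintegral_rootKer_le (by linarith) τ q₀) hF hS δ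
  have hctop : c ≠ ⊤ := ENNReal.ofReal_ne_top
  calc _ ≤ (c * (4 * ∫⁻ p, ∫⁻ p', rootKer l p p' * G p p' ∂freqMeasure l ∂freqMeasure l)) ^ 2 := by
        rw [← lintegral_relabel (rootKer_measurable l) hGm hGs hGr,
          ← lintegral_const_mul' _ _ hctop]
        gcongr with p
        rw [← lintegral_const_mul' _ _ hctop]
        exact lintegral_mono fun p' => hpt p p'
    _ = c ^ 2 * (16 * (∫⁻ p, ∫⁻ p', rootKer l p p' * G p p' ∂freqMeasure l ∂freqMeasure l) ^ 2) := by
        ring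
    _ ≤ c ^ 2 * (16 * (modConst b * kerConst b * modSq l b F ^ 3)) := by
        gcongr
    _ = _ := by
        rw [hc2, mainConst]
        ring


variable {l : ℝ} [hl : Fact (1 < l)]

/-! ### The cubic increment on the Fourier side -/

theorem redSymbol_measurable (l : ℝ) {m : ℝ → ℝ} (hm : Measurable m) :
    Measurable fun q : (ℤ × ℝ) × (ℤ × ℝ) => redSymbol l m q.1 q.2 := by
  unfold redSymbol
  have h1 : Measurable fun p => m (rad l p) := hm.comp (rad_measurable l)
  have h3 : Measurable fun q : (ℤ × ℝ) × (ℤ × ℝ) => m (rad l (-q.1 - q.2)) :=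
    h1.comp (by fun_prop)
  have h4 : Measurable fun q : (ℤ × ℝ) × (ℤ × ℝ) => m (rad l q.1) := h1.comp measurable_fst
  have h5 : Measurable fun q : (ℤ × ℝ) × (ℤ × ℝ) => m (rad l q.2) := h1.comp measurable_snd
  have h6 : Measurable fun q : (ℤ × ℝ) × (ℤ × ℝ) => (q.1.1 : ℝ) / l :=
    (fst_measurable l).comp measurable_fst
  exact ((measurable_snd.comp measurable_fst).mul
    (((measurable_snd.comp measurable_fst).pow_const 2).add (h6.pow_const 2))).mul
    ((h4.div (h5.mul h3)).const_sub 1)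

/-- The density of the cubic increment on the Fourier side. -/
noncomputable def incForm (l : ℝ) (m : ℝ → ℝ) (δ : ℝ) (F : ℝ → ℤ × ℝ → ℂ)
    (q : (ℤ × ℝ) × (ℤ × ℝ)) : ℂ :=
  Complex.I * (redSymbol l m q.1 q.2 : ℂ) * timeKer δ F q.1 q.2

theorem timeInv_section_measurable {F : ℝ → ℤ × ℝ → ℂ}
    (hF : Measurable fun q : ℝ × (ℤ × ℝ) => F q.1 q.2) (t : ℝ) :
    Measurable (timeInv F t) :=
  (timeInv_measurable hF).comp (f := fun p : ℤ × ℝ => (t, p)) (by fun_prop)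

/-- One formula for the truncated increment, with χ the cutoff, and the full one, with χ = 1.
Dividing the symbol by m₁m₂m₃ turns `incSymbol` into `redSymbol`; the H² bound, uniform in time,
justifies exchanging the time integral with the frequency integrals. -/
theorem cubicIncrement_eq {m : ℝ → ℝ} (hm : Measurable m) (hm0 : ∀ r, 0 < m r)
    (hm1 : ∀ r, m r ≤ 1) {χ : ℤ × ℝ → ℝ} (hχ : Measurable χ) {F : ℝ → ℤ × ℝ → ℂ}
    (hF : Measurable fun q : ℝ × (ℤ × ℝ) => F q.1 q.2) {δ : ℝ} (hδ : 0 ≤ δ) {w : ℝ → Cyl l → ℂ}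
    {R : ℝ≥0∞} (hR : R ≠ ⊤)
    (hw : ∀ᵐ t ∂volume.restrict (Set.Icc 0 δ), MemLp (w t) 2 volume ∧
      cylFT (w t) =ᵐ[freqMeasure l] (fun p => ((χ p / m (rad l p) : ℝ) : ℂ) * timeInv F t p) ∧
      sobSq l (fun p => ((χ p / m (rad l p) : ℝ) : ℂ) * timeInv F t p) ≤ R) :
    cubicIncrement l m δ w = (((2 * π) ^ 4)⁻¹ : ℝ) *
      ∫ q : (ℤ × ℝ) × (ℤ × ℝ), ((χ q.1 * χ q.2 * χ (-q.1 - q.2) : ℝ) : ℂ) * incForm l m δ F q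
        ∂(freqMeasure l).prod (freqMeasure l) := by
  have hw' := ae_restrict_of_ae_restrict_of_subset Set.Ioc_subset_Icc_self hw
  have hV := timeInv_measurable hF
  set a : ℤ × ℝ → ℂ := fun p => ((χ p / m (rad l p) : ℝ) : ℂ) with ha
  have ham : Measurable a :=
    Complex.measurable_ofReal.comp (hχ.div (hm.comp (rad_measurable l)))
  have hGm : ∀ t : ℝ, Measurable fun p : ℤ × ℝ => a p * timeInv F t p := by
    intro t
    exact ham.mul (timeInv_section_measurable hF t)
  set S : ℝ → (ℤ × ℝ) × (ℤ × ℝ) → ℂ := fun t q => incSymbol l m q.1 q.2 *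
    (a q.1 * timeInv F t q.1 * (a q.2 * timeInv F t q.2) *
      (a (-q.1 - q.2) * timeInv F t (-q.1 - q.2))) with hS
  have hSm : Measurable fun z : ℝ × ((ℤ × ℝ) × (ℤ × ℝ)) => S z.1 z.2 := by
    have hG : Measurable fun z : ℝ × (ℤ × ℝ) => a z.2 * timeInv F z.1 z.2 :=
      (ham.comp measurable_snd).mul hV
    refine ((incSymbol_measurable hm).comp measurable_snd).mul ?_
    exact ((hG.comp (f := fun z : ℝ × ((ℤ × ℝ) × (ℤ × ℝ)) => (z.1, z.2.1)) (by fun_prop)).mul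
      (hG.comp (f := fun z : ℝ × ((ℤ × ℝ) × (ℤ × ℝ)) => (z.1, z.2.2)) (by fun_prop))).mul
      (hG.comp (f := fun z : ℝ × ((ℤ × ℝ) × (ℤ × ℝ)) => (z.1, -z.2.1 - z.2.2)) (by fun_prop))
  -- Only the square of the frequency integral is bounded; the summand 1 covers the case where that
  -- integral is less than 1.
  set K : ℝ≥0∞ := 1 + 4 * (weightConst l * R ^ 3) with hK
  have hKt : K ≠ ⊤ := by
    refine ENNReal.add_ne_top.mpr ⟨ENNReal.one_ne_top, ENNReal.mul_ne_top (by norm_num)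
      (ENNReal.mul_ne_top ?_ (ENNReal.pow_ne_top hR))⟩
    exact lintegral_radBr_ne_top
  have hSle : ∀ᵐ t ∂volume.restrict (Set.Ioc 0 δ),
      ∫⁻ q, ‖S t q‖ₑ ∂(freqMeasure l).prod (freqMeasure l) ≤ K := by
    filter_upwards [hw'] with t ht
    have h1 := lintegral_incSymbol_le (l := l) (fun r => (hm0 r).le) hm1 (hGm t)
    have hSt : Measurable (S t) :=
      hSm.comp (f := fun q : (ℤ × ℝ) × (ℤ × ℝ) => (t, q)) (by fun_prop)
    rw [lintegral_prod _ hSt.enorm.aemeasurable]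
    set x := ∫⁻ p, ∫⁻ p', ‖S t (p, p')‖ₑ ∂freqMeasure l ∂freqMeasure l with hx
    have h2 : x ^ 2 ≤ 4 * (weightConst l * R ^ 3) := h1.trans (by gcongr; exact ht.2.2)
    rcases le_total x 1 with h3 | h3
    · exact h3.trans le_self_add
    · exact ((le_self_pow h3 two_ne_zero).trans h2).trans le_add_self
  have hSi : Integrable (fun z : ℝ × ((ℤ × ℝ) × (ℤ × ℝ)) => S z.1 z.2)
      ((volume.restrict (Set.Ioc 0 δ)).prod ((freqMeasure l).prod (freqMeasure l))) := by
    refine ⟨hSm.aestronglyMeasurable, ?_⟩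
    rw [HasFiniteIntegral, lintegral_prod _ hSm.enorm.aemeasurable]
    refine (lintegral_mono_ae hSle).trans_lt ?_
    rw [lintegral_const, Measure.restrict_apply_univ, Real.volume_Ioc]
    exact ENNReal.mul_lt_top hKt.lt_top ENNReal.ofReal_lt_top
  have hinc : ∀ᵐ t ∂volume.restrict (Set.Ioc 0 δ), incDensity l m (w t) =
      (((2 * π) ^ 4)⁻¹ : ℝ) * ∫ q, S t q ∂(freqMeasure l).prod (freqMeasure l) := by
    filter_upwards [hw', hSi.prod_right_ae] with t ht hi
    rw [incDensity_eq hm (fun r => (hm0 r).le) hm1 ht.1 (hGm t) ht.2.1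
      (ne_top_of_le_ne_top hR ht.2.2), integral_prod _ hi]
  have hred : ∀ t q, S t q = ((χ q.1 * χ q.2 * χ (-q.1 - q.2) : ℝ) : ℂ) *
      (Complex.I * (redSymbol l m q.1 q.2 : ℂ)) *
      (timeInv F t q.1 * timeInv F t q.2 * timeInv F t (-q.1 - q.2)) := by
    intro t q
    have n1 : (m (rad l q.1) : ℂ) ≠ 0 := Complex.ofReal_ne_zero.mpr (hm0 _).ne'
    have n2 : (m (rad l q.2) : ℂ) ≠ 0 := Complex.ofReal_ne_zero.mpr (hm0 _).ne'
    have n3 : (m (rad l (-q.1 - q.2)) : ℂ) ≠ 0 := Complex.ofReal_ne_zero.mpr (hm0 _).ne'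
    simp only [hS, ha, incSymbol, redSymbol]
    push_cast
    field_simp
  have hcub : cubicIncrement l m δ w = ∫ t in Set.Ioc 0 δ, incDensity l m (w t) :=
    intervalIntegral.integral_of_le hδ
  rw [hcub, integral_congr_ae hinc, integral_const_mul, integral_integral_swap hSi]
  congr 2
  funext q
  simp only [hred]
  rw [integral_const_mul]
  unfold incForm timeKer
  ring

/-- As m never vanishes, the transform of u(t) is recovered from any extension of Iu, at almost
every time of the window. -/
theorem cylFT_eq_of_extension {s A N b δ : ℝ} {m : ℝ → ℝ} (h : IsMultiplier s A N m) (hN : 1 ≤ N)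
    (hb : 1 / 2 < b) {u v : ℝ → Cyl l → ℂ}
    (hu : MemLp (fun p : ℝ × Cyl l => u p.1 p.2) 2
      ((volume.restrict (Set.Icc 0 δ)).prod volume))
    (hv : bourgainNorm l 1 b v ≠ ⊤)
    (huv : ∀ᵐ t ∂volume.restrict (Set.Icc 0 δ), v t =ᵐ[volume] opI l m (u t)) :
    ∀ᵐ t ∂volume.restrict (Set.Icc 0 δ), MemLp (u t) 2 volume ∧
      cylFT (u t) =ᵐ[freqMeasure l]
        fun p => ((1 / m (rad l p) : ℝ) : ℂ) * timeInv (stHat v) t p := by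
  filter_upwards [ae_memLp_section hu, huv, ae_restrict_of_ae (cylFT_ae_eq_timeInv hb hv)]
    with t h1 h2 h3
  refine ⟨h1, ?_⟩
  have hG : Measurable fun p => (m (rad l p) : ℂ) * cylFT (u t) p :=
    (Complex.measurable_ofReal.comp (h.smooth.continuous.measurable.comp (rad_measurable l))).mul
      (cylFT_measurable _)
  have hGl : MemLp (fun p => (m (rad l p) : ℂ) * cylFT (u t) p) 2 (freqMeasure l) :=
    (memLp_cylFT h1).mono hG.aestronglyMeasurable (ae_of_all _ fun p => by
      rw [norm_mul, Complex.norm_real, Real.norm_of_nonneg (h.pos hN _).le]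
      exact mul_le_of_le_one_left (norm_nonneg _) (h.le_one _))
  have h4 := (fourierMul_spec (fun ξ q => (m (freqNorm ξ q) : ℂ)) (u t) hG hGl
    (EventuallyEq.refl _ _)).2
  have h5 : cylFT (v t) = cylFT (opI l m (u t)) := cylFT_congr h2
  filter_upwards [h3.2, h4] with p h6 h7
  have h8 : (m (rad l p) : ℂ) ≠ 0 := Complex.ofReal_ne_zero.mpr (h.pos hN _).ne'
  rw [← h6, h5]
  unfold opI
  rw [h7]
  push_cast
  field_simp

theorem enorm_timeInv_le (F : ℝ → ℤ × ℝ → ℂ) (t : ℝ) (p : ℤ × ℝ) :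
    ‖timeInv F t p‖ₑ ≤ ∫⁻ τ, ‖F τ p‖ₑ := by
  refine (enorm_invFourierIntegral_le _ t).trans (mul_le_of_le_one_left' ?_)
  rw [ENNReal.ofReal_le_one]
  exact inv_le_one_of_one_le₀ (by nlinarith [pi_gt_three])

/-- The symbol of the sharp truncation. -/
noncomputable def cutoff (l M : ℝ) (p : ℤ × ℝ) : ℝ := if rad l p ≤ M then 1 else 0

theorem cutoff_measurable (l M : ℝ) : Measurable (cutoff l M) :=
  Measurable.ite (measurableSet_le (rad_measurable l) measurable_const) measurable_const
    measurable_const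

theorem abs_cutoff_le (l M : ℝ) (p : ℤ × ℝ) : |cutoff l M p| ≤ 1 := by
  unfold cutoff
  split_ifs <;> simp

/-- On the support of the cutoff all weights are bounded and m ≥ m(|M|). The constant grows with M,
but only its finiteness and uniformity in t are used. -/
theorem sobSq_cutoff_le {s A N b : ℝ} {m : ℝ → ℝ} (h : IsMultiplier s A N m) (hN : 1 ≤ N)
    {F : ℝ → ℤ × ℝ → ℂ} (hF : Measurable fun q : ℝ × (ℤ × ℝ) => F q.1 q.2) (M t : ℝ) :
    sobSq l (fun p => ((cutoff l M p / m (rad l p) : ℝ) : ℂ) * timeInv F t p) ≤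
      ENNReal.ofReal ((1 + |M|) / m |M|) ^ 2 * (modConst b * modSq l b F) := by
  refine le_trans ?_ (mul_le_mul_right (lintegral_sq_lintegral_le_modSq hF b) _)
  rw [← lintegral_const_mul' _ _ (ENNReal.pow_ne_top ENNReal.ofReal_ne_top)]
  refine lintegral_mono fun p => ?_
  rw [← mul_pow]
  refine pow_le_pow_left' ?_ 2
  have hr := zero_le_one.trans (one_le_radBr l p)
  have hm := h.pos hN
  rw [enorm_mul, ← mul_assoc, ← mul_assoc]
  refine mul_le_mul' ?_ (enorm_timeInv_le F t p)
  rw [← ofReal_norm, ← ENNReal.ofReal_mul (by positivity),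
    ← ENNReal.ofReal_mul (div_nonneg (by positivity) (hm _).le)]
  apply ENNReal.ofReal_le_ofReal
  rw [Complex.norm_real]
  unfold cutoff
  split_ifs with hp
  · have h1 : rad l p ≤ |M| := hp.trans (le_abs_self M)
    have h2 := h.antitone h1
    rw [Real.norm_of_nonneg (div_nonneg zero_le_one (hm _).le), sq, mul_assoc, mul_comm,
      mul_one_div]
    refine mul_le_mul_of_nonneg_right ?_ hr
    refine div_le_div₀ (by positivity) ?_ (hm _) h2
    unfold radBr
    linarith
  · rw [zero_div, norm_zero, mul_zero]
    exact mul_nonneg (div_nonneg (by positivity) (hm _).le) hr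

theorem sobSq_cylFT {f : Cyl l → ℂ} (hf : MemLp f 2 volume) :
    sobSq l (cylFT f) = ENNReal.ofReal (2 * π) * sobolevNorm l 2 f ^ 2 := by
  unfold sobolevNorm sobSq
  rw [if_pos hf, ← ENNReal.rpow_natCast, ← ENNReal.rpow_mul,
    show (1 / 2 : ℝ) * ((2 : ℕ) : ℝ) = 1 by norm_num, ENNReal.rpow_one,
    lintegral_freqMeasure l ((weight_measurable (cylFT_measurable f)).pow_const 2), ← mul_assoc,
    ← ENNReal.ofReal_mul two_pi_pos.le]
  congr 2
  · have := two_pi_pos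
    rw [mul_inv, mul_inv_cancel_left₀ this.ne']
  · funext k
    congr 1
    funext ξ
    have e := radBr_eq l (k, ξ)
    simp only at e
    rw [e, mul_pow, ← ENNReal.ofReal_pow (by positivity), ← pow_mul,
      show (2 : ℝ) * 2 = ((4 : ℕ) : ℝ) by norm_num, Real.rpow_natCast]
    rfl


variable {l : ℝ} [hl : Fact (1 < l)]

/-! ### The limit of the truncated increments -/

theorem incForm_measurable (l : ℝ) {m : ℝ → ℝ} (hm : Measurable m) (δ : ℝ) {F : ℝ → ℤ × ℝ → ℂ}
    (hF : Measurable fun q : ℝ × (ℤ × ℝ) => F q.1 q.2) : Measurable (incForm l m δ F) :=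
  ((Complex.measurable_ofReal.comp (redSymbol_measurable l hm)).const_mul _).mul
    (timeKer_measurable δ hF)

theorem sq_lintegral_incForm_le {s A N b : ℝ} {m : ℝ → ℝ} (h : IsMultiplier s A N m)
    (hs : 9 / 10 < s) (hN : 1 ≤ N) (hb : 1 / 2 < b) {F : ℝ → ℤ × ℝ → ℂ}
    (hF : Measurable fun q : ℝ × (ℤ × ℝ) => F q.1 q.2) (hS : modSq l b F ≠ ⊤) (δ : ℝ) :
    (∫⁻ q, ‖incForm l m δ F q‖ₑ ∂(freqMeasure l).prod (freqMeasure l)) ^ 2 ≤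
      mainConst A b * ENNReal.ofReal (N ^ (-(1 / 5) : ℝ)) * modSq l b F ^ 3 := by
  refine le_trans (le_of_eq ?_) (sq_lintegral_redSymbol_timeKer_le h hs hN hb hF hS δ)
  rw [lintegral_prod _
    (incForm_measurable l h.smooth.continuous.measurable δ hF).enorm.aemeasurable]
  congr 2
  funext p
  congr 1
  funext p'
  unfold incForm
  rw [enorm_mul, enorm_mul, ← ofReal_norm Complex.I, Complex.norm_I, ENNReal.ofReal_one, one_mul,
    ← ofReal_norm (redSymbol l m p p' : ℂ), Complex.norm_real, ofReal_norm]

theorem truncate_spec {s A N b δ : ℝ} {m : ℝ → ℝ} (h : IsMultiplier s A N m) (hN : 1 ≤ N)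
    (hb : 1 / 2 < b) {u v : ℝ → Cyl l → ℂ}
    (hu : MemLp (fun p : ℝ × Cyl l => u p.1 p.2) 2
      ((volume.restrict (Set.Icc 0 δ)).prod volume))
    (hv : bourgainNorm l 1 b v ≠ ⊤)
    (huv : ∀ᵐ t ∂volume.restrict (Set.Icc 0 δ), v t =ᵐ[volume] opI l m (u t)) (M : ℝ) :
    ∀ᵐ t ∂volume.restrict (Set.Icc 0 δ), MemLp (truncate l M (u t)) 2 volume ∧
      cylFT (truncate l M (u t)) =ᵐ[freqMeasure l]
        fun p => ((cutoff l M p / m (rad l p) : ℝ) : ℂ) * timeInv (stHat v) t p := by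
  filter_upwards [cylFT_eq_of_extension h hN hb hu hv huv] with t ht
  have hG : Measurable fun p =>
      ((cutoff l M p / m (rad l p) : ℝ) : ℂ) * timeInv (stHat v) t p :=
    (Complex.measurable_ofReal.comp ((cutoff_measurable l M).div
      (h.smooth.continuous.measurable.comp (rad_measurable l)))).mul
      (timeInv_section_measurable (stHat_measurable v) t)
  have he : (fun p => (cutoff l M p : ℂ) * cylFT (u t) p) =ᵐ[freqMeasure l]
      fun p => ((cutoff l M p / m (rad l p) : ℝ) : ℂ) * timeInv (stHat v) t p := by
    filter_upwards [ht.2] with p hp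
    rw [hp]
    push_cast
    ring
  have hGl : MemLp (fun p => (cutoff l M p : ℂ) * cylFT (u t) p) 2 (freqMeasure l) :=
    (memLp_cylFT ht.1).mono ((Complex.measurable_ofReal.comp (cutoff_measurable l M)).mul
      (cylFT_measurable _)).aestronglyMeasurable (ae_of_all _ fun p => by
      rw [norm_mul, Complex.norm_real]
      exact mul_le_of_le_one_left (norm_nonneg _) (abs_cutoff_le l M p))
  refine fourierMul_spec _ (u t) hG (hGl.ae_eq he) ?_
  refine EventuallyEq.trans (Eventually.of_forall fun p => ?_) he
  by_cases hp : freqNorm p.2 (p.1 / l) ≤ M <;> simp [cutoff, rad, hp]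

/-- The density `incForm` is integrable by the main estimate and free of M. The truncations multiply
it by factors bounded by 1 that equal 1 once M exceeds the three moduli, so dominated convergence
gives the limit. -/
theorem exists_increment_limit {s A N b δ : ℝ} {m : ℝ → ℝ} (h : IsMultiplier s A N m)
    (hs : 9 / 10 < s) (hN : 1 ≤ N) (hb : 1 / 2 < b) (hδ : 0 ≤ δ) {u v : ℝ → Cyl l → ℂ}
    (hu : MemLp (fun p : ℝ × Cyl l => u p.1 p.2) 2
      ((volume.restrict (Set.Icc 0 δ)).prod volume))
    (hv : bourgainNorm l 1 b v ≠ ⊤)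
    (huv : ∀ᵐ t ∂volume.restrict (Set.Icc 0 δ), v t =ᵐ[volume] opI l m (u t)) :
    ∃ J : ℂ, Tendsto (fun M : ℝ => cubicIncrement l m δ (fun t => truncate l M (u t)))
        atTop (𝓝 J) ∧
      ((∃ R : ℝ, ∀ᵐ t ∂(volume.restrict (Set.Icc 0 δ)),
          sobolevNorm l 2 (u t) ≤ ENNReal.ofReal R) → J = cubicIncrement l m δ u) ∧
      ‖J‖ₑ ^ 2 ≤ mainConst A b * ENNReal.ofReal (N ^ (-(1 / 5) : ℝ)) *
        bourgainNorm l 1 b v ^ 6 := by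
  have hF := stHat_measurable v
  have hm : Measurable m := h.smooth.continuous.measurable
  have hm0 := h.pos hN
  have hS : modSq l b (stHat v) ≠ ⊤ := by
    rw [← bourgainNorm_sq hv]
    exact ENNReal.pow_ne_top hv
  have hbound := sq_lintegral_incForm_le h hs hN hb hF hS δ
  have hfm := incForm_measurable l hm δ hF
  have hint : Integrable (incForm l m δ (stHat v)) ((freqMeasure l).prod (freqMeasure l)) := by
    refine ⟨hfm.aestronglyMeasurable, ?_⟩
    rw [HasFiniteIntegral, lt_top_iff_ne_top]
    intro hc
    rw [hc, ENNReal.top_pow two_ne_zero, top_le_iff] at hbound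
    exact ENNReal.mul_ne_top (ENNReal.mul_ne_top (mainConst_ne_top A hb) ENNReal.ofReal_ne_top)
      (ENNReal.pow_ne_top hS) hbound
  refine ⟨(((2 * π) ^ 4)⁻¹ : ℝ) * ∫ q, incForm l m δ (stHat v) q
    ∂(freqMeasure l).prod (freqMeasure l), ?_, ?_, ?_⟩
  · have hR : ∀ M : ℝ, ENNReal.ofReal ((1 + |M|) / m |M|) ^ 2 *
        (modConst b * modSq l b (stHat v)) ≠ ⊤ := fun M =>
      ENNReal.mul_ne_top (ENNReal.pow_ne_top ENNReal.ofReal_ne_top)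
        (ENNReal.mul_ne_top (modConst_ne_top hb) hS)
    have he : ∀ M : ℝ, cubicIncrement l m δ (fun t => truncate l M (u t)) = _ := fun M =>
      cubicIncrement_eq hm hm0 h.le_one (cutoff_measurable l M) hF hδ (hR M) (by
        filter_upwards [truncate_spec h hN hb hu hv huv M] with t ht
        exact ⟨ht.1, ht.2, sobSq_cutoff_le h hN hF M t⟩)
    simp only [he]
    refine Tendsto.const_mul _ (tendsto_integral_filter_of_dominated_convergence
      (fun q => ‖incForm l m δ (stHat v) q‖) (Eventually.of_forall fun M => ?_)
      (Eventually.of_forall fun M => ae_of_all _ fun q => ?_) hint.norm (ae_of_all _ fun q => ?_))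
    · have hc := cutoff_measurable l M
      refine Measurable.aestronglyMeasurable (Measurable.mul (Complex.measurable_ofReal.comp ?_) hfm)
      exact ((hc.comp measurable_fst).mul (hc.comp measurable_snd)).mul
        (hc.comp (f := fun q : (ℤ × ℝ) × (ℤ × ℝ) => -q.1 - q.2) (by fun_prop))
    · rw [norm_mul, Complex.norm_real, norm_mul, norm_mul]
      refine mul_le_of_le_one_left (norm_nonneg _) ?_
      exact mul_le_one₀ (mul_le_one₀ (abs_cutoff_le l M _) (norm_nonneg _) (abs_cutoff_le l M _))
        (norm_nonneg _) (abs_cutoff_le l M _)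
    · refine tendsto_const_nhds.congr' ?_
      filter_upwards [eventually_ge_atTop (rad l q.1), eventually_ge_atTop (rad l q.2),
        eventually_ge_atTop (rad l (-q.1 - q.2))] with M h1 h2 h3
      simp only [cutoff]
      rw [if_pos h1, if_pos h2, if_pos h3]
      simp
  · rintro ⟨R, hR⟩
    have he := cubicIncrement_eq (w := u) hm hm0 h.le_one (χ := fun _ => 1) measurable_const hF hδ
      (R := ENNReal.ofReal (2 * π) * ENNReal.ofReal R ^ 2)
      (ENNReal.mul_ne_top ENNReal.ofReal_ne_top (ENNReal.pow_ne_top ENNReal.ofReal_ne_top)) (by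
        filter_upwards [cylFT_eq_of_extension h hN hb hu hv huv, hR] with t ht hRt
        refine ⟨ht.1, ht.2, ?_⟩
        calc _ = sobSq l (cylFT (u t)) := by
              refine lintegral_congr_ae ?_
              filter_upwards [ht.2] with p hp
              rw [hp]
          _ ≤ _ := by
              rw [sobSq_cylFT ht.1]
              gcongr)
    rw [he]
    simp
  · rw [show (6 : ℕ) = 2 * 3 from rfl, pow_mul, bourgainNorm_sq hv]
    refine le_trans (pow_le_pow_left' ?_ 2) hbound
    rw [enorm_mul]
    refine (mul_le_of_le_one_left' ?_).trans (enorm_integral_le_lintegral_enorm _)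
    rw [← ofReal_norm, Complex.norm_real, norm_of_nonneg (by positivity), ENNReal.ofReal_le_one]
    exact inv_le_one_of_one_le₀ (one_le_pow₀ (by nlinarith [pi_gt_three]))

/-- The infimum over extensions need not be attained: take an extension whose norm is within η of it
and let η tend to 0. -/
theorem norm_increment_le {N b δ D : ℝ} {J : ℂ} (hN : 0 < N) (hD : 0 ≤ D)
    {w : ℝ → Cyl l → ℂ} (hw : bourgainNormOn l 1 b δ w ≠ ⊤)
    (hJ : ∀ v : ℝ → Cyl l → ℂ, (∀ᵐ t ∂volume.restrict (Set.Icc 0 δ), v t =ᵐ[volume] w t) →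
      bourgainNorm l 1 b v ≠ ⊤ → ‖J‖ₑ ^ 2 ≤
        ENNReal.ofReal D * ENNReal.ofReal (N ^ (-(1 / 5) : ℝ)) * bourgainNorm l 1 b v ^ 6) :
    ‖J‖ ≤ √D * N ^ (-(1 / 10) : ℝ) * (bourgainNormOn l 1 b δ w).toReal ^ 3 := by
  set X := bourgainNormOn l 1 b δ w with hX
  have hη : ∀ η : ℝ, 0 < η → ‖J‖ ≤ √D * N ^ (-(1 / 10) : ℝ) * (X.toReal + η) ^ 3 := by
    intro η hη
    have hx : 0 ≤ X.toReal := ENNReal.toReal_nonneg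
    have hlt : X < ENNReal.ofReal (X.toReal + η) := by
      rw [ENNReal.lt_ofReal_iff_toReal_lt hw]
      linarith
    obtain ⟨v, hv⟩ := iInf_lt_iff.mp hlt
    obtain ⟨hvw, hv⟩ := iInf_lt_iff.mp hv
    have h1 := hJ v hvw hv.ne_top
    have h2 : ‖J‖ₑ ^ 2 ≤ ENNReal.ofReal (D * N ^ (-(1 / 5) : ℝ) * (X.toReal + η) ^ 6) := by
      rw [ENNReal.ofReal_mul (by positivity), ENNReal.ofReal_mul hD,
        ENNReal.ofReal_pow (by positivity)]
      exact h1.trans (by gcongr)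
    rw [← ofReal_norm, ← ENNReal.ofReal_pow (norm_nonneg _),
      ENNReal.ofReal_le_ofReal_iff (by positivity)] at h2
    refine abs_le_of_sq_le_sq' ?_ (by positivity) |>.2
    refine h2.trans_eq ?_
    rw [mul_pow, mul_pow, Real.sq_sqrt hD, ← pow_mul, ← Real.rpow_natCast (N ^ _),
      ← Real.rpow_mul hN.le]
    norm_num
  have hc : Tendsto (fun η : ℝ => √D * N ^ (-(1 / 10) : ℝ) * (X.toReal + η) ^ 3) (𝓝[>] 0)
      (𝓝 (√D * N ^ (-(1 / 10) : ℝ) * (X.toReal + 0) ^ 3)) := by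
    refine tendsto_nhdsWithin_of_tendsto_nhds (Continuous.tendsto ?_ 0)
    fun_prop
  rw [add_zero] at hc
  exact ge_of_tendsto hc (eventually_mem_nhdsWithin.mono fun η hη' => hη η hη')

end ZK

/-- Cubic energy increment. The constant depends only on `s`, `b`, `ε` and the bound `A` for the
profile of the multiplier, not on `λ = l`, `N = 2 ^ n`, `δ` or `u`. -/
theorem lemma4p3 (s b ε A : ℝ) (hs : 9 / 10 < s) (hb : 1 / 2 < b) (hε : 0 < ε) :
    ∃ C : ℝ, ∀ (l : ℝ) [Fact (1 < l)] (n : ℕ) (m : ℝ → ℝ), ZK.IsMultiplier s A ((2 : ℝ) ^ n) m →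
      ∀ (δ : ℝ), 0 < δ → ∀ u : ℝ → ZK.Cyl l → ℂ,
        MemLp (fun p : ℝ × ZK.Cyl l => u p.1 p.2) 2
          ((volume.restrict (Set.Icc 0 δ)).prod volume) →
        ZK.bourgainNormOn l 1 b δ (fun t => ZK.opI l m (u t)) ≠ ⊤ →
        ∃ J : ℂ,
          Tendsto (fun M : ℝ => ZK.cubicIncrement l m δ (fun t => ZK.truncate l M (u t)))
            atTop (𝓝 J) ∧
          ((∃ R : ℝ, ∀ᵐ t ∂(volume.restrict (Set.Icc 0 δ)),
              ZK.sobolevNorm l 2 (u t) ≤ ENNReal.ofReal R) →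
            J = ZK.cubicIncrement l m δ u) ∧
          ‖J‖ ≤ C * ((2 : ℝ) ^ n) ^ (-(1 / 10) + ε) *
            (ZK.bourgainNormOn l 1 b δ (fun t => ZK.opI l m (u t))).toReal ^ 3 := by
  refine ⟨√(ZK.mainConst A b).toReal, ?_⟩
  intro l _ n m h δ hδ u hu hX
  have hN : (1 : ℝ) ≤ 2 ^ n := one_le_pow₀ (by norm_num)
  have hlt := lt_top_iff_ne_top.mpr hX
  obtain ⟨v, hv⟩ := iInf_lt_iff.mp hlt
  obtain ⟨huv, hv⟩ := iInf_lt_iff.mp hv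
  obtain ⟨J, hJ, hJ2, -⟩ := ZK.exists_increment_limit h hs hN hb hδ.le hu hv.ne huv
  refine ⟨J, hJ, hJ2, ?_⟩
  refine (ZK.norm_increment_le (D := (ZK.mainConst A b).toReal) (one_pos.trans_le hN)
    ENNReal.toReal_nonneg hX fun v' huv' hv' => ?_).trans ?_
  · obtain ⟨J', hJ', -, hle⟩ := ZK.exists_increment_limit h hs hN hb hδ.le hu hv' huv'
    -- The truncated increments do not involve the extension, so every extension yields the same
    -- limit and its own bound applies to J.
    rw [tendsto_nhds_unique hJ hJ', ENNReal.ofReal_toReal (ZK.mainConst_ne_top A hb)]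
    exact hle
  -- The estimate holds with N^{-1/10}; since N ≥ 1, adding ε to the exponent only weakens it.
  · gcongr
    linarith
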